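/- **Model.** Fix $N>M\ge 0$, request probabilities $p_1\ge\dots\ge p_N\ge0$ with $\sum_i p_i=1$, and put $\delta=\sum_{i\le M}p_i$; assume $\delta<1$. Let $\alpha\in[0,1]$, $\theta\in(0,1]$, $2<\beta\le4$, $P>0$, $\lambda_b,\lambda_e>0$, and assume the noise power is $\sigma^2=0$ (interference-limited regime). Put $$\lambda_{b_1}=\tfrac{\alpha(1-\delta)}{1-\alpha\delta}\lambda_b,\qquad \lambda_{b_3}=\tfrac{(1-\alpha)(1-\delta)}{1-\alpha\delta}\lambda_b,\qquad \gamma_{th_0}=\tfrac{\theta}{1-\theta}\in(0,\infty]\quad(\gamma_{th_0}=\infty\text{ if }\theta=1).$$ The base stations (BSs) form a homogeneous Poisson point process (PPP) $\Phi_b$ of density $\lambda_b$ on $\mathbb R^2$. Independently, each BS is in state 1 (secure transmission), 2 (normal transmission of a pre-cached file) or 3 (normal transmission of another file) with probabilities $\frac{\alpha(1-\delta)}{1-\alpha\delta}$, $\frac{(1-\alpha)\delta}{1-\alpha\delta}$, $\frac{(1-\alpha)(1-\delta)}{1-\alpha\delta}$; $\Phi_{b_i}$ is the set of BSs in state $i$.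 The typical cache-enabled user is at the origin and is served, by secure transmission, by its nearest BS $b_0$. All small-scale fading power gains $|h|^2$ are $\mathrm{Exp}(1)$. The signal-to-interference-plus-noise ratio (SINR) of the user is $$\gamma_u=\frac{\theta P\,|b_0|^{-\beta}|h_{b_0}|^2}{\theta P\sum_{b\in\Phi_{b_1}\setminus b_0}|b|^{-\beta}|h_b|^2+P\sum_{b\in\Phi_{b_3}\setminus b_0}|b|^{-\beta}|h_b|^2+\sigma^2}.$$ The eavesdroppers form a PPP $\Phi_e=\{e_j\}$ of density $\lambda_e$, and the SINR of $e_j$ is $$\mathrm{SINR}_{e_j}=\frac{\theta P\,|h_{e_j,b_0}|^2|e_j-b_0|^{-\beta}}{P\,I_j+(1-\theta)P\,|h_{e_j,b_0}|^2|e_j-b_0|^{-\beta}+\sigma^2},\qquad I_j=\sum_{b\in\Psi_j}|h_{e_j,b}|^2|e_j-b|^{-\beta},$$ where $\Psi_j$ denotes the BSs other than $b_0$ that interfere at $e_j$. As is customary, $\Psi_j$ is taken to be a PPP of density $\lambda_b$, the fields $\Psi_j$ being independent for different eavesdroppers and independent of the user's link. Explicitly, $\Phi_b$, $\Phi_e$,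 all the $\Psi_j$, all the BS states and all the fading gains are mutually independent. Let $\gamma_e=\sup_j\mathrm{SINR}_{e_j}$. The average secrecy rate of secure transmission is $$\overline{\mathcal C}_{ST}=\mathbb E\big[\max\{\log_2(1+\gamma_u)-\log_2(1+\gamma_e),\,0\}\big].$$ **Theorem.** $\overline{\mathcal C}_{ST}$ is finite, and $$\overline{\mathcal C}_{ST}=\frac1{\ln2}\int_0^{\gamma_{th_0}}\frac{\exp\Big\{-\dfrac{\lambda_e/\lambda_b}{\Gamma(1+\frac2\beta)\Gamma(1-\frac2\beta)\big[\frac{\gamma}{\theta-(1-\theta)\gamma}\big]^{2/\beta}}\Big\}}{(1+\gamma)\big[\mathcal Z(\gamma)\frac{\lambda_{b_1}}{\lambda_b}+\mathcal Z(\frac\gamma\theta)\frac{\lambda_{b_3}}{\lambda_b}+1\big]}\,d\gamma+\frac1{\ln2}\int_{\gamma_{th_0}}^\infty\frac{d\gamma}{(1+\gamma)\big[\mathcal Z(\gamma)\frac{\lambda_{b_1}}{\lambda_b}+\mathcal Z(\frac\gamma\theta)\frac{\lambda_{b_3}}{\lambda_b}+1\big]},$$ where both integrals converge, the second one is $0$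 if $\theta=1$, $\mathcal Z(\gamma)=\frac{2\gamma}{\beta-2}\,{}_2F_1\big[1,1-\frac2\beta;2-\frac2\beta;-\gamma\big]$, and ${}_2F_1$ is the (analytically continued) Gauss hypergeometric function. -/

import Mathlib

open MeasureTheory ProbabilityTheory Set
open scoped ENNReal NNReal

noncomputable section

namespace CacheNet

/-- The Euclidean plane in which all nodes live. -/
abbrev Plane : Type := EuclideanSpace ℝ (Fin 2)

/-! ### Poisson point processes -/

/-- The number of points of the configuration `x` (counted with multiplicity) in `B`. -/
def count (x : ℕ → Plane) (B : Set Plane) : ℕ∞ := {n | x n ∈ B}.encard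

/-- `X 0, X 1, …` is a (measurable) enumeration of the points of a homogeneous Poisson point
process of density `lam` on the plane: the number of points in a Borel set `B` of finite area is
Poisson with mean `lam * area B`, and the numbers of points in disjoint sets are independent. -/
structure IsPoissonProcess {Ω : Type*} [MeasurableSpace Ω] (μ : Measure Ω)
    (X : ℕ → Ω → Plane) (lam : ℝ) : Prop where
  measurable : ∀ n, Measurable (X n)
  count_law : ∀ B : Set Plane, MeasurableSet B → volume B ≠ ∞ → ∀ k : ℕ,
    μ {ω | count (fun n => X n ω) B = k}
      = poissonMeasure (lam * (volume B).toReal).toNNReal {k}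
  indep : ∀ (m : ℕ) (B : Fin m → Set Plane), (∀ i, MeasurableSet (B i)) →
    (∀ i, volume (B i) ≠ ∞) → Pairwise (fun i j => Disjoint (B i) (B j)) →
    iIndepFun (fun i ω => count (fun n => X n ω) (B i)) μ

/-! ### Parameters of the network -/

/-- State of a base station: secure transmission, or normal transmission of a file which is
(respectively is not) one of the pre-cached files. -/
inductive BSState
  | secure
  | normalCached
  | normalUncached

instance : MeasurableSpace BSState := ⊤

/-- Parameters of the network: a library of `N` files with request probabilities `p`, of which the
`M` most popular are pre-cached; the proportion `α` of users with a cache; the fraction `θ` of the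
power that carries the requested file; the path-loss exponent `β`; the transmission power `P`;
the noise power `σ2`; and the densities of base stations and eavesdroppers. -/
structure Params where
  N : ℕ
  M : ℕ
  p : Fin N → ℝ
  α : ℝ
  θ : ℝ
  β : ℝ
  P : ℝ
  σ2 : ℝ
  lamB : ℝ
  lamE : ℝ

namespace Params

variable (c : Params)

/-- The standing assumptions on the parameters. -/
structure Valid : Prop where
  M_lt_N : c.M < c.N
  p_nonneg : ∀ i, 0 ≤ c.p i
  p_antitone : Antitone c.p
  p_sum : ∑ i, c.p i = 1
  α_nonneg : 0 ≤ c.α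
  α_le_one : c.α ≤ 1
  θ_pos : 0 < c.θ
  θ_le_one : c.θ ≤ 1
  two_lt_β : 2 < c.β
  β_le_four : c.β ≤ 4
  P_pos : 0 < c.P
  σ2_nonneg : 0 ≤ c.σ2
  lamB_pos : 0 < c.lamB
  lamE_pos : 0 < c.lamE

/-- Cache hit probability `δ`: a request falls among the `M` most popular files. -/
def δ : ℝ := ∑ i : Fin c.N with i.val < c.M, c.p i

/-- Proportion of all requests which are of the given transmission type; the remaining proportion
`α δ` is served from the user's own cache. -/
def requestShare : BSState → ℝ
  | .secure => c.α * (1 - c.δ)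
  | .normalCached => (1 - c.α) * c.δ
  | .normalUncached => (1 - c.α) * (1 - c.δ)

/-- Probability that a base station, which serves one of the transmission requests chosen
uniformly at random, is in the given state. -/
def stateProb (s : BSState) : ℝ :=
  c.requestShare s /
    (c.requestShare .secure + c.requestShare .normalCached + c.requestShare .normalUncached)

/-- Density of the base stations in secure transmission. -/
def lamB1 : ℝ := c.stateProb .secure * c.lamB

/-- Density of the base stations in normal transmission of a file that is not pre-cached. -/
def lamB3 : ℝ := c.stateProb .normalUncached * c.lamB

/-- The threshold `θ / (1 - θ)`, which is `∞` for `θ = 1`. -/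
def gammaTh0 : ℝ≥0∞ := ENNReal.ofReal c.θ / ENNReal.ofReal (1 - c.θ)

end Params

/-! ### The random network seen from a typical cache-enabled user at the origin -/

/-- The random objects of the network. -/
structure Network (Ω : Type*) where
  /-- locations of the base stations -/
  bs : ℕ → Ω → Plane
  /-- states of the base stations -/
  state : ℕ → Ω → BSState
  /-- power gains of the small-scale fading from the base stations to the typical user -/
  gainU : ℕ → Ω → ℝ
  /-- locations of the eavesdroppers -/
  er : ℕ → Ω → Plane
  /-- power gains of the small-scale fading from the serving base station to the eavesdroppers -/
  gainE : ℕ → Ω → ℝ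
  /-- `field j k`: location of the `k`-th interfering base station in the interference
  at eavesdropper `j` -/
  field : ℕ → ℕ → Ω → Plane
  /-- `gainI j k`: power gain of the small-scale fading from `field j k` to eavesdropper `j` -/
  gainI : ℕ → ℕ → Ω → ℝ

/-- Labels of the independent sources of randomness. -/
inductive Source
  | bs
  | state (n : ℕ)
  | gainU (n : ℕ)
  | er
  | gainE (j : ℕ)
  | field (j : ℕ)
  | gainI (j k : ℕ)

namespace Network

variable {Ω : Type*} (W : Network Ω)

/-- The σ-algebra generated by a source of randomness. -/
def sigma : Source → MeasurableSpace Ω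
  | .bs => ⨆ n, MeasurableSpace.comap (W.bs n) inferInstance
  | .state n => MeasurableSpace.comap (W.state n) inferInstance
  | .gainU n => MeasurableSpace.comap (W.gainU n) inferInstance
  | .er => ⨆ j, MeasurableSpace.comap (W.er j) inferInstance
  | .gainE j => MeasurableSpace.comap (W.gainE j) inferInstance
  | .field j => ⨆ k, MeasurableSpace.comap (W.field j k) inferInstance
  | .gainI j k => MeasurableSpace.comap (W.gainI j k) inferInstance

/-- The probabilistic model. Base stations and eavesdroppers are independent Poisson processes,
the states of the base stations are an independent thinning, all fading gains are
exponential with mean one (Rayleigh fading). The base stations that interfere at an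
eavesdropper are distributed as the (reduced Palm version of the) Poisson process of base
stations, and the interference fields of different eavesdroppers and of the user are
independent. All sources are mutually independent. -/
structure IsModel [MeasurableSpace Ω] (μ : Measure Ω) (c : Params) : Prop where
  bs_poisson : IsPoissonProcess μ W.bs c.lamB
  state_measurable : ∀ n, Measurable (W.state n)
  state_law : ∀ n s, μ {ω | W.state n ω = s} = ENNReal.ofReal (c.stateProb s)
  gainU_law : ∀ n, Measurable (W.gainU n) ∧ μ.map (W.gainU n) = expMeasure 1
  er_poisson : IsPoissonProcess μ W.er c.lamE
  gainE_law : ∀ j, Measurable (W.gainE j) ∧ μ.map (W.gainE j) = expMeasure 1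
  field_poisson : ∀ j, IsPoissonProcess μ (W.field j) c.lamB
  gainI_law : ∀ j k, Measurable (W.gainI j k) ∧ μ.map (W.gainI j k) = expMeasure 1
  indep : iIndep W.sigma μ

/-- Index of the serving base station `b₀`: the base station nearest to the origin. -/
def serving (ω : Ω) : ℕ := sInf {n | ∀ k, ‖W.bs n ω‖ ≤ ‖W.bs k ω‖}

variable (c : Params)

open Classical in
/-- Interference at the typical user from the base stations other than `b₀` in state `s`,
per unit of transmission power. -/
def interferenceU (s : BSState) (ω : Ω) : ℝ≥0∞ :=
  ∑' n, if n ≠ W.serving ω ∧ W.state n ω = s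
    then ENNReal.ofReal (‖W.bs n ω‖ ^ (-c.β) * W.gainU n ω) else 0

/-- SINR `γ_u` of the typical cache-enabled user: the pre-cached component of the signals of
base stations in secure transmission, and all the signals of pre-cached files, are cancelled. -/
def sinrU (ω : Ω) : ℝ≥0∞ :=
  ENNReal.ofReal
      (c.θ * c.P * ‖W.bs (W.serving ω) ω‖ ^ (-c.β) * W.gainU (W.serving ω) ω) /
    (ENNReal.ofReal (c.θ * c.P) * W.interferenceU c .secure ω
      + ENNReal.ofReal c.P * W.interferenceU c .normalUncached ω + ENNReal.ofReal c.σ2)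

/-- Interference at eavesdropper `j` from the base stations other than `b₀`,
per unit of transmission power. -/
def interferenceE (j : ℕ) (ω : Ω) : ℝ≥0∞ :=
  ∑' k, ENNReal.ofReal (dist (W.er j ω) (W.field j k ω) ^ (-c.β) * W.gainI j k ω)

/-- Power received by eavesdropper `j` from `b₀`, per unit of transmission power. -/
def receivedE (j : ℕ) (ω : Ω) : ℝ :=
  W.gainE j ω * dist (W.er j ω) (W.bs (W.serving ω) ω) ^ (-c.β)

/-- SINR of eavesdropper `j`; the pre-cached component of the signal acts as interference. -/
def sinrE (j : ℕ) (ω : Ω) : ℝ≥0∞ :=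
  ENNReal.ofReal (c.θ * c.P * W.receivedE c j ω) /
    (ENNReal.ofReal c.P * W.interferenceE c j ω
      + ENNReal.ofReal ((1 - c.θ) * c.P * W.receivedE c j ω) + ENNReal.ofReal c.σ2)

/-- SINR `γ_e` of the most detrimental eavesdropper. -/
def sinrMaxE (ω : Ω) : ℝ≥0∞ := ⨆ j, W.sinrE c j ω

/-- Instantaneous secrecy rate `[log₂ (1 + γ_u) - log₂ (1 + γ_e)]⁺`. -/
def secrecyRate (ω : Ω) : ℝ :=
  max (Real.logb 2 (1 + (W.sinrU c ω).toReal) - Real.logb 2 (1 + (W.sinrMaxE c ω).toReal)) 0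

end Network

/-! ### The functions in the closed form -/

/-- Gauss hypergeometric function `₂F₁[a, b; c; z]` for `0 < b < c` and real `z < 1`, by Euler's
integral (the power series converges only for `|z| < 1`, and this is its analytic
continuation). -/
def hyp2F1 (a b c z : ℝ) : ℝ :=
  Real.Gamma c / (Real.Gamma b * Real.Gamma (c - b)) *
    ∫ t in (0 : ℝ)..1, t ^ (b - 1) * (1 - t) ^ (c - b - 1) * (1 - z * t) ^ (-a)

namespace Params

variable (c : Params)

/-- `Z(γ) = 2γ/(β-2) · ₂F₁[1, 1-2/β; 2-2/β; -γ]`. -/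
def Z (γ : ℝ) : ℝ :=
  2 * γ / (c.β - 2) * hyp2F1 1 (1 - 2 / c.β) (2 - 2 / c.β) (-γ)

/-- Integrand beyond `γ_th0`. -/
def tailIntegrand (γ : ℝ) : ℝ :=
  1 / ((1 + γ) * (c.Z γ * (c.lamB1 / c.lamB) + c.Z (γ / c.θ) * (c.lamB3 / c.lamB) + 1))

/-- Integrand below `γ_th0`. -/
def headIntegrand (γ : ℝ) : ℝ :=
  Real.exp (-((c.lamE / c.lamB) /
      (Real.Gamma (1 + 2 / c.β) * Real.Gamma (1 - 2 / c.β)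
        * (γ / (c.θ - (1 - c.θ) * γ)) ^ (2 / c.β)))) /
    ((1 + γ) * (c.Z γ * (c.lamB1 / c.lamB) + c.Z (γ / c.θ) * (c.lamB3 / c.lamB) + 1))

/-- The interval `(0, γ_th0)`. -/
def headSet : Set ℝ := {γ | 0 < γ ∧ ENNReal.ofReal γ < c.gammaTh0}

/-- The interval `[γ_th0, ∞)`, empty for `θ = 1`. -/
def tailSet : Set ℝ := {γ | 0 < γ ∧ c.gammaTh0 ≤ ENNReal.ofReal γ}

end Params

end CacheNet

end

/-!
Let `γ_u` and `γ_e` be the SINR of the user and the largest SINR of the eavesdroppers. As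
`log₂ (1 + u) - log₂ (1 + e)` is the integral of `1 / ((1 + γ) ln 2)` over `e ≤ γ < u`, Tonelli
turns the mean secrecy rate into the integral of `ℙ(γ_e ≤ γ < γ_u) / ((1 + γ) ln 2)` over `γ > 0`.

Given the locations of the base stations, the user's link is independent of the eavesdroppers, and
the conditional probability of `γ_e ≤ γ` depends only on the location of the serving station. The
eavesdroppers and their interference are stationary, so it does not depend on that location either,
and the joint probability factors.

For the user, Rayleigh fading makes the conditional probability of `γ_u > γ` equal to
`exp (-∑ f R Xₙ)`, where `R` is the distance of the nearest station and the sum is over the other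
stations. Differentiating the Laplace functional of the Poisson process (along the difference
quotients at `2⁻ᵏ`) gives Mecke's formula; applied to this functional, restricted to the event that
no other station is closer, it yields `1 / (1 + A)`, with `A` the combination of the values of `𝒵`
in the denominator of the integrand.

For the eavesdroppers, the ones whose SINR exceeds `γ` form an independent thinning of a Poisson
process, and a single one at distance `s` exceeds `γ` with probability `exp (-κ s²)`, the Laplace
transform of its interference; the factor `Γ(1 + 2/β) Γ(1 - 2/β)` in `κ` comes from that transform.
Hence none does with probability `exp (-λ_e π / κ)`. The artificial noise bounds the SINR of every
eavesdropper by `θ / (1 - θ)`, so above `γ_th₀` this probability is `1`.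
-/

noncomputable section

namespace CacheNet

open Filter Topology

/-! ### The function `a ↦ exp (-a)` on `[0, ∞]` -/

/-- `exp (-a)` for `a ∈ [0, ∞]`, the shape in which Laplace transforms of interference
appear; the value at `∞` is `0`. -/
def expNeg (a : ℝ≥0∞) : ℝ≥0∞ := EReal.exp (-(a : EReal))

/-- `-log p` for `p ∈ [0, 1]`, extended by `0` to `p ≥ 1`; it turns a product of probabilities
into `expNeg` of a sum. -/
def negLog (p : ℝ≥0∞) : ℝ≥0∞ := (-(ENNReal.log p)).toENNReal

@[simp] lemma expNeg_zero : expNeg 0 = 1 := by simp [expNeg]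

@[simp] lemma expNeg_top : expNeg ∞ = 0 := by simp [expNeg]

lemma expNeg_add (a b : ℝ≥0∞) : expNeg (a + b) = expNeg a * expNeg b := by
  rw [expNeg, EReal.coe_ennreal_add, EReal.neg_add (by simp) (by simp), sub_eq_add_neg,
    EReal.exp_add, expNeg, expNeg]

lemma expNeg_antitone : Antitone expNeg := fun _ _ h =>
  EReal.exp_monotone (EReal.neg_le_neg_iff.2 (EReal.coe_ennreal_le_coe_ennreal_iff.2 h))

lemma expNeg_le_one (a : ℝ≥0∞) : expNeg a ≤ 1 := by
  simpa using expNeg_antitone (zero_le (a := a))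

lemma expNeg_ne_zero {a : ℝ≥0∞} (ha : a ≠ ∞) : expNeg a ≠ 0 := by
  simpa [expNeg, EReal.exp_eq_zero_iff] using ha

lemma continuous_expNeg : Continuous expNeg :=
  ENNReal.continuous_exp.comp (continuous_neg.comp continuous_coe_ennreal_ereal)

@[fun_prop] lemma measurable_expNeg : Measurable expNeg := continuous_expNeg.measurable

lemma expNeg_ofReal {x : ℝ} (hx : 0 ≤ x) :
    expNeg (ENNReal.ofReal x) = ENNReal.ofReal (Real.exp (-x)) := by
  rw [expNeg, EReal.coe_ennreal_ofReal, max_eq_left hx, ← EReal.coe_neg, EReal.exp_coe]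

lemma measurable_negLog : Measurable negLog :=
  measurable_ereal_toENNReal.comp ENNReal.measurable_log.neg

lemma negLog_antitone : Antitone negLog := fun _ _ h =>
  EReal.toENNReal_le_toENNReal (EReal.neg_le_neg_iff.2 (ENNReal.log_monotone h))

@[simp] lemma negLog_one : negLog 1 = 0 := by simp [negLog]

lemma expNeg_negLog {p : ℝ≥0∞} (hp : p ≤ 1) : expNeg (negLog p) = p := by
  have h_nonneg : (0 : EReal) ≤ -(ENNReal.log p) := by
    rw [EReal.le_neg, neg_zero]; simpa using hp
  rw [expNeg, negLog, EReal.coe_toENNReal h_nonneg, neg_neg, ENNReal.exp_log]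

lemma expNeg_sum {ι : Type*} (s : Finset ι) (f : ι → ℝ≥0∞) :
    expNeg (∑ i ∈ s, f i) = ∏ i ∈ s, expNeg (f i) := by
  induction s using Finset.cons_induction with
  | empty => simp
  | cons i s hi ih => rw [Finset.sum_cons hi, Finset.prod_cons hi, expNeg_add, ih]

lemma expNeg_mul_natCast (a : ℝ≥0∞) (k : ℕ) : expNeg (a * k) = expNeg a ^ k := by
  simpa [mul_comm] using expNeg_sum (Finset.range k) fun _ => a

lemma tendsto_prod_expNeg (f : ℕ → ℝ≥0∞) :
    Tendsto (fun N => ∏ n ∈ Finset.range N, expNeg (f n)) atTop (𝓝 (expNeg (∑' n, f n))) := by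
  simp_rw [← expNeg_sum]
  exact (continuous_expNeg.tendsto _).comp ENNReal.summable.hasSum.tendsto_sum_nat

lemma tendsto_tsum_of_monotone {ι : Type*} {g : ℕ → ι → ℝ≥0∞} {f : ι → ℝ≥0∞} (hg : Monotone g)
    (hlim : ∀ i, Tendsto (fun k => g k i) atTop (𝓝 (f i))) :
    Tendsto (fun k => ∑' i, g k i) atTop (𝓝 (∑' i, f i)) := by
  let _ : MeasurableSpace ι := ⊤
  simp_rw [← lintegral_count]
  exact lintegral_tendsto_of_tendsto_of_monotone (fun _ => measurable_from_top.aemeasurable)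
    (ae_of_all _ fun i _ _ hjk => hg hjk i) (ae_of_all _ hlim)

/-! ### The Laplace functional of a Poisson process -/

section

lemma count_eq_tsum (x : ℕ → Plane) (B : Set Plane) :
    (count x B : ℝ≥0∞) = ∑' n, B.indicator (fun _ => (1 : ℝ≥0∞)) (x n) := by
  rw [count, ← ENNReal.tsum_set_one, tsum_subtype {n | x n ∈ B} (fun _ => (1 : ℝ≥0∞))]
  rfl

lemma tsum_indicator_eq_mul_count (x : ℕ → Plane) (B : Set Plane) (a : ℝ≥0∞) :
    ∑' n, B.indicator (fun _ => a) (x n) = a * count x B := by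
  rw [count_eq_tsum, ← ENNReal.tsum_mul_left]
  congr 1 with n
  by_cases h : x n ∈ B <;> simp [h]

lemma indicator_comp_simpleFunc_eq_sum {α β : Type*} [MeasurableSpace α] (f : SimpleFunc α β)
    (φ : β → ℝ≥0∞) (D : Set α) (x : α) :
    D.indicator (fun x => φ (f x)) x
      = ∑ y : f.range, (f ⁻¹' {(y : β)} ∩ D).indicator (fun _ => φ y) x := by
  rw [Finset.sum_eq_single ⟨f x, f.mem_range_self x⟩]
  · by_cases hx : x ∈ D <;> simp [hx]
  · intro y _ hy
    exact Set.indicator_of_notMem (fun hx => hy (Subtype.ext hx.1.symm)) _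
  · simp

lemma exists_simpleFunc_indicator_ball_tendsto {f : Plane → ℝ≥0∞} (hf : Measurable f) :
    ∃ g : ℕ → SimpleFunc Plane ℝ≥0∞,
      Monotone (fun k : ℕ => (Metric.ball (0 : Plane) k).indicator (g k)) ∧
      ∀ x, Tendsto (fun k : ℕ => (Metric.ball (0 : Plane) k).indicator (g k) x) atTop
        (𝓝 (f x)) := by
  refine ⟨SimpleFunc.eapprox f, fun j k hjk x => ?_, fun x => ?_⟩
  · refine (Set.indicator_le_indicator_of_subset
      (Metric.ball_subset_ball (Nat.cast_le.2 hjk)) (fun _ => zero_le) x).trans ?_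
    exact Set.indicator_le_indicator (SimpleFunc.monotone_eapprox f hjk x)
  · have hlim : Tendsto (fun k => SimpleFunc.eapprox f k x) atTop (𝓝 (f x)) := by
      rw [← SimpleFunc.iSup_eapprox_apply hf x]
      exact tendsto_atTop_iSup fun j k hjk => SimpleFunc.monotone_eapprox f hjk x
    obtain ⟨N, hN⟩ := exists_nat_gt ‖x‖
    refine hlim.congr' ?_
    filter_upwards [eventually_ge_atTop N] with k hk
    rw [Set.indicator_of_mem]
    exact mem_ball_zero_iff.2 (hN.trans_le (by exact_mod_cast hk))

variable {Ω : Type*} [MeasurableSpace Ω] {μ : Measure Ω} {X : ℕ → Ω → Plane} {lam : ℝ}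

lemma measurable_count (hX : ∀ n, Measurable (X n)) {B : Set Plane} (hB : MeasurableSet B) :
    Measurable fun ω => count (fun n => X n ω) B := by
  have h_coe : Measurable fun ω => (count (fun n => X n ω) B : ℝ≥0∞) := by
    simp_rw [count_eq_tsum]
    exact Measurable.tsum fun n => (measurable_const.indicator hB).comp (hX n)
  refine measurable_to_countable' fun y => ?_
  convert h_coe (measurableSet_singleton (y : ℝ≥0∞)) using 1
  ext ω
  simp

lemma IsPoissonProcess.ae_count_ne_top [IsProbabilityMeasure μ] (h : IsPoissonProcess μ X lam)
    {B : Set Plane} (hB : MeasurableSet B) (hBv : volume B ≠ ∞) :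
    ∀ᵐ ω ∂μ, count (fun n => X n ω) B ≠ ⊤ := by
  have hmk (k : ℕ) : MeasurableSet {ω | count (fun n => X n ω) B = k} :=
    measurable_count h.measurable hB (measurableSet_singleton _)
  have hset : {ω | count (fun n => X n ω) B ≠ ⊤} = ⋃ k : ℕ, {ω | count (fun n => X n ω) B = k} := by
    ext ω
    simp only [mem_ofPred_eq, mem_iUnion, ENat.ne_top_iff_exists, eq_comm]
  have hdisj : Pairwise (Function.onFun Disjoint
      fun k : ℕ => {ω | count (fun n => X n ω) B = k}) := fun i j hij =>
    Set.disjoint_left.2 fun ω hi hj => hij (by exact_mod_cast hi.symm.trans hj)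
  have hone : μ {ω | count (fun n => X n ω) B ≠ ⊤} = 1 := by
    rw [hset, measure_iUnion hdisj hmk]
    simp_rw [h.count_law B hB hBv]
    rw [← measure_univ (μ := poissonMeasure (lam * (volume B).toReal).toNNReal),
      ← Measure.tsum_indicator_apply_singleton _ _ MeasurableSet.univ]
    simp
  rwa [← prob_compl_eq_zero_iff (by rw [hset]; exact .iUnion hmk)] at hone

lemma tsum_poissonMeasure_mul_pow {r : ℝ} (hr : 0 ≤ r) {p : ℝ≥0∞} (hp : p ≤ 1) :
    ∑' k : ℕ, poissonMeasure r.toNNReal {k} * p ^ k = expNeg (ENNReal.ofReal r * (1 - p)) := by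
  lift p to ℝ≥0 using ne_top_of_le_ne_top ENNReal.one_ne_top hp
  have hp1 : (p : ℝ) ≤ 1 := by exact_mod_cast hp
  have hterm (k : ℕ) : poissonMeasure r.toNNReal {k} * (p : ℝ≥0∞) ^ k
      = ENNReal.ofReal (Real.exp (-r) * ((r * p) ^ k / k.factorial)) := by
    rw [poissonMeasure_singleton, Real.coe_toNNReal _ hr, ← ENNReal.ofReal_coe_nnreal,
      ← ENNReal.ofReal_pow p.coe_nonneg, ← ENNReal.ofReal_mul (by positivity)]
    congr 1
    rw [mul_pow]; ring
  have hseries : HasSum (fun k : ℕ => Real.exp (-r) * ((r * p) ^ k / k.factorial))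
      (Real.exp (-r) * Real.exp (r * p)) := by
    have := NormedSpace.expSeries_div_hasSum_exp (r * p : ℝ)
    rw [← Real.exp_eq_exp_ℝ] at this
    exact this.mul_left _
  have hexponent : ENNReal.ofReal r * (1 - (p : ℝ≥0∞)) = ENNReal.ofReal (r * (1 - p)) := by
    rw [ENNReal.ofReal_mul hr, ENNReal.ofReal_sub _ p.coe_nonneg]; simp
  simp_rw [hterm]
  rw [← ENNReal.ofReal_tsum_of_nonneg (fun k => by positivity) hseries.summable, hseries.tsum_eq,
    ← Real.exp_add, hexponent, expNeg_ofReal (mul_nonneg hr (by linarith))]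
  congr 2; ring

lemma IsPoissonProcess.lintegral_expNeg_mul_count [IsProbabilityMeasure μ]
    (h : IsPoissonProcess μ X lam) (hlam : 0 ≤ lam)
    {B : Set Plane} (hB : MeasurableSet B) (hBv : volume B ≠ ∞) (a : ℝ≥0∞) :
    ∫⁻ ω, expNeg (a * count (fun n => X n ω) B) ∂μ
      = expNeg (ENNReal.ofReal lam * (volume B * (1 - expNeg a))) := by
  have hmk (k : ℕ) : MeasurableSet {ω | count (fun n => X n ω) B = k} :=
    measurable_count h.measurable hB (measurableSet_singleton _)
  have hsplit : ∫⁻ ω, expNeg (a * count (fun n => X n ω) B) ∂μ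
      = ∫⁻ ω, ∑' k : ℕ, {ω | count (fun n => X n ω) B = k}.indicator
          (fun _ => expNeg a ^ k) ω ∂μ := by
    refine lintegral_congr_ae ?_
    filter_upwards [h.ae_count_ne_top hB hBv] with ω hω
    obtain ⟨k, hk⟩ := ENat.ne_top_iff_exists.1 hω
    rw [tsum_eq_single k, Set.indicator_of_mem (by exact hk.symm), ← hk]
    · simp [expNeg_mul_natCast]
    · exact fun j hj => Set.indicator_of_notMem
        (fun hj' => hj (by exact_mod_cast hj'.symm.trans hk.symm)) _
  rw [hsplit, lintegral_tsum fun k => (measurable_const.indicator (hmk k)).aemeasurable]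
  simp_rw [lintegral_indicator_const (hmk _), h.count_law B hB hBv, mul_comm (_ ^ _)]
  rw [tsum_poissonMeasure_mul_pow (by positivity) (expNeg_le_one a), ENNReal.ofReal_mul hlam,
    ENNReal.ofReal_toReal hBv, mul_assoc]

lemma IsPoissonProcess.iIndepFun_count {ι : Type*} [Finite ι] (h : IsPoissonProcess μ X lam)
    {B : ι → Set Plane} (hB : ∀ i, MeasurableSet (B i)) (hBv : ∀ i, volume (B i) ≠ ∞)
    (hBd : Pairwise fun i j => Disjoint (B i) (B j)) :
    iIndepFun (fun i ω => count (fun n => X n ω) (B i)) μ := by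
  obtain ⟨m, ⟨e⟩⟩ := Finite.exists_equiv_fin ι
  have hfin := h.indep m (B ∘ e.symm) (fun i => hB _) (fun i => hBv _)
    fun i j hij => hBd (e.symm.injective.ne hij)
  simpa using hfin.precomp e.injective

lemma IsPoissonProcess.lintegral_expNeg_sum_mul_count [IsProbabilityMeasure μ] {ι : Type*}
    [Fintype ι] (h : IsPoissonProcess μ X lam) (hlam : 0 ≤ lam)
    {B : ι → Set Plane} (hB : ∀ i, MeasurableSet (B i)) (hBv : ∀ i, volume (B i) ≠ ∞)
    (hBd : Pairwise fun i j => Disjoint (B i) (B j)) (a : ι → ℝ≥0∞) :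
    ∫⁻ ω, expNeg (∑ i, a i * count (fun n => X n ω) (B i)) ∂μ
      = expNeg (ENNReal.ofReal lam * ∑ i, volume (B i) * (1 - expNeg (a i))) := by
  have hg (i : ι) : Measurable fun y : ℕ∞ => expNeg (a i * y) := measurable_from_top
  have hprod := lintegral_prod_eq_prod_lintegral_of_indepFun Finset.univ _
    ((h.iIndepFun_count hB hBv hBd).comp _ hg)
    fun i => (hg i).comp (measurable_count h.measurable (hB i))
  simp_rw [Finset.mul_sum, expNeg_sum, ← h.lintegral_expNeg_mul_count hlam (hB _) (hBv _)]
  exact hprod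

lemma IsPoissonProcess.lintegral_expNeg_tsum_indicator_simpleFunc [IsProbabilityMeasure μ]
    (h : IsPoissonProcess μ X lam) (hlam : 0 ≤ lam) (f : SimpleFunc Plane ℝ≥0∞)
    {D : Set Plane} (hD : MeasurableSet D) (hDv : volume D ≠ ∞) :
    ∫⁻ ω, expNeg (∑' n, D.indicator f (X n ω)) ∂μ
      = expNeg (ENNReal.ofReal lam * ∫⁻ x, (1 - expNeg (D.indicator f x))) := by
  let B : f.range → Set Plane := fun y => f ⁻¹' {(y : ℝ≥0∞)} ∩ D
  have hB (y) : MeasurableSet (B y) := (f.measurableSet_preimage _).inter hD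
  have hBv (y) : volume (B y) ≠ ∞ := ne_top_of_le_ne_top hDv (measure_mono inter_subset_right)
  have hBd : Pairwise fun y z => Disjoint (B y) (B z) := fun y z hyz =>
    Set.disjoint_left.2 fun x hy hz => hyz (Subtype.ext (hy.1.symm.trans hz.1))
  have hsum (ω) : ∑' n, D.indicator f (X n ω)
      = ∑ y : f.range, (y : ℝ≥0∞) * count (fun n => X n ω) (B y) := by
    simp_rw [← tsum_indicator_eq_mul_count, ← Summable.tsum_finsetSum fun _ _ => ENNReal.summable]
    exact tsum_congr fun n => indicator_comp_simpleFunc_eq_sum f id D (X n ω)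
  have hint : ∫⁻ x, (1 - expNeg (D.indicator f x))
      = ∑ y : f.range, volume (B y) * (1 - expNeg y) := by
    have hpoint (x) : 1 - expNeg (D.indicator f x)
        = ∑ y : f.range, (B y).indicator (fun _ => 1 - expNeg y) x := by
      rw [← indicator_comp_simpleFunc_eq_sum f (fun y => 1 - expNeg y) D x]
      by_cases hx : x ∈ D <;> simp [hx]
    simp_rw [hpoint]
    rw [lintegral_finsetSum _ fun y _ => measurable_const.indicator (hB y)]
    simp_rw [lintegral_indicator_const (hB _), mul_comm]
  simp_rw [hsum, hint]
  exact h.lintegral_expNeg_sum_mul_count hlam hB hBv hBd _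

/-- The value `exp (-λ ∫ (1 - exp (-f)))` of the Laplace functional `𝔼 exp (-∑ₙ f (Xₙ))` of a
Poisson process `X` of density `λ`. -/
def laplaceFunctional (lam : ℝ) (f : Plane → ℝ≥0∞) : ℝ≥0∞ :=
  expNeg (ENNReal.ofReal lam * ∫⁻ x, (1 - expNeg (f x)))

lemma tendsto_laplaceFunctional (lam : ℝ) {g : ℕ → Plane → ℝ≥0∞} {f : Plane → ℝ≥0∞}
    (hgm : ∀ k, Measurable (g k)) (hg : Monotone g)
    (hlim : ∀ x, Tendsto (fun k => g k x) atTop (𝓝 (f x))) :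
    Tendsto (fun k => laplaceFunctional lam (g k)) atTop (𝓝 (laplaceFunctional lam f)) := by
  refine (continuous_expNeg.tendsto _).comp
    (ENNReal.Tendsto.const_mul ?_ (Or.inr ENNReal.ofReal_ne_top))
  refine lintegral_tendsto_of_tendsto_of_monotone (fun k => by have := hgm k; fun_prop)
    (ae_of_all _ fun x _ _ hjk => tsub_le_tsub_left (expNeg_antitone (hg hjk x)) _)
    (ae_of_all _ fun x => ?_)
  exact ((ENNReal.continuous_sub_left ENNReal.one_ne_top).tendsto _).comp
    ((continuous_expNeg.tendsto _).comp (hlim x))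

theorem IsPoissonProcess.lintegral_expNeg_tsum [IsProbabilityMeasure μ]
    (h : IsPoissonProcess μ X lam) (hlam : 0 ≤ lam) {f : Plane → ℝ≥0∞} (hf : Measurable f) :
    ∫⁻ ω, expNeg (∑' n, f (X n ω)) ∂μ = laplaceFunctional lam f := by
  obtain ⟨g, hmono, hlim⟩ := exists_simpleFunc_indicator_ball_tendsto hf
  have hgm (k : ℕ) : Measurable ((Metric.ball (0 : Plane) k).indicator (g k)) :=
    (g k).measurable.indicator measurableSet_ball
  have hleft : Tendsto
      (fun k : ℕ => ∫⁻ ω, expNeg (∑' n, (Metric.ball (0 : Plane) k).indicator (g k) (X n ω)) ∂μ)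
      atTop (𝓝 (∫⁻ ω, expNeg (∑' n, f (X n ω)) ∂μ)) := by
    refine tendsto_lintegral_of_dominated_convergence (fun _ => 1)
      (fun k => measurable_expNeg.comp (Measurable.tsum fun n => (hgm k).comp (h.measurable n)))
      (fun k => ae_of_all _ fun ω => expNeg_le_one _) (by simp) (ae_of_all _ fun ω => ?_)
    exact (continuous_expNeg.tendsto _).comp
      (tendsto_tsum_of_monotone (fun j k hjk n => hmono hjk _) fun n => hlim _)
  refine tendsto_nhds_unique hleft
    ((tendsto_laplaceFunctional lam hgm hmono hlim).congr fun k => ?_)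
  exact (h.lintegral_expNeg_tsum_indicator_simpleFunc hlam (g k) measurableSet_ball
    measure_ball_lt_top.ne).symm

end

/-! ### Radial integrals over the plane -/

lemma volume_ball_plane {r : ℝ} (hr : 0 ≤ r) (x : Plane) :
    volume (Metric.ball x r) = ENNReal.ofReal (Real.pi * r ^ 2) := by
  rw [InnerProductSpace.volume_ball_of_dim_even (k := 1) (by simp), ← ENNReal.ofReal_pow hr,
    ← ENNReal.ofReal_mul (by positivity), mul_comm]
  simp

lemma volume_normSq_lt {a : ℝ} (ha : 0 ≤ a) :
    volume {x : Plane | ‖x‖ ^ 2 < a} = ENNReal.ofReal (Real.pi * a) := by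
  convert volume_ball_plane (Real.sqrt_nonneg a) 0 using 2
  · ext x
    simp [Real.lt_sqrt (norm_nonneg x)]
  · rw [Real.sq_sqrt ha]

lemma map_normSq_volume :
    (volume : Measure Plane).map (fun x => ‖x‖ ^ 2)
      = ENNReal.ofReal Real.pi • volume.restrict (Ici 0) := by
  have hmeas : Measurable fun x : Plane => ‖x‖ ^ 2 := by fun_prop
  have hIio (a : ℝ) : (volume : Measure Plane).map (fun x => ‖x‖ ^ 2) (Iio a)
      = ENNReal.ofReal (Real.pi * max a 0) := by
    rw [Measure.map_apply hmeas measurableSet_Iio]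
    rcases le_total a 0 with ha | ha
    · have hempty : (fun x : Plane => ‖x‖ ^ 2) ⁻¹' Iio a = ∅ :=
        Set.eq_empty_of_forall_notMem fun x hx => (ha.trans (sq_nonneg ‖x‖)).not_gt hx
      simp [hempty, ha]
    · rw [max_eq_left ha, ← volume_normSq_lt ha]
      rfl
  refine Measure.ext_of_Ico' _ _ (fun a b _ => ?_) fun a b hab => ?_
  · exact ne_top_of_le_ne_top (by simp [hIio]) (measure_mono Ico_subset_Iio_self)
  · have hIco : Ico a b ∩ Ici 0 = Ico (max a 0) (max b 0) := by
      ext x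
      simp only [mem_inter_iff, mem_Ico, mem_Ici, max_le_iff, lt_max_iff]
      grind
    rw [Measure.smul_apply, Measure.restrict_apply measurableSet_Ico, hIco, Real.volume_Ico,
      smul_eq_mul, ← ENNReal.ofReal_mul Real.pi_nonneg, mul_sub,
      ENNReal.ofReal_sub _ (by positivity), ← hIio, ← hIio, ← Iio_sdiff_Iio,
      measure_sdiff (Iio_subset_Iio hab.le) measurableSet_Iio.nullMeasurableSet (by simp [hIio])]

lemma lintegral_comp_normSq {φ : ℝ → ℝ≥0∞} (hφ : Measurable φ) :
    ∫⁻ x : Plane, φ (‖x‖ ^ 2) = ENNReal.ofReal Real.pi * ∫⁻ u in Ioi 0, φ u := by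
  rw [← lintegral_map hφ (by fun_prop), map_normSq_volume, lintegral_smul_measure,
    setLIntegral_congr Ioi_ae_eq_Ici, smul_eq_mul]

lemma lintegral_exp_neg_mul_normSq {κ : ℝ} (hκ : 0 < κ) :
    ∫⁻ x : Plane, ENNReal.ofReal (Real.exp (-κ * ‖x‖ ^ 2)) = ENNReal.ofReal (Real.pi / κ) := by
  rw [lintegral_comp_normSq (φ := fun u => ENNReal.ofReal (Real.exp (-κ * u))) (by fun_prop),
    ← ofReal_integral_eq_lintegral_ofReal (exp_neg_integrableOn_Ioi 0 hκ)
      (ae_of_all _ fun _ => (Real.exp_pos _).le), integral_exp_mul_Ioi (by linarith),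
    ← ENNReal.ofReal_mul Real.pi_nonneg]
  congr 1
  simp only [mul_zero, Real.exp_zero, neg_div_neg_eq, one_div]
  field_simp

/-! ### The Mecke formula -/

section

/-- `(1 - exp (-t a)) / t` for `t = 2⁻ᵏ`, which increases to `a` as `k → ∞`. -/
def expNegQuotient (k : ℕ) (a : ℝ≥0∞) : ℝ≥0∞ := 2 ^ k * (1 - expNeg (a / 2 ^ k))

lemma expNegQuotient_mono (k : ℕ) : Monotone (expNegQuotient k) := fun _ _ hab =>
  mul_le_mul_right (tsub_le_tsub_left (expNeg_antitone (ENNReal.div_le_div_right hab _)) _) _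

@[fun_prop] lemma measurable_expNegQuotient (k : ℕ) : Measurable (expNegQuotient k) := by
  unfold expNegQuotient; fun_prop

lemma expNegQuotient_le_succ (k : ℕ) (a : ℝ≥0∞) :
    expNegQuotient k a ≤ expNegQuotient (k + 1) a := by
  have hhalf : a / 2 ^ k = a / 2 ^ (k + 1) + a / 2 ^ (k + 1) := by
    rw [← two_mul, pow_succ', ← mul_div_assoc, ENNReal.mul_div_mul_left _ _ two_ne_zero (by simp)]
  rw [expNegQuotient, expNegQuotient, hhalf, expNeg_add, pow_succ, mul_assoc]
  set e := expNeg (a / 2 ^ (k + 1))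
  refine mul_le_mul_right (tsub_le_iff_right.2 ?_) _
  have hsum : 1 - e + e = 1 := tsub_add_cancel_of_le (expNeg_le_one _)
  calc (1 : ℝ≥0∞) = 1 - e + (1 - e + e) * e := by rw [hsum, one_mul, hsum]
    _ = 1 - e + (1 - e) * e + e * e := by ring
    _ ≤ 2 * (1 - e) + e * e := by
        rw [two_mul]
        gcongr
        exact mul_le_of_le_one_right' (expNeg_le_one _)

lemma monotone_expNegQuotient : Monotone expNegQuotient :=
  monotone_nat_of_le_succ expNegQuotient_le_succ

lemma iSup_expNegQuotient (a : ℝ≥0∞) : ⨆ k, expNegQuotient k a = a := by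
  refine tendsto_nhds_unique
    (tendsto_atTop_iSup fun j k hjk => monotone_expNegQuotient hjk a) ?_
  have hpow : Tendsto (fun k : ℕ => (2 : ℝ) ^ k) atTop atTop :=
    tendsto_pow_atTop_atTop_of_one_lt one_lt_two
  induction a using ENNReal.recTopCoe with
  | top =>
    have htop := ENNReal.tendsto_ofReal_atTop.comp hpow
    refine htop.congr fun k => ?_
    simp [expNegQuotient, ENNReal.ofReal_pow, ENNReal.top_div]
  | coe x =>
    have hlim := ((Real.hasDerivAt_exp 0).hasFDerivAt.lim_real (-(x : ℝ))).comp hpow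
    have hneg : Tendsto (fun k : ℕ => (2 : ℝ) ^ k * (1 - Real.exp (-(x / 2 ^ k)))) atTop
        (𝓝 (x : ℝ)) := by
      convert hlim.neg using 2
      · simp only [Function.comp_apply, zero_add, smul_eq_mul, Real.exp_zero, mul_neg,
          div_eq_inv_mul]
        ring
      · simp
    have hcoe := (ENNReal.continuous_ofReal.tendsto _).comp hneg
    rw [ENNReal.ofReal_coe_nnreal] at hcoe
    refine hcoe.congr fun k => ?_
    have hdiv : (x : ℝ≥0∞) / 2 ^ k = ENNReal.ofReal (x / 2 ^ k) := by
      rw [ENNReal.ofReal_div_of_pos (by positivity), ENNReal.ofReal_pow zero_le_two]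
      simp
    rw [expNegQuotient, hdiv, expNeg_ofReal (by positivity), Function.comp_apply,
      ENNReal.ofReal_mul (by positivity), ENNReal.ofReal_sub _ (Real.exp_pos _).le,
      ENNReal.ofReal_pow zero_le_two, ENNReal.ofReal_one, ENNReal.ofReal_ofNat]

lemma iSup_expNegQuotient_of_monotone {b : ℕ → ℝ≥0∞} (hb : Monotone b) :
    ⨆ k, expNegQuotient k (b k) = ⨆ k, b k := by
  refine le_antisymm (iSup_mono fun k => ?_) (iSup_le fun j => ?_)
  · exact (le_iSup _ k).trans (iSup_expNegQuotient (b k)).le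
  · rw [← iSup_expNegQuotient (b j)]
    exact iSup_le fun k => le_iSup_of_le (max j k)
      ((monotone_expNegQuotient (le_max_right j k) _).trans
        (expNegQuotient_mono _ (hb (le_max_left j k))))

lemma expNegQuotient_mul_expNeg (k : ℕ) (a b : ℝ≥0∞) :
    expNegQuotient k a * expNeg b = 2 ^ k * (expNeg b - expNeg (b + a / 2 ^ k)) := by
  rw [expNegQuotient, mul_assoc, ENNReal.sub_mul fun _ _ =>
    ne_top_of_le_ne_top ENNReal.one_ne_top (expNeg_le_one b), one_mul, expNeg_add,
    mul_comm (expNeg b)]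

lemma monotone_lintegral_expNegQuotient_mul_expNeg {α : Type*} [MeasurableSpace α] (ν : Measure α)
    (a b : α → ℝ≥0∞) : Monotone fun k => ∫⁻ x, expNegQuotient k (a x) * expNeg (b x) ∂ν :=
  fun _ _ hjk => lintegral_mono fun _ => mul_le_mul_left (monotone_expNegQuotient hjk _) _

lemma iSup_lintegral_expNegQuotient_mul_expNeg {α : Type*} [MeasurableSpace α] (ν : Measure α)
    {a b : α → ℝ≥0∞} (ha : Measurable a) (hb : Measurable b) :
    ⨆ k, ∫⁻ x, expNegQuotient k (a x) * expNeg (b x) ∂ν = ∫⁻ x, a x * expNeg (b x) ∂ν := by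
  rw [← lintegral_iSup (f := fun k x => expNegQuotient k (a x) * expNeg (b x))
    (fun k => by fun_prop) fun j k hjk x => mul_le_mul_left (monotone_expNegQuotient hjk _) _]
  simp_rw [← ENNReal.iSup_mul, iSup_expNegQuotient]

lemma laplaceFunctional_add_div_two_pow (lam : ℝ) {u v : Plane → ℝ≥0∞} (hu : Measurable u)
    (hv : Measurable v) (k : ℕ) :
    laplaceFunctional lam (fun x => v x + u x / 2 ^ k)
      = expNeg (ENNReal.ofReal lam * (∫⁻ x, (1 - expNeg (v x)))
        + ENNReal.ofReal lam * (∫⁻ x, expNegQuotient k (u x) * expNeg (v x)) / 2 ^ k) := by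
  have hpoint (x) : 1 - expNeg (v x + u x / 2 ^ k)
      = 1 - expNeg (v x) + expNegQuotient k (u x) * expNeg (v x) / 2 ^ k := by
    rw [expNegQuotient_mul_expNeg, mul_comm, ENNReal.mul_div_cancel_right (by simp) (by simp),
      tsub_add_tsub_cancel (expNeg_le_one _) (expNeg_antitone le_self_add)]
  simp_rw [laplaceFunctional, hpoint, div_eq_mul_inv]
  rw [lintegral_add_left (by fun_prop), lintegral_mul_const _ (by fun_prop), mul_add, mul_assoc]

variable {Ω : Type*} [MeasurableSpace Ω] {μ : Measure Ω} {X : ℕ → Ω → Plane} {lam : ℝ}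
  {u v : Plane → ℝ≥0∞}

lemma IsPoissonProcess.lintegral_expNegQuotient_tsum_mul [IsProbabilityMeasure μ]
    (h : IsPoissonProcess μ X lam) (hlam : 0 ≤ lam) (hu : Measurable u) (hv : Measurable v)
    (k : ℕ) :
    ∫⁻ ω, expNegQuotient k (∑' n, u (X n ω)) * expNeg (∑' n, v (X n ω)) ∂μ
      = expNegQuotient k (ENNReal.ofReal lam * ∫⁻ x, expNegQuotient k (u x) * expNeg (v x))
        * laplaceFunctional lam v := by
  have hw : Measurable fun x => v x + u x / 2 ^ k := by fun_prop
  have hmeas {f : Plane → ℝ≥0∞} (hf : Measurable f) :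
      Measurable fun ω => expNeg (∑' n, f (X n ω)) :=
    measurable_expNeg.comp (Measurable.tsum fun n => hf.comp (h.measurable n))
  have hfin : ∫⁻ ω, expNeg (∑' n, (v (X n ω) + u (X n ω) / 2 ^ k)) ∂μ ≠ ∞ :=
    ne_top_of_le_ne_top (by simp) (lintegral_mono fun ω => expNeg_le_one _)
  have hle (ω) : expNeg (∑' n, (v (X n ω) + u (X n ω) / 2 ^ k)) ≤ expNeg (∑' n, v (X n ω)) :=
    expNeg_antitone (ENNReal.tsum_le_tsum fun n => le_self_add)
  have hsum (ω) : ∑' n, v (X n ω) + (∑' n, u (X n ω)) / 2 ^ k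
      = ∑' n, (v (X n ω) + u (X n ω) / 2 ^ k) := by
    simp_rw [ENNReal.tsum_add, div_eq_mul_inv, ENNReal.tsum_mul_right]
  calc ∫⁻ ω, expNegQuotient k (∑' n, u (X n ω)) * expNeg (∑' n, v (X n ω)) ∂μ
      = ∫⁻ ω, 2 ^ k * (expNeg (∑' n, v (X n ω))
          - expNeg (∑' n, (v (X n ω) + u (X n ω) / 2 ^ k))) ∂μ := by
        simp_rw [expNegQuotient_mul_expNeg, hsum]
    _ = 2 ^ k * (laplaceFunctional lam v
          - laplaceFunctional lam fun x => v x + u x / 2 ^ k) := by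
        rw [lintegral_const_mul' _ _ (by simp),
          lintegral_sub (hmeas hw) hfin (ae_of_all _ hle), h.lintegral_expNeg_tsum hlam hv,
          ← h.lintegral_expNeg_tsum hlam hw]
    _ = _ := by
        rw [laplaceFunctional_add_div_two_pow lam hu hv, laplaceFunctional,
          expNegQuotient_mul_expNeg]

/-- The contribution to the sum of `v` over the points of the configuration `x` of all the points
other than the `n`-th one. -/
def sumOthers (v : Plane → ℝ≥0∞) (x : ℕ → Plane) (n : ℕ) : ℝ≥0∞ :=
  ∑' m, if m = n then 0 else v (x m)

lemma add_sumOthers (v : Plane → ℝ≥0∞) (x : ℕ → Plane) (n : ℕ) :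
    v (x n) + sumOthers v x n = ∑' m, v (x m) := by
  rw [sumOthers, ENNReal.tsum_eq_add_tsum_ite (f := fun m => v (x m)) n]
  congr!

lemma tendsto_sumOthers {g : ℕ → Plane → ℝ≥0∞} {v : Plane → ℝ≥0∞} (hg : Monotone g)
    (hlim : ∀ x, Tendsto (fun k => g k x) atTop (𝓝 (v x))) (x : ℕ → Plane) (n : ℕ) :
    Tendsto (fun k => sumOthers (g k) x n) atTop (𝓝 (sumOthers v x n)) := by
  refine tendsto_tsum_of_monotone (fun j k hjk m => ?_) fun m => ?_
  · dsimp only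
    split_ifs
    exacts [le_rfl, hg hjk _]
  · split_ifs
    exacts [tendsto_const_nhds, hlim _]

lemma sumOthers_mono {v w : Plane → ℝ≥0∞} (hvw : v ≤ w) (x : ℕ → Plane) (n : ℕ) :
    sumOthers v x n ≤ sumOthers w x n :=
  ENNReal.tsum_le_tsum fun m => by split_ifs <;> simp [hvw _]

lemma measurable_sumOthers {α : Type*} [MeasurableSpace α] {x : ℕ → α → Plane}
    {v : Plane → ℝ≥0∞} (hv : Measurable v) (hx : ∀ n, Measurable (x n)) (n : ℕ) :
    Measurable fun a => sumOthers v (fun m => x m a) n :=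
  Measurable.tsum fun m => by
    split_ifs
    exacts [measurable_const, hv.comp (hx m)]

namespace IsPoissonProcess

lemma lintegral_tsum_mul_expNeg_tsum [IsProbabilityMeasure μ]
    (h : IsPoissonProcess μ X lam) (hlam : 0 ≤ lam) (hu : Measurable u) (hv : Measurable v) :
    ∫⁻ ω, (∑' n, u (X n ω)) * expNeg (∑' n, v (X n ω)) ∂μ
      = ENNReal.ofReal lam * (∫⁻ x, u x * expNeg (v x)) * laplaceFunctional lam v := by
  have hsum {f : Plane → ℝ≥0∞} (hf : Measurable f) : Measurable fun ω => ∑' n, f (X n ω) :=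
    Measurable.tsum fun n => hf.comp (h.measurable n)
  have hmono : Monotone fun k =>
      ENNReal.ofReal lam * ∫⁻ x, expNegQuotient k (u x) * expNeg (v x) := fun j k hjk =>
    mul_le_mul_right (monotone_lintegral_expNegQuotient_mul_expNeg volume u v hjk) _
  rw [← iSup_lintegral_expNegQuotient_mul_expNeg μ (hsum hu) (hsum hv)]
  simp_rw [h.lintegral_expNegQuotient_tsum_mul hlam hu hv]
  rw [← ENNReal.iSup_mul, iSup_expNegQuotient_of_monotone hmono, ← ENNReal.mul_iSup,
    iSup_lintegral_expNegQuotient_mul_expNeg volume hu hv]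

lemma tsum_lintegral_mul_expNeg_sumOthers_of_ne_top [IsProbabilityMeasure μ]
    (h : IsPoissonProcess μ X lam) (hlam : 0 ≤ lam) (hu : Measurable u) (hv : Measurable v)
    (hvtop : ∀ x, v x ≠ ∞) :
    ∑' n, ∫⁻ ω, u (X n ω) * expNeg (sumOthers v (fun m => X m ω) n) ∂μ
      = ENNReal.ofReal lam * (∫⁻ x, u x) * laplaceFunctional lam v := by
  have hcancel (x) : (expNeg (v x))⁻¹ * expNeg (v x) = 1 :=
    ENNReal.inv_mul_cancel (expNeg_ne_zero (hvtop x))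
      (ne_top_of_le_ne_top ENNReal.one_ne_top (expNeg_le_one _))
  have hterm (ω n) : u (X n ω) * expNeg (sumOthers v (fun m => X m ω) n)
      = u (X n ω) * (expNeg (v (X n ω)))⁻¹ * expNeg (∑' m, v (X m ω)) := by
    rw [← add_sumOthers v (fun m => X m ω) n, expNeg_add, mul_assoc, ← mul_assoc _ (expNeg _),
      hcancel, one_mul]
  have hmeas : Measurable fun x => u x * (expNeg (v x))⁻¹ := by fun_prop
  have key := h.lintegral_tsum_mul_expNeg_tsum hlam hmeas hv
  simp_rw [mul_assoc (u _), hcancel, mul_one, ← ENNReal.tsum_mul_right] at key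
  rw [← key, ← lintegral_tsum fun n => ?_]
  · simp_rw [hterm]
  · exact ((hu.comp (h.measurable n)).mul
      (measurable_expNeg.comp (measurable_sumOthers hv h.measurable n))).aemeasurable

lemma tsum_lintegral [IsProbabilityMeasure μ] (h : IsPoissonProcess μ X lam) (hlam : 0 ≤ lam)
    (hu : Measurable u) : ∑' n, ∫⁻ ω, u (X n ω) ∂μ = ENNReal.ofReal lam * ∫⁻ x, u x := by
  simpa [sumOthers, laplaceFunctional] using
    h.tsum_lintegral_mul_expNeg_sumOthers_of_ne_top hlam hu measurable_zero (by simp)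

theorem tsum_lintegral_mul_expNeg_sumOthers [IsProbabilityMeasure μ]
    (h : IsPoissonProcess μ X lam) (hlam : 0 ≤ lam) (hu : Measurable u) (hu' : ∫⁻ x, u x ≠ ∞)
    (hv : Measurable v) :
    ∑' n, ∫⁻ ω, u (X n ω) * expNeg (sumOthers v (fun m => X m ω) n) ∂μ
      = ENNReal.ofReal lam * (∫⁻ x, u x) * laplaceFunctional lam v := by
  let trunc (k : ℕ) (x : Plane) : ℝ≥0∞ := min (v x) k
  have htrunc (k : ℕ) : Measurable (trunc k) := hv.min measurable_const
  have hmono : Monotone trunc := fun j k hjk x => min_le_min le_rfl (by exact_mod_cast hjk)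
  have hlim (x) : Tendsto (fun k => trunc k x) atTop (𝓝 (v x)) := by
    simpa using tendsto_const_nhds.min ENNReal.tendsto_nat_nhds_top
  have htotal : ∑' n, ∫⁻ ω, u (X n ω) ∂μ ≠ ∞ := by
    rw [h.tsum_lintegral hlam hu]
    exact ENNReal.mul_ne_top ENNReal.ofReal_ne_top hu'
  have hbound (k n ω) :
      u (X n ω) * expNeg (sumOthers (trunc k) (fun m => X m ω) n) ≤ u (X n ω) :=
    mul_le_of_le_one_right' (expNeg_le_one _)
  have hsum : Tendsto (fun k => ∑' n, ∫⁻ ω, u (X n ω)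
      * expNeg (sumOthers (trunc k) (fun m => X m ω) n) ∂μ) atTop
      (𝓝 (∑' n, ∫⁻ ω, u (X n ω) * expNeg (sumOthers v (fun m => X m ω) n) ∂μ)) := by
    have hfin (n) : ∫⁻ ω, u (X n ω) ∂μ ≠ ∞ := ENNReal.ne_top_of_tsum_ne_top htotal n
    simp_rw [← lintegral_count] at htotal ⊢
    refine tendsto_lintegral_of_dominated_convergence _ (fun k => measurable_from_top)
      (fun k => ae_of_all _ fun n => lintegral_mono (hbound k n)) htotal (ae_of_all _ fun n => ?_)
    have hun : Measurable fun ω => u (X n ω) := hu.comp (h.measurable n)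
    refine tendsto_lintegral_of_dominated_convergence _
      (fun k => hun.mul (measurable_expNeg.comp (measurable_sumOthers (htrunc k) h.measurable n)))
      (fun k => ae_of_all _ (hbound k n)) (hfin n) ?_
    filter_upwards [ae_lt_top hun (hfin n)] with ω hω
    exact ENNReal.Tendsto.const_mul ((continuous_expNeg.tendsto _).comp
      (tendsto_sumOthers hmono hlim _ n)) (.inr hω.ne)
  refine tendsto_nhds_unique hsum ?_
  simp_rw [h.tsum_lintegral_mul_expNeg_sumOthers_of_ne_top hlam hu (htrunc _)
    fun _ => ne_top_of_le_ne_top (ENNReal.natCast_ne_top _) (min_le_right _ _)]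
  exact ENNReal.Tendsto.const_mul (tendsto_laplaceFunctional lam htrunc hmono hlim)
    (.inr (ENNReal.mul_ne_top ENNReal.ofReal_ne_top hu'))

end IsPoissonProcess

end

section

variable {Ω : Type*} [MeasurableSpace Ω] {μ : Measure Ω} {X : ℕ → Ω → Plane} {lam : ℝ}

lemma lintegral_comp_eq_tsum_indicator {α : Type*} [MeasurableSpace α] (ν : Measure α) {κ : α → ℕ}
    (hκ : Measurable κ) {G : ℕ → α → ℝ≥0∞} (hG : ∀ k, Measurable (G k)) :
    ∫⁻ x, G (κ x) x ∂ν = ∑' k, ∫⁻ x, (κ ⁻¹' {k}).indicator 1 x * G k x ∂ν := by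
  have hκ' (k) : MeasurableSet (κ ⁻¹' {k}) := hκ (measurableSet_singleton k)
  rw [← lintegral_tsum (f := fun k x => (κ ⁻¹' {k}).indicator 1 x * G k x) fun k =>
    ((measurable_one.indicator (hκ' k)).mul (hG k)).aemeasurable]
  refine lintegral_congr fun x => ?_
  rw [tsum_eq_single (κ x) fun k hk => by simp [indicator, hk.symm]]
  simp

namespace IsPoissonProcess

lemma tsum_lintegral_expNeg_sumOthers_comp_nat [IsProbabilityMeasure μ]
    (h : IsPoissonProcess μ X lam) (hlam : 0 ≤ lam) {κ : Plane → ℕ} (hκ : Measurable κ)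
    (hfin : ∀ k, volume (κ ⁻¹' {k}) ≠ ∞) {w : ℕ → Plane → ℝ≥0∞} (hw : ∀ k, Measurable (w k)) :
    ∑' n, ∫⁻ ω, expNeg (sumOthers (w (κ (X n ω))) (fun m => X m ω) n) ∂μ
      = ENNReal.ofReal lam * ∫⁻ x, laplaceFunctional lam (w (κ x)) := by
  have hκ' (k) : MeasurableSet (κ ⁻¹' {k}) := hκ (measurableSet_singleton k)
  have hind (k) : Measurable ((κ ⁻¹' {k}).indicator (1 : Plane → ℝ≥0∞)) :=
    measurable_one.indicator (hκ' k)
  have hvol (k) : ∫⁻ x, (κ ⁻¹' {k}).indicator 1 x ≠ ∞ := by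
    simpa [lintegral_indicator_one (hκ' k)] using hfin k
  calc ∑' n, ∫⁻ ω, expNeg (sumOthers (w (κ (X n ω))) (fun m => X m ω) n) ∂μ
      = ∑' n, ∑' k, ∫⁻ ω, (κ ⁻¹' {k}).indicator 1 (X n ω)
          * expNeg (sumOthers (w k) (fun m => X m ω) n) ∂μ :=
        tsum_congr fun n => lintegral_comp_eq_tsum_indicator μ (hκ.comp (h.measurable n))
          fun k => measurable_expNeg.comp (measurable_sumOthers (hw k) h.measurable n)
    _ = ∑' k, ENNReal.ofReal lam * ((∫⁻ x, (κ ⁻¹' {k}).indicator 1 x)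
          * laplaceFunctional lam (w k)) := by
        rw [ENNReal.tsum_comm]
        simp_rw [← mul_assoc]
        exact tsum_congr fun k =>
          h.tsum_lintegral_mul_expNeg_sumOthers hlam (hind k) (hvol k) (hw k)
    _ = ENNReal.ofReal lam * ∫⁻ x, laplaceFunctional lam (w (κ x)) := by
        rw [ENNReal.tsum_mul_left, lintegral_comp_eq_tsum_indicator volume hκ
          (G := fun k _ => laplaceFunctional lam (w k)) fun k => measurable_const]
        simp_rw [lintegral_mul_const _ (hind _)]

end IsPoissonProcess

lemma lintegral_floor_normSq_div_le {ε : ℝ} (hε : 0 < ε) {g : ℕ → ℝ≥0∞} (hg : ∀ k, g k ≤ 1) :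
    ∫⁻ x : Plane, g ⌊‖x‖ ^ 2 / ε⌋₊
      ≤ ENNReal.ofReal (Real.pi * ε) + ∫⁻ x : Plane, g (⌊‖x‖ ^ 2 / ε⌋₊ + 1) := by
  have hmeas : Measurable fun u => g ⌊u / ε⌋₊ := by fun_prop
  have hmeas' : Measurable fun u => g (⌊u / ε⌋₊ + 1) := by fun_prop
  have hshift : ∫⁻ u in Ioi 0, g (⌊u / ε⌋₊ + 1) = ∫⁻ u in Ioi ε, g ⌊u / ε⌋₊ := by
    rw [← (measurePreserving_add_right volume ε).setLIntegral_comp_preimage measurableSet_Ioi hmeas,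
      preimage_add_const_Ioi, sub_self]
    refine setLIntegral_congr_fun measurableSet_Ioi fun u hu => ?_
    rw [add_div, div_self hε.ne', Nat.floor_add_one (div_nonneg (mem_Ioi.1 hu).le hε.le)]
  rw [lintegral_comp_normSq hmeas, lintegral_comp_normSq hmeas', hshift,
    ENNReal.ofReal_mul Real.pi_pos.le, ← mul_add]
  gcongr
  rw [← Ioc_union_Ioi_eq_Ioi hε.le, lintegral_union measurableSet_Ioi
    (Ioc_disjoint_Ioi le_rfl)]
  gcongr
  calc ∫⁻ u in Ioc 0 ε, g ⌊u / ε⌋₊ ≤ ∫⁻ _ in Ioc 0 ε, 1 := lintegral_mono fun _ => hg _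
    _ = ENNReal.ofReal ε := by simp

lemma sqrt_floor_div_mul_le {ε : ℝ} (hε : 0 < ε) {r : ℝ} (hr : 0 ≤ r) :
    √(⌊r ^ 2 / ε⌋₊ * ε) ≤ r := by
  rw [Real.sqrt_le_left hr, ← le_div_iff₀ hε]
  exact Nat.floor_le (by positivity)

lemma le_sqrt_floor_div_add_one_mul {ε : ℝ} (hε : 0 < ε) (r : ℝ) :
    r ≤ √((⌊r ^ 2 / ε⌋₊ + 1 : ℕ) * ε) := by
  refine Real.le_sqrt_of_sq_le ?_
  rw [← div_le_iff₀ hε]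
  exact_mod_cast (Nat.lt_floor_add_one _).le

lemma volume_floor_normSq_div_fiber_ne_top {ε : ℝ} (hε : 0 < ε) (k : ℕ) :
    volume ((fun x : Plane => ⌊‖x‖ ^ 2 / ε⌋₊) ⁻¹' {k}) ≠ ∞ := by
  refine ne_top_of_le_ne_top ENNReal.ofReal_ne_top ((measure_mono fun x hx => ?_).trans
    (volume_normSq_lt (a := (k + 1) * ε) (by positivity)).le)
  rw [mem_ofPred_eq, ← div_lt_iff₀ hε, ← mem_singleton_iff.1 hx]
  exact Nat.lt_floor_add_one _

lemma laplaceFunctional_antitone (lam : ℝ) : Antitone (laplaceFunctional lam) := fun _ _ hfg =>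
  expNeg_antitone (by gcongr with x; exact expNeg_antitone (hfg x))

/-! ### The nearest point -/

lemma exists_step_between {lam : ℝ} (hlam : 0 < lam) {v : ℝ → Plane → ℝ≥0∞}
    (hv : ∀ r, Measurable (v r)) (hmono : MonotoneOn v (Ici 0)) {δ : ℝ≥0} (hδ : 0 < δ) :
    ∃ (κ : Plane → ℕ) (w : ℕ → Plane → ℝ≥0∞), Measurable κ ∧ (∀ k, volume (κ ⁻¹' {k}) ≠ ∞) ∧
      (∀ k, Measurable (w k)) ∧ (∀ x, w (κ x) ≤ v ‖x‖) ∧ (∀ x, v ‖x‖ ≤ w (κ x + 1)) ∧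
      ENNReal.ofReal lam * ∫⁻ x, laplaceFunctional lam (w (κ x))
        ≤ ENNReal.ofReal lam * (∫⁻ x, laplaceFunctional lam (w (κ x + 1))) + δ := by
  set ε : ℝ := δ / (lam * Real.pi) with hεdef
  have hε : 0 < ε := by positivity
  refine ⟨fun x => ⌊‖x‖ ^ 2 / ε⌋₊, fun k => v √(k * ε), by fun_prop,
    volume_floor_normSq_div_fiber_ne_top hε, fun k => hv _,
    fun x => hmono (Real.sqrt_nonneg _) (norm_nonneg x) (sqrt_floor_div_mul_le hε (norm_nonneg x)),
    fun x => hmono (norm_nonneg x) (Real.sqrt_nonneg _) (le_sqrt_floor_div_add_one_mul hε ‖x‖), ?_⟩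
  refine (mul_le_mul_right (lintegral_floor_normSq_div_le hε
    (g := fun k => laplaceFunctional lam (v √(k * ε))) fun k => expNeg_le_one _) _).trans_eq ?_
  rw [mul_add, add_comm, ← ENNReal.ofReal_mul hlam.le, hεdef, ← mul_assoc,
    mul_div_cancel₀ _ (by positivity), ENNReal.ofReal_coe_nnreal]

namespace IsPoissonProcess

/- Mecke's formula holds for step functions of the distance, and both sides are antitone in `v`. -/
theorem tsum_lintegral_expNeg_sumOthers_norm [IsProbabilityMeasure μ]
    (h : IsPoissonProcess μ X lam) (hlam : 0 < lam) {v : ℝ → Plane → ℝ≥0∞}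
    (hv : ∀ r, Measurable (v r)) (hmono : MonotoneOn v (Ici 0)) :
    ∑' n, ∫⁻ ω, expNeg (sumOthers (v ‖X n ω‖) (fun m => X m ω) n) ∂μ
      = ENNReal.ofReal lam * ∫⁻ x : Plane, laplaceFunctional lam (v ‖x‖) := by
  refine le_antisymm (ENNReal.le_of_forall_pos_le_add fun δ hδ _ => ?_)
    (ENNReal.le_of_forall_pos_le_add fun δ hδ _ => ?_) <;>
  obtain ⟨κ, w, hκ, hfin, hw, hlower, hupper, hgap⟩ := exists_step_between hlam hv hmono hδ
  · calc _ ≤ ∑' n, ∫⁻ ω, expNeg (sumOthers (w (κ (X n ω))) (fun m => X m ω) n) ∂μ :=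
          ENNReal.tsum_le_tsum fun n => lintegral_mono fun ω =>
            expNeg_antitone (sumOthers_mono (hlower _) _ _)
      _ = ENNReal.ofReal lam * ∫⁻ x, laplaceFunctional lam (w (κ x)) :=
          h.tsum_lintegral_expNeg_sumOthers_comp_nat hlam.le hκ hfin hw
      _ ≤ _ := by
          refine hgap.trans ?_
          gcongr with x
          exact laplaceFunctional_antitone lam (hupper x)
  · calc _ ≤ ENNReal.ofReal lam * ∫⁻ x, laplaceFunctional lam (w (κ x)) := by
          gcongr with x
          exact laplaceFunctional_antitone lam (hlower x)
      _ ≤ ENNReal.ofReal lam * (∫⁻ x, laplaceFunctional lam (w (κ x + 1))) + δ := hgap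
      _ ≤ _ := by
          rw [← h.tsum_lintegral_expNeg_sumOthers_comp_nat hlam.le hκ hfin fun k => hw (k + 1)]
          gcongr with n ω
          exact expNeg_antitone (sumOthers_mono (hupper _) _ _)

lemma ae_forall_ne [IsProbabilityMeasure μ] (h : IsPoissonProcess μ X lam) (hlam : 0 ≤ lam)
    (x : Plane) : ∀ᵐ ω ∂μ, ∀ n, X n ω ≠ x := by
  have hx : Measurable (({x} : Set Plane).indicator (1 : Plane → ℝ≥0∞)) :=
    measurable_one.indicator (measurableSet_singleton x)
  have hsum := h.tsum_lintegral hlam hx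
  rw [lintegral_indicator_one (measurableSet_singleton x), measure_singleton, mul_zero,
    ENNReal.tsum_eq_zero] at hsum
  refine ae_all_iff.2 fun n => ?_
  filter_upwards [(lintegral_eq_zero_iff (hx.comp (h.measurable n))).1 (hsum n)] with ω hω
  by_contra hne
  simp [hne] at hω

end IsPoissonProcess

/-- The index of the point of the configuration `x` which is nearest to the origin. -/
def nearest (x : ℕ → Plane) : ℕ := sInf {n | ∀ k, ‖x n‖ ≤ ‖x k‖}

lemma nearest_le_iff (x : ℕ → Plane) (m : ℕ) :
    nearest x ≤ m ↔ (∃ n ≤ m, ∀ k, ‖x n‖ ≤ ‖x k‖) ∨ ∀ n, ¬ ∀ k, ‖x n‖ ≤ ‖x k‖ := by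
  rcases {n | ∀ k, ‖x n‖ ≤ ‖x k‖}.eq_empty_or_nonempty with hempty | hne
  · simp only [nearest, hempty, Nat.sInf_empty, zero_le, true_iff]
    exact .inr (eq_empty_iff_forall_notMem.1 hempty)
  · refine ⟨fun hm => .inl ⟨_, hm, Nat.sInf_mem hne⟩, ?_⟩
    rintro (⟨n, hn, hmin⟩ | hnone)
    · exact (Nat.sInf_le (s := {n | ∀ k, ‖x n‖ ≤ ‖x k‖}) hmin).trans hn
    · exact absurd (Nat.sInf_mem hne) (hnone _)

lemma measurable_nearest : Measurable nearest := by
  refine measurable_of_Iic fun m => ?_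
  have hIic : nearest ⁻¹' Iic m = {x | (∃ n ≤ m, ∀ k, ‖x n‖ ≤ ‖x k‖) ∨
      ∀ n, ¬ ∀ k, ‖x n‖ ≤ ‖x k‖} := ext fun x => nearest_le_iff x m
  rw [hIic]
  measurability

lemma measurable_apply_nearest : Measurable fun x : ℕ → Plane => x (nearest x) :=
  (measurable_from_prod_countable_right (f := fun p : ℕ × (ℕ → Plane) => p.2 p.1)
    fun n => measurable_pi_apply n).comp (measurable_nearest.prodMk measurable_id)

lemma IsPoissonProcess.ae_nearest_le [IsProbabilityMeasure μ] (h : IsPoissonProcess μ X lam) :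
    ∀ᵐ ω ∂μ, ∀ k, ‖X (nearest fun n => X n ω) ω‖ ≤ ‖X k ω‖ := by
  have hcount : ∀ᵐ ω ∂μ, ∀ N : ℕ, count (fun n => X n ω) (Metric.ball 0 N) ≠ ⊤ :=
    ae_all_iff.2 fun N => h.ae_count_ne_top measurableSet_ball measure_ball_lt_top.ne
  filter_upwards [hcount] with ω hω
  obtain ⟨N, hN⟩ := exists_nat_gt ‖X 0 ω‖
  have hfin : {n | X n ω ∈ Metric.ball 0 (N : ℝ)}.Finite := Set.encard_ne_top_iff.1 (hω N)
  obtain ⟨m, hm, hmin⟩ := Set.exists_min_image _ (fun n => ‖X n ω‖) hfin ⟨0, by simpa using hN⟩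
  refine Nat.sInf_mem (s := {n | ∀ k, ‖X n ω‖ ≤ ‖X k ω‖}) ⟨m, fun k => ?_⟩
  by_cases hk : X k ω ∈ Metric.ball 0 (N : ℝ)
  · exact hmin k hk
  · have hmN : ‖X m ω‖ < N := by simpa using hm
    have hkN : (N : ℝ) ≤ ‖X k ω‖ := by simpa using hk
    exact (hmN.trans_le hkN).le

lemma laplaceFunctional_indicator_top_add (lam : ℝ) {s : Set Plane} (hs : MeasurableSet s)
    (f : Plane → ℝ≥0∞) :
    laplaceFunctional lam (s.indicator ⊤ + f)
      = expNeg (ENNReal.ofReal lam * (volume s + ∫⁻ x in sᶜ, (1 - expNeg (f x)))) := by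
  rw [laplaceFunctional, ← lintegral_add_compl _ hs,
    setLIntegral_congr_fun (g := fun _ => 1) hs fun x hx => by simp [indicator_of_mem hx],
    setLIntegral_congr_fun (g := fun x => 1 - expNeg (f x)) hs.compl fun x hx => by
      simp [indicator_of_notMem hx], setLIntegral_one]

lemma lintegral_laplaceFunctional_indicator_top_add (hlam : 0 < lam) {f : ℝ → Plane → ℝ≥0∞}
    {A : ℝ} (hA : 0 ≤ A) (hInt : ∀ r > 0, ∫⁻ x in (Metric.ball 0 r)ᶜ, (1 - expNeg (f r x))
      = ENNReal.ofReal (Real.pi * r ^ 2 * A)) {s : ℝ → Set Plane} (hs : ∀ r, MeasurableSet (s r))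
    (hsball : ∀ r, s r =ᵐ[volume] Metric.ball 0 r) :
    ENNReal.ofReal lam * ∫⁻ x : Plane, laplaceFunctional lam ((s ‖x‖).indicator ⊤ + f ‖x‖)
      = ENNReal.ofReal (1 / (1 + A)) := by
  have hL (r : ℝ) (hr : 0 < r) : laplaceFunctional lam ((s r).indicator ⊤ + f r)
      = ENNReal.ofReal (Real.exp (-(lam * Real.pi * (1 + A)) * r ^ 2)) := by
    rw [laplaceFunctional_indicator_top_add lam (hs r), measure_congr (hsball r),
      setLIntegral_congr (hsball r).compl, hInt r hr, volume_ball_plane hr.le,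
      ← ENNReal.ofReal_add (by positivity) (by positivity), ← ENNReal.ofReal_mul hlam.le,
      expNeg_ofReal (by positivity)]
    ring_nf
  have hpos : 0 < lam * Real.pi * (1 + A) := by positivity
  have hne : ∀ᵐ x : Plane, x ≠ 0 := by simp [ae_iff]
  rw [lintegral_congr_ae (hne.mono fun x hx => hL ‖x‖ (norm_pos_iff.2 hx)),
    lintegral_exp_neg_mul_normSq hpos, ← ENNReal.ofReal_mul hlam.le]
  congr 1
  field_simp

lemma closedBall_ae_eq_ball (x : Plane) (r : ℝ) :
    Metric.closedBall x r =ᵐ[volume] Metric.ball x r :=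
  (ae_eq_of_subset_of_measure_ge Metric.ball_subset_closedBall
    (Measure.addHaar_closedBall_eq_addHaar_ball ..).le
    measurableSet_ball.nullMeasurableSet measure_closedBall_lt_top.ne).symm

lemma sumOthers_indicator_top_add_of_forall_notMem {s : Set Plane} {x : ℕ → Plane} {n : ℕ}
    (hs : ∀ m, m ≠ n → x m ∉ s) (f : Plane → ℝ≥0∞) :
    sumOthers (s.indicator ⊤ + f) x n = sumOthers f x n :=
  tsum_congr fun m => by
    by_cases hm : m = n
    · simp [hm]
    · simp [hm, indicator_of_notMem (hs m hm)]

lemma sumOthers_indicator_top_add_of_mem {s : Set Plane} {x : ℕ → Plane} {m n : ℕ} (hmn : m ≠ n)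
    (hm : x m ∈ s) (f : Plane → ℝ≥0∞) : sumOthers (s.indicator ⊤ + f) x n = ⊤ :=
  top_unique ((ENNReal.le_tsum m).trans' (by simp [hmn, indicator_of_mem hm]))

/- Only the nearest point has no other point in the closed ball through it; it also has none in
the open ball. The two inequalities make it unnecessary to show that the nearest point is unique. -/
lemma expNeg_sumOthers_nearest_le {x : ℕ → Plane} (hx : ∀ k, ‖x (nearest x)‖ ≤ ‖x k‖)
    (f : ℝ → Plane → ℝ≥0∞) :
    expNeg (sumOthers (f ‖x (nearest x)‖) x (nearest x))
      ≤ ∑' n, expNeg (sumOthers ((Metric.ball 0 ‖x n‖).indicator ⊤ + f ‖x n‖) x n) := by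
  refine (ENNReal.le_tsum (nearest x)).trans' (le_of_eq ?_)
  rw [sumOthers_indicator_top_add_of_forall_notMem fun m _ => by simpa using hx m]

lemma tsum_expNeg_sumOthers_le_nearest {x : ℕ → Plane} (hx : ∀ k, ‖x (nearest x)‖ ≤ ‖x k‖)
    (f : ℝ → Plane → ℝ≥0∞) :
    ∑' n, expNeg (sumOthers ((Metric.closedBall 0 ‖x n‖).indicator ⊤ + f ‖x n‖) x n)
      ≤ expNeg (sumOthers (f ‖x (nearest x)‖) x (nearest x)) := by
  rw [tsum_eq_single (nearest x) fun n hn => by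
    rw [sumOthers_indicator_top_add_of_mem hn.symm (by simpa using hx n), expNeg_top]]
  exact expNeg_antitone (sumOthers_mono (fun y => le_add_self) _ _)

namespace IsPoissonProcess

lemma measurable_sumOthers_norm (h : IsPoissonProcess μ X lam) {v : ℝ → Plane → ℝ≥0∞}
    (hv : Measurable (Function.uncurry v)) (n : ℕ) :
    Measurable fun ω => sumOthers (v ‖X n ω‖) (fun m => X m ω) n :=
  Measurable.tsum fun m => by
    split_ifs
    exacts [measurable_const, hv.comp ((h.measurable n).norm.prodMk (h.measurable m))]

lemma lintegral_tsum_expNeg_sumOthers_indicator_top_add [IsProbabilityMeasure μ]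
    (h : IsPoissonProcess μ X lam) (hlam : 0 < lam) {f : ℝ → Plane → ℝ≥0∞} {A : ℝ}
    (hf : Measurable (Function.uncurry f)) (hmono : MonotoneOn f (Ici 0)) (hA : 0 ≤ A)
    (hInt : ∀ r > 0, ∫⁻ x in (Metric.ball 0 r)ᶜ, (1 - expNeg (f r x))
      = ENNReal.ofReal (Real.pi * r ^ 2 * A)) {s : ℝ → Set Plane} (hsmono : Monotone s)
    (hs : MeasurableSet {p : ℝ × Plane | p.2 ∈ s p.1})
    (hsball : ∀ r, s r =ᵐ[volume] Metric.ball 0 r) :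
    ∫⁻ ω, ∑' n, expNeg (sumOthers ((s ‖X n ω‖).indicator ⊤ + f ‖X n ω‖) (fun m => X m ω) n) ∂μ
      = ENNReal.ofReal (1 / (1 + A)) := by
  have hv : Measurable (Function.uncurry fun r => (s r).indicator ⊤ + f r) :=
    (measurable_const.indicator hs).add hf
  have hvmono : MonotoneOn (fun r => (s r).indicator ⊤ + f r) (Ici 0) := fun a ha b hb hab =>
    add_le_add (indicator_le_indicator_of_subset (hsmono hab) fun _ => zero_le) (hmono ha hb hab)
  rw [lintegral_tsum (f := fun n ω =>
      expNeg (sumOthers ((s ‖X n ω‖).indicator ⊤ + f ‖X n ω‖) (fun m => X m ω) n)) fun n =>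
      (measurable_expNeg.comp (h.measurable_sumOthers_norm hv n)).aemeasurable,
    h.tsum_lintegral_expNeg_sumOthers_norm hlam (fun r => hv.of_uncurry_left) hvmono,
    lintegral_laplaceFunctional_indicator_top_add hlam hA hInt
      (s := s) (fun r => measurable_prodMk_left hs) hsball]

theorem lintegral_expNeg_sumOthers_nearest [IsProbabilityMeasure μ]
    (h : IsPoissonProcess μ X lam) (hlam : 0 < lam) {f : ℝ → Plane → ℝ≥0∞} {A : ℝ}
    (hf : Measurable (Function.uncurry f)) (hmono : MonotoneOn f (Ici 0)) (hA : 0 ≤ A)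
    (hInt : ∀ r > 0, ∫⁻ x in (Metric.ball 0 r)ᶜ, (1 - expNeg (f r x))
      = ENNReal.ofReal (Real.pi * r ^ 2 * A)) :
    ∫⁻ ω, expNeg (sumOthers (f ‖X (nearest fun n => X n ω) ω‖) (fun n => X n ω)
      (nearest fun n => X n ω)) ∂μ = ENNReal.ofReal (1 / (1 + A)) := by
  have hball := h.lintegral_tsum_expNeg_sumOthers_indicator_top_add hlam hf hmono hA hInt
    (s := Metric.ball 0) (fun _ _ hab => Metric.ball_subset_ball hab)
    (by simpa using measurableSet_lt measurable_snd.norm measurable_fst)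
    fun r => Filter.EventuallyEq.refl _ _
  have hclosedBall := h.lintegral_tsum_expNeg_sumOthers_indicator_top_add hlam hf hmono hA hInt
    (s := Metric.closedBall 0) (fun _ _ hab => Metric.closedBall_subset_closedBall hab)
    (by simpa using measurableSet_le measurable_snd.norm measurable_fst)
    fun r => closedBall_ae_eq_ball 0 r
  refine le_antisymm ?_ ?_
  · refine (lintegral_mono_ae ?_).trans_eq hball
    exact h.ae_nearest_le.mono fun ω hω => expNeg_sumOthers_nearest_le (x := fun n => X n ω) hω f
  · refine hclosedBall.symm.trans_le (lintegral_mono_ae ?_)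
    exact h.ae_nearest_le.mono fun ω hω =>
      tsum_expNeg_sumOthers_le_nearest (x := fun n => X n ω) hω f

end IsPoissonProcess

end

/-! ### Rayleigh fading and the interference integrals -/

instance : IsProbabilityMeasure (expMeasure 1) := isProbabilityMeasure_expMeasure one_pos

lemma lintegral_expMeasure {g : ℝ → ℝ≥0∞} (hg : Measurable g) :
    ∫⁻ x, g x ∂(expMeasure 1) = ∫⁻ x in Ioi 0, ENNReal.ofReal (Real.exp (-x)) * g x := by
  have hpdf : Measurable (exponentialPDF 1) := (measurable_exponentialPDFReal 1).ennreal_ofReal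
  have hdens : expMeasure 1 = volume.withDensity (exponentialPDF 1) := rfl
  rw [hdens, lintegral_withDensity_eq_lintegral_mul _ hpdf hg,
    ← lintegral_indicator measurableSet_Ioi]
  refine lintegral_congr_ae ?_
  filter_upwards [Measure.ae_ne volume 0] with x hx
  rcases hx.lt_or_gt with hneg | hpos
  · simp [exponentialPDF_of_neg hneg, hneg.not_gt]
  · simp [exponentialPDF_of_nonneg hpos.le, hpos]

lemma expMeasure_lt_ofReal (T : ℝ≥0∞) : expMeasure 1 {h | T < ENNReal.ofReal h} = expNeg T := by
  rcases eq_or_ne T ∞ with rfl | hT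
  · simp
  lift T to ℝ≥0 using hT
  have hset : {h | (T : ℝ≥0∞) < ENNReal.ofReal h} = (Iic (T : ℝ))ᶜ := by
    ext h
    simp [ENNReal.lt_ofReal_iff_toReal_lt]
  have hcdf := cdf_expMeasure_eq one_pos (T : ℝ)
  rw [if_pos T.coe_nonneg, one_mul, cdf_eq_real] at hcdf
  rw [hset, prob_compl_eq_one_sub measurableSet_Iic, ← ofReal_measureReal, hcdf,
    ← ENNReal.ofReal_one, ← ENNReal.ofReal_sub _ (by simp), sub_sub_cancel,
    ← ENNReal.ofReal_coe_nnreal, expNeg_ofReal T.coe_nonneg]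

lemma ae_expMeasure_pos : ∀ᵐ h ∂(expMeasure 1), 0 < h := by
  have hpos := expMeasure_lt_ofReal 0
  rw [expNeg_zero, ← prob_compl_eq_zero_iff
    (measurableSet_lt measurable_const ENNReal.measurable_ofReal)] at hpos
  exact (measure_eq_zero_iff_ae_notMem.1 hpos).mono fun h hh => by simpa using hh

lemma lintegral_expNeg_expMeasure {t : ℝ} (ht : 0 ≤ t) :
    ∫⁻ h, expNeg (ENNReal.ofReal (t * h)) ∂(expMeasure 1) = ENNReal.ofReal (1 / (1 + t)) := by
  have hneg : -(1 + t) < 0 := by linarith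
  calc ∫⁻ h, expNeg (ENNReal.ofReal (t * h)) ∂(expMeasure 1)
      = ∫⁻ h in Ioi 0, ENNReal.ofReal (Real.exp (-h)) * expNeg (ENNReal.ofReal (t * h)) :=
        lintegral_expMeasure (by fun_prop)
    _ = ∫⁻ h in Ioi (0 : ℝ), ENNReal.ofReal (Real.exp (-(1 + t) * h)) := by
        refine setLIntegral_congr_fun measurableSet_Ioi fun h hh => ?_
        rw [expNeg_ofReal (mul_nonneg ht (mem_Ioi.1 hh).le),
          ← ENNReal.ofReal_mul (Real.exp_pos _).le, ← Real.exp_add]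
        ring_nf
    _ = ENNReal.ofReal (1 / (1 + t)) := by
        rw [← ofReal_integral_eq_lintegral_ofReal (integrableOn_exp_mul_Ioi hneg 0)
          (ae_of_all _ fun h => (Real.exp_pos _).le), integral_exp_mul_Ioi hneg, mul_zero,
          Real.exp_zero, neg_div_neg_eq]

lemma lintegral_rpow_expMeasure {p : ℝ} (hp : -1 < p) :
    ∫⁻ h, ENNReal.ofReal (h ^ p) ∂(expMeasure 1) = ENNReal.ofReal (Real.Gamma (1 + p)) := by
  have hp' : 0 < 1 + p := by linarith
  rw [lintegral_expMeasure (by fun_prop), Real.Gamma_eq_integral hp',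
    ofReal_integral_eq_lintegral_ofReal (Real.GammaIntegral_convergent hp')
      ((ae_restrict_mem measurableSet_Ioi).mono fun h (hh : 0 < h) => by positivity)]
  refine setLIntegral_congr_fun measurableSet_Ioi fun h _ => ?_
  rw [← ENNReal.ofReal_mul (Real.exp_pos _).le, add_sub_cancel_left]

lemma volume_le_mul_rpow_neg {β k e : ℝ} (hβ : 0 < β) (hk : 0 < k) (he : 0 < e) :
    volume {x : Plane | e ≤ k * ‖x‖ ^ (-β)}
      = ENNReal.ofReal (Real.pi * (k ^ (2 / β) * e ^ (-(2 / β)))) := by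
  have hset : {x : Plane | e ≤ k * ‖x‖ ^ (-β)}
      = Metric.closedBall 0 ((k / e) ^ β⁻¹) \ {0} := by
    ext x
    simp only [mem_ofPred_eq, Set.mem_sdiff, mem_closedBall_zero_iff, mem_singleton_iff]
    rcases eq_or_ne x 0 with rfl | hx
    · simp [Real.zero_rpow (neg_ne_zero.2 hβ.ne'), he]
    · have hx' : 0 < ‖x‖ := norm_pos_iff.2 hx
      rw [Real.rpow_neg hx'.le, Real.le_rpow_inv_iff_of_pos hx'.le (by positivity) hβ,
        le_div_iff₀ he, ← div_eq_mul_inv, le_div_iff₀ (by positivity), mul_comm]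
      simp [hx]
  rw [hset, measure_sdiff_null (measure_singleton _), Measure.addHaar_closedBall_eq_addHaar_ball,
    volume_ball_plane (by positivity), ← Real.rpow_mul_natCast (by positivity),
    Real.div_rpow hk.le he.le, Real.rpow_neg he.le, Nat.cast_ofNat, inv_mul_eq_div, div_eq_mul_inv]

/- This turns a Laplace exponent under Rayleigh fading into the measure of a set. -/
lemma expMeasure_prod_le_mul {t : ℝ} (ht : 0 ≤ t) :
    (expMeasure 1).prod (expMeasure 1) {p | p.2 ≤ t * p.1}
      = 1 - ENNReal.ofReal (1 / (1 + t)) := by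
  have hfiber (h : ℝ) (hh : 0 < h) :
      expMeasure 1 {e | e ≤ t * h} = 1 - expNeg (ENNReal.ofReal (t * h)) := by
    have hcompl : {e | e ≤ t * h} = {e | ENNReal.ofReal (t * h) < ENNReal.ofReal e}ᶜ := by
      ext e
      simp [ENNReal.ofReal_le_ofReal_iff (show 0 ≤ t * h by positivity)]
    rw [hcompl, prob_compl_eq_one_sub
      (measurableSet_lt measurable_const ENNReal.measurable_ofReal), expMeasure_lt_ofReal]
  rw [Measure.prod_apply (measurableSet_le (by fun_prop) (by fun_prop))]
  refine (lintegral_congr_ae (ae_expMeasure_pos.mono hfiber)).trans ?_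
  rw [lintegral_sub (by fun_prop) (by simp [lintegral_expNeg_expMeasure ht])
      (ae_of_all _ fun _ => expNeg_le_one _), lintegral_expNeg_expMeasure ht]
  simp

lemma lintegral_one_sub_inv_one_add {β s : ℝ} (hβ : 2 < β) (hs : 0 < s) :
    ∫⁻ x : Plane, (1 - ENNReal.ofReal (1 / (1 + s * ‖x‖ ^ (-β))))
      = ENNReal.ofReal (Real.pi * s ^ (2 / β)
          * (Real.Gamma (1 + 2 / β) * Real.Gamma (1 - 2 / β))) := by
  have hβ0 : 0 < β := by linarith
  have hp : 2 / β < 1 := (div_lt_one hβ0).2 hβ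
  have hp0 : 0 < 2 / β := by positivity
  set ν := (expMeasure 1).prod (expMeasure 1)
  have hS : MeasurableSet {q : Plane × ℝ × ℝ | q.2.2 ≤ s * ‖q.1‖ ^ (-β) * q.2.1} :=
    measurableSet_le (by fun_prop) (by fun_prop)
  have hpos : ∀ᵐ p ∂ν, 0 < p.1 ∧ 0 < p.2 :=
    (Measure.quasiMeasurePreserving_fst.ae ae_expMeasure_pos).and
      (Measure.quasiMeasurePreserving_snd.ae ae_expMeasure_pos)
  have hfiber (p : ℝ × ℝ) (hp : 0 < p.1 ∧ 0 < p.2) :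
      volume {x : Plane | p.2 ≤ s * ‖x‖ ^ (-β) * p.1}
        = ENNReal.ofReal (Real.pi * s ^ (2 / β))
          * (ENNReal.ofReal (p.1 ^ (2 / β)) * ENNReal.ofReal (p.2 ^ (-(2 / β)))) := by
    have hp1 := hp.1
    simp_rw [mul_right_comm s]
    rw [volume_le_mul_rpow_neg hβ0 (by positivity) hp.2, Real.mul_rpow hs.le hp.1.le,
      ← ENNReal.ofReal_mul (by positivity), ← ENNReal.ofReal_mul (by positivity)]
    ring_nf
  calc ∫⁻ x : Plane, (1 - ENNReal.ofReal (1 / (1 + s * ‖x‖ ^ (-β))))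
      = ∫⁻ x : Plane, ν {p | p.2 ≤ s * ‖x‖ ^ (-β) * p.1} :=
        lintegral_congr fun x => (expMeasure_prod_le_mul (by positivity)).symm
    _ = ∫⁻ p, volume {x : Plane | p.2 ≤ s * ‖x‖ ^ (-β) * p.1} ∂ν :=
        (Measure.prod_apply hS).symm.trans (Measure.prod_apply_symm hS)
    _ = ENNReal.ofReal (Real.pi * s ^ (2 / β))
          * ∫⁻ p, ENNReal.ofReal (p.1 ^ (2 / β)) * ENNReal.ofReal (p.2 ^ (-(2 / β))) ∂ν := by
        rw [lintegral_congr_ae (hpos.mono hfiber), lintegral_const_mul _ (by fun_prop)]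
    _ = _ := by
        rw [lintegral_prod_mul (f := fun h => ENNReal.ofReal (h ^ (2 / β)))
          (g := fun e => ENNReal.ofReal (e ^ (-(2 / β)))) (by fun_prop) (by fun_prop),
          lintegral_rpow_expMeasure (by linarith), lintegral_rpow_expMeasure (by linarith),
          ← ENNReal.ofReal_mul (Real.Gamma_pos_of_pos (by linarith)).le,
          ← ENNReal.ofReal_mul (by positivity), ← sub_eq_add_neg]

lemma intervalIntegrable_rpow_neg_div {p g : ℝ} (hp : p < 1) (hg : 0 ≤ g) :
    IntervalIntegrable (fun t : ℝ => t ^ (-p) / (1 + g * t)) volume 0 1 := by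
  have hrpow : IntervalIntegrable (fun t : ℝ => t ^ (-p)) volume 0 1 :=
    intervalIntegral.intervalIntegrable_rpow' (by linarith)
  refine hrpow.mono_fun (Measurable.aestronglyMeasurable (by fun_prop)) ?_
  rw [uIoc_of_le zero_le_one]
  refine (ae_restrict_mem measurableSet_Ioc).mono fun t ht => ?_
  have hgt : 0 ≤ g * t := mul_nonneg hg ht.1.le
  refine (norm_div _ _).trans_le (div_le_self (norm_nonneg _) ?_)
  rw [Real.norm_of_nonneg] <;> linarith

lemma image_mul_rpow_neg_Ioc {a p : ℝ} (ha : 0 < a) (hp : 0 < p) :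
    (fun t : ℝ => a * t ^ (-p)) '' Ioc 0 1 = Ici a := by
  ext u
  constructor
  · rintro ⟨t, ht, rfl⟩
    exact le_mul_of_one_le_right ha.le
      (Real.one_le_rpow_of_pos_of_le_one_of_nonpos ht.1 ht.2 (neg_nonpos.2 hp.le))
  · intro hu
    have hu0 : 1 ≤ u / a := (one_le_div ha).2 hu
    refine ⟨(u / a) ^ (-p)⁻¹, ⟨by positivity,
      Real.rpow_le_one_of_one_le_of_nonpos hu0 (inv_nonpos.2 (neg_nonpos.2 hp.le))⟩, ?_⟩
    beta_reduce
    rw [Real.rpow_inv_rpow (by positivity) (neg_ne_zero.2 hp.ne'), mul_div_cancel₀ _ ha.ne']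

lemma lintegral_Ici_eq_lintegral_Ioc_rpow_neg {a p : ℝ} (ha : 0 < a) (hp : 0 < p)
    (φ : ℝ → ℝ≥0∞) :
    ∫⁻ u in Ici a, φ u
      = ∫⁻ t in Ioc 0 1, ENNReal.ofReal (a * (p * t ^ (-p - 1))) * φ (a * t ^ (-p)) := by
  have hderiv (t) (ht : t ∈ Ioc (0 : ℝ) 1) :
      HasDerivWithinAt (fun t : ℝ => a * t ^ (-p)) (a * (-p * t ^ (-p - 1))) (Ioc 0 1) t :=
    ((Real.hasDerivAt_rpow_const (.inl ht.1.ne')).const_mul a).hasDerivWithinAt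
  have hinj : InjOn (fun t : ℝ => a * t ^ (-p)) (Ioc 0 1) := fun s hs t ht hst =>
    Real.rpow_left_injOn (neg_ne_zero.2 hp.ne') hs.1.le ht.1.le (mul_left_cancel₀ ha.ne' hst)
  rw [← image_mul_rpow_neg_Ioc ha hp,
    lintegral_image_eq_lintegral_abs_deriv_mul measurableSet_Ioc hderiv hinj]
  refine setLIntegral_congr_fun measurableSet_Ioc fun t ht => ?_
  have ht0 := ht.1
  rw [neg_mul, mul_neg, abs_neg, abs_of_pos (by positivity)]

lemma lintegral_compl_ball_comp_normSq {φ : ℝ → ℝ≥0∞} {r : ℝ} (hr : 0 < r) (hφ : Measurable φ) :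
    ∫⁻ x in (Metric.ball (0 : Plane) r)ᶜ, φ (‖x‖ ^ 2)
      = ENNReal.ofReal Real.pi * ∫⁻ u in Ici (r ^ 2), φ u := by
  have hindicator (x : Plane) : (Metric.ball 0 r)ᶜ.indicator (fun x => φ (‖x‖ ^ 2)) x
      = (Ici (r ^ 2)).indicator φ (‖x‖ ^ 2) := by
    simp only [indicator, mem_compl_iff, Metric.mem_ball, dist_zero_right, not_lt, mem_Ici,
      pow_le_pow_iff_left₀ hr.le (norm_nonneg x) two_ne_zero]
  rw [← lintegral_indicator measurableSet_ball.compl, lintegral_congr hindicator,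
    lintegral_comp_normSq (hφ.indicator measurableSet_Ici),
    setLIntegral_indicator measurableSet_Ici,
    inter_eq_self_of_subset_left (Ici_subset_Ioi.2 (by positivity))]

namespace Params

variable {c : Params}

lemma Z_eq_integral (hβ : 2 < c.β) (g : ℝ) :
    c.Z g = 2 / c.β * g * ∫ t in (0 : ℝ)..1, t ^ (-(2 / c.β)) / (1 + g * t) := by
  have hβ0 : 0 < c.β := by linarith
  have hp : 0 < 1 - 2 / c.β := sub_pos.2 ((div_lt_one hβ0).2 hβ)
  have hGamma : Real.Gamma (2 - 2 / c.β) = (1 - 2 / c.β) * Real.Gamma (1 - 2 / c.β) := by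
    rw [← Real.Gamma_add_one hp.ne']
    ring_nf
  have hintegrand (t : ℝ) :
      t ^ (1 - 2 / c.β - 1) * (1 - t) ^ ((1 : ℝ) - 1) * (1 - -g * t) ^ (-1 : ℝ)
        = t ^ (-(2 / c.β)) / (1 + g * t) := by
    rw [sub_self, Real.rpow_zero, mul_one, Real.rpow_neg_one, ← div_eq_mul_inv]
    ring_nf
  rw [Z, hyp2F1, show 2 - 2 / c.β - (1 - 2 / c.β) = 1 by ring, Real.Gamma_one, mul_one, hGamma,
    mul_div_cancel_right₀ _ (Real.Gamma_pos_of_pos hp).ne']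
  simp_rw [hintegrand]
  have hβ2 : c.β - 2 ≠ 0 := by linarith
  field_simp

lemma Z_nonneg (hβ : 2 < c.β) {g : ℝ} (hg : 0 ≤ g) : 0 ≤ c.Z g := by
  rw [Z_eq_integral hβ]
  have : 0 ≤ 2 / c.β := div_nonneg two_pos.le (by linarith)
  refine mul_nonneg (by positivity) (intervalIntegral.integral_nonneg zero_le_one fun t ht => ?_)
  have ht0 := ht.1
  positivity

lemma lintegral_Ioc_eq_Z (hβ : 2 < c.β) {g : ℝ} (hg : 0 ≤ g) :
    ∫⁻ t in Ioc (0 : ℝ) 1, ENNReal.ofReal (2 / c.β * g * (t ^ (-(2 / c.β)) / (1 + g * t)))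
      = ENNReal.ofReal (c.Z g) := by
  have : 0 < 2 / c.β := div_pos two_pos (by linarith)
  have hint : IntegrableOn (fun t : ℝ => 2 / c.β * g * (t ^ (-(2 / c.β)) / (1 + g * t)))
      (Ioc 0 1) :=
    ((intervalIntegrable_iff_integrableOn_Ioc_of_le zero_le_one).1
      (intervalIntegrable_rpow_neg_div ((div_lt_one (by linarith)).2 hβ) hg)).const_mul _
  rw [Z_eq_integral hβ, intervalIntegral.integral_of_le zero_le_one, ← integral_const_mul,
    ofReal_integral_eq_lintegral_ofReal hint]
  refine (ae_restrict_mem measurableSet_Ioc).mono fun t ht => ?_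
  have ht0 := ht.1
  rw [Pi.zero_apply]
  positivity

/- Substituting `u = r² t^(-2/β)` for the squared distance gives Euler's integral for `Z`. -/
lemma lintegral_Ici_one_sub_inv_one_add (hβ : 2 < c.β) {g r : ℝ} (hg : 0 ≤ g) (hr : 0 < r) :
    ∫⁻ u in Ici (r ^ 2), (1 - ENNReal.ofReal (1 / (1 + g * r ^ c.β * u ^ (-(c.β / 2)))))
      = ENNReal.ofReal (r ^ 2) * ENNReal.ofReal (c.Z g) := by
  have : 0 < c.β := by linarith
  rw [lintegral_Ici_eq_lintegral_Ioc_rpow_neg (p := 2 / c.β) (by positivity) (by positivity),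
    ← lintegral_Ioc_eq_Z hβ hg, ← lintegral_const_mul _ (by fun_prop)]
  refine setLIntegral_congr_fun measurableSet_Ioc fun t ht => ?_
  have ht0 := ht.1
  have hbase : g * r ^ c.β * (r ^ 2 * t ^ (-(2 / c.β))) ^ (-(c.β / 2)) = g * t := by
    rw [Real.mul_rpow (by positivity) (by positivity), ← Real.rpow_mul ht0.le,
      ← Real.rpow_natCast_mul hr.le, show -(2 / c.β) * -(c.β / 2) = 1 by field_simp,
      Real.rpow_one, Nat.cast_ofNat, show 2 * -(c.β / 2) = -c.β by ring, Real.rpow_neg hr.le]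
    field_simp
  rw [hbase, ← ENNReal.ofReal_one, ← ENNReal.ofReal_sub _ (by positivity),
    ← ENNReal.ofReal_mul (by positivity), ← ENNReal.ofReal_mul (by positivity),
    Real.rpow_sub_one ht0.ne']
  congr 1
  field_simp
  ring

lemma lintegral_compl_ball_one_sub_inv_one_add (hβ : 2 < c.β) {g r : ℝ} (hg : 0 ≤ g)
    (hr : 0 < r) :
    ∫⁻ x in (Metric.ball (0 : Plane) r)ᶜ,
        (1 - ENNReal.ofReal (1 / (1 + g * r ^ c.β * ‖x‖ ^ (-c.β))))
      = ENNReal.ofReal (Real.pi * r ^ 2 * c.Z g) := by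
  have hnormSq (x : Plane) : ‖x‖ ^ (-c.β) = (‖x‖ ^ 2) ^ (-(c.β / 2)) := by
    rw [← Real.rpow_natCast_mul (norm_nonneg x)]
    ring_nf
  simp_rw [hnormSq]
  rw [lintegral_compl_ball_comp_normSq hr
      (φ := fun u => 1 - ENNReal.ofReal (1 / (1 + g * r ^ c.β * u ^ (-(c.β / 2))))) (by fun_prop),
    lintegral_Ici_one_sub_inv_one_add hβ hg hr, ← ENNReal.ofReal_mul (by positivity),
    ← ENNReal.ofReal_mul Real.pi_pos.le, mul_assoc]

end Params

/-! ### Independence between the components of the network -/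

section

lemma iIndep_iSup_of_pairwise_disjoint {Ω ι κ : Type*} {mΩ : MeasurableSpace Ω} {μ : Measure Ω}
    {m : ι → MeasurableSpace Ω} (hm : ∀ i, m i ≤ mΩ) (hind : iIndep m μ) {S : κ → Set ι}
    (hS : Pairwise fun j k => Disjoint (S j) (S k)) :
    iIndep (fun k => ⨆ i ∈ S k, m i) μ := by
  classical
  have := hind.isProbabilityMeasure
  rw [iIndep_iff]
  intro s
  induction s using Finset.induction_on with
  | empty => intro f _; simp
  | insert a s ha ih =>
    intro f hf
    rw [Finset.set_biInter_insert, Finset.prod_insert ha,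
      ← ih fun i hi => hf i (Finset.mem_insert_of_mem hi)]
    have hdisj : Disjoint (S a) (⋃ k ∈ s, S k) := by
      simp only [disjoint_iUnion_right]
      exact fun k hk => hS fun h => ha (h ▸ hk)
    refine (Indep_iff _ _ μ).1 (indep_iSup_of_disjoint hm hind hdisj) _ _
      (hf a (Finset.mem_insert_self _ _)) (Finset.measurableSet_biInter s fun k hk => ?_)
    have hle : ⨆ i ∈ S k, m i ≤ ⨆ i ∈ ⋃ k ∈ s, S k, m i :=
      biSup_mono fun i hi => mem_biUnion hk hi
    exact hle _ (hf k (Finset.mem_insert_of_mem hk))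

variable {Ω : Type*} [MeasurableSpace Ω] {μ : Measure Ω}

lemma lintegral_of_indepFun [IsProbabilityMeasure μ] {E F : Type*} [MeasurableSpace E]
    [MeasurableSpace F] {X : Ω → E} {Y : Ω → F} (h : IndepFun X Y μ) (hX : Measurable X)
    (hY : Measurable Y) {Φ : E × F → ℝ≥0∞} (hΦ : Measurable Φ) :
    ∫⁻ ω, Φ (X ω, Y ω) ∂μ = ∫⁻ ω, ∫⁻ ω', Φ (X ω, Y ω') ∂μ ∂μ := by
  have := Measure.isProbabilityMeasure_map (μ := μ) hY.aemeasurable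
  rw [← lintegral_map hΦ (hX.prodMk hY),
    (indepFun_iff_map_prod_eq_prod_map_map hX.aemeasurable hY.aemeasurable).1 h,
    lintegral_prod _ hΦ.aemeasurable, lintegral_map hΦ.lintegral_prod_right' hX]
  exact lintegral_congr fun ω => lintegral_map (hΦ.comp measurable_prodMk_left) hY

lemma measure_of_indepFun [IsProbabilityMeasure μ] {E F : Type*} [MeasurableSpace E]
    [MeasurableSpace F] {X : Ω → E} {Y : Ω → F} (h : IndepFun X Y μ) (hX : Measurable X)
    (hY : Measurable Y) {D : Set (E × F)} (hD : MeasurableSet D) :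
    μ {ω | (X ω, Y ω) ∈ D} = ∫⁻ ω, μ {ω' | (X ω, Y ω') ∈ D} ∂μ := by
  refine (lintegral_indicator_one ((hX.prodMk hY) hD)).symm.trans
    ((lintegral_of_indepFun h hX hY (measurable_one.indicator hD)).trans ?_)
  exact lintegral_congr fun ω =>
    lintegral_indicator_one ((measurable_const.prodMk hY) hD)

lemma measure_lt_ofReal_of_indepFun [IsProbabilityMeasure μ] {T : Ω → ℝ≥0∞} {h : Ω → ℝ}
    (hT : Measurable T) (hh : Measurable h) (hlaw : μ.map h = expMeasure 1)
    (hind : IndepFun T h μ) :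
    μ {ω | T ω < ENNReal.ofReal (h ω)} = ∫⁻ ω, expNeg (T ω) ∂μ := by
  refine (measure_of_indepFun hind hT hh (D := {p | p.1 < ENNReal.ofReal p.2})
    (measurableSet_lt measurable_fst (by fun_prop))).trans (lintegral_congr fun ω => ?_)
  rw [← expMeasure_lt_ofReal, ← hlaw,
    Measure.map_apply hh (measurableSet_lt measurable_const (by fun_prop))]
  rfl

lemma lintegral_expNeg_mul_of_map_eq {h : Ω → ℝ} (hh : Measurable h)
    (hlaw : μ.map h = expMeasure 1) {t : ℝ} (ht : 0 ≤ t) :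
    ∫⁻ ω, expNeg (ENNReal.ofReal (t * h ω)) ∂μ = ENNReal.ofReal (1 / (1 + t)) := by
  rw [← lintegral_expNeg_expMeasure ht, ← hlaw, lintegral_map (by fun_prop) hh]

lemma lintegral_expNeg_tsum_of_iIndepFun [IsProbabilityMeasure μ] {Y : ℕ → Ω → ℝ≥0∞}
    (hY : ∀ n, Measurable (Y n)) (hind : iIndepFun Y μ) :
    ∫⁻ ω, expNeg (∑' n, Y n ω) ∂μ = expNeg (∑' n, negLog (∫⁻ ω, expNeg (Y n ω) ∂μ)) := by
  have hle (n) : ∫⁻ ω, expNeg (Y n ω) ∂μ ≤ 1 :=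
    (lintegral_mono fun ω => expNeg_le_one _).trans (by simp)
  have hprod := tendsto_prod_expNeg fun n => negLog (∫⁻ ω, expNeg (Y n ω) ∂μ)
  simp_rw [expNeg_negLog (hle _)] at hprod
  have hmeas (n) : Measurable fun ω => expNeg (Y n ω) := measurable_expNeg.comp (hY n)
  have hlim : Tendsto (fun N => ∫⁻ ω, ∏ n ∈ Finset.range N, expNeg (Y n ω) ∂μ) atTop
      (𝓝 (∫⁻ ω, expNeg (∑' n, Y n ω) ∂μ)) :=
    tendsto_lintegral_of_dominated_convergence (fun _ => 1)
      (fun N => Finset.measurable_prod _ fun n _ => hmeas n)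
      (fun N => ae_of_all _ fun ω => Finset.prod_le_one' fun n _ => expNeg_le_one _) (by simp)
      (ae_of_all _ fun ω => tendsto_prod_expNeg _)
  refine tendsto_nhds_unique hlim (hprod.congr fun N => ?_)
  exact (lintegral_prod_eq_prod_lintegral_of_indepFun _ _
    (hind.comp (fun _ => expNeg) fun _ => measurable_expNeg) hmeas).symm

end

namespace Network

section

variable {Ω : Type*}

/-- The σ-algebra generated by a set of sources of randomness; independence of two functionals of
the network is derived from measurability with respect to disjoint sets of sources. -/
abbrev sigmaOn (W : Network Ω) (S : Set Source) : MeasurableSpace Ω := ⨆ i ∈ S, W.sigma i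

variable (W : Network Ω) {S : Set Source}

lemma sigma_le_sigmaOn {i : Source} (hi : i ∈ S) : W.sigma i ≤ W.sigmaOn S :=
  le_biSup W.sigma hi

lemma measurable_bs_sigmaOn (h : Source.bs ∈ S) (n : ℕ) : Measurable[W.sigmaOn S] (W.bs n) :=
  Measurable.of_comap_le <|
    (le_iSup (fun n => MeasurableSpace.comap (W.bs n) inferInstance) n).trans (W.sigma_le_sigmaOn h)

lemma measurable_state_sigmaOn {n : ℕ} (h : Source.state n ∈ S) :
    Measurable[W.sigmaOn S] (W.state n) :=
  Measurable.of_comap_le (W.sigma_le_sigmaOn h)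

lemma measurable_gainU_sigmaOn {n : ℕ} (h : Source.gainU n ∈ S) :
    Measurable[W.sigmaOn S] (W.gainU n) :=
  Measurable.of_comap_le (W.sigma_le_sigmaOn h)

lemma measurable_er_sigmaOn (h : Source.er ∈ S) (j : ℕ) : Measurable[W.sigmaOn S] (W.er j) :=
  Measurable.of_comap_le <|
    (le_iSup (fun n => MeasurableSpace.comap (W.er n) inferInstance) j).trans (W.sigma_le_sigmaOn h)

lemma measurable_gainE_sigmaOn {j : ℕ} (h : Source.gainE j ∈ S) :
    Measurable[W.sigmaOn S] (W.gainE j) :=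
  Measurable.of_comap_le (W.sigma_le_sigmaOn h)

lemma measurable_field_sigmaOn {j : ℕ} (h : Source.field j ∈ S) (k : ℕ) :
    Measurable[W.sigmaOn S] (W.field j k) :=
  Measurable.of_comap_le <|
    (le_iSup (fun n => MeasurableSpace.comap (W.field j n) inferInstance) k).trans
      (W.sigma_le_sigmaOn h)

lemma measurable_gainI_sigmaOn {j k : ℕ} (h : Source.gainI j k ∈ S) :
    Measurable[W.sigmaOn S] (W.gainI j k) :=
  Measurable.of_comap_le (W.sigma_le_sigmaOn h)

end

section

variable {Ω : Type*} [mΩ : MeasurableSpace Ω] {μ : Measure Ω} {c : Params} {W : Network Ω}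

lemma IsModel.sigma_le (h : W.IsModel μ c) (i : Source) : W.sigma i ≤ mΩ := by
  cases i with
  | bs => exact iSup_le fun n => (h.bs_poisson.measurable n).comap_le
  | state n => exact (h.state_measurable n).comap_le
  | gainU n => exact (h.gainU_law n).1.comap_le
  | er => exact iSup_le fun n => (h.er_poisson.measurable n).comap_le
  | gainE n => exact (h.gainE_law n).1.comap_le
  | field j => exact iSup_le fun n => ((h.field_poisson j).measurable n).comap_le
  | gainI j k => exact (h.gainI_law j k).1.comap_le

lemma IsModel.indepFun_of_disjoint (h : W.IsModel μ c) {S T : Set Source} (hST : Disjoint S T)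
    {E F : Type*} [MeasurableSpace E] [MeasurableSpace F] {f : Ω → E} {g : Ω → F}
    (hf : Measurable[W.sigmaOn S] f) (hg : Measurable[W.sigmaOn T] g) : IndepFun f g μ :=
  (IndepFun_iff_Indep f g μ).2 <|
    indep_of_indep_of_le (indep_iSup_of_disjoint h.sigma_le h.indep hST) hf.comap_le hg.comap_le

lemma IsModel.iIndepFun_of_disjoint (h : W.IsModel μ c) {κ : Type*} {S : κ → Set Source}
    (hS : Pairwise fun j k => Disjoint (S j) (S k)) {E : κ → Type*}
    [∀ k, MeasurableSpace (E k)] {f : ∀ k, Ω → E k} (hf : ∀ k, Measurable[W.sigmaOn (S k)] (f k)) :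
    iIndepFun f μ :=
  (iIndepFun_iff_iIndep _ f μ).2 <|
    iIndep_of_iIndep_of_le (iIndep_iSup_of_pairwise_disjoint h.sigma_le h.indep hS)
      fun k => (hf k).comap_le

end

section

variable {Ω : Type*} {mΩ : MeasurableSpace Ω} {c : Params} {W : Network Ω}

lemma measurable_serving (hb : ∀ n, Measurable (W.bs n)) : Measurable W.serving :=
  measurable_nearest.comp (measurable_pi_lambda _ hb)

lemma measurable_bs_serving (hb : ∀ n, Measurable (W.bs n)) :
    Measurable fun ω => W.bs (W.serving ω) ω :=
  measurable_apply_nearest.comp (measurable_pi_lambda _ hb)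

lemma measurable_interferenceU (hb : ∀ n, Measurable (W.bs n)) (hs : ∀ n, Measurable (W.state n))
    (hg : ∀ n, Measurable (W.gainU n)) (s : BSState) : Measurable (W.interferenceU c s) := by
  refine Measurable.tsum fun n => Measurable.ite ?_ ?_ measurable_const
  · have hserving : MeasurableSet {ω | n ≠ W.serving ω} :=
      (measurableSet_eq_fun measurable_const (measurable_serving hb)).compl
    exact hserving.inter (hs n (measurableSet_singleton s))
  · have := hb n
    have := hg n
    fun_prop

lemma measurable_sinrU (hb : ∀ n, Measurable (W.bs n)) (hs : ∀ n, Measurable (W.state n))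
    (hg : ∀ n, Measurable (W.gainU n)) : Measurable (W.sinrU c) := by
  have hgain : Measurable fun ω => W.gainU (W.serving ω) ω :=
    (measurable_from_prod_countable_right (f := fun p : ℕ × Ω => W.gainU p.1 p.2) hg).comp
      ((measurable_serving hb).prodMk measurable_id)
  have := measurable_bs_serving hb
  have := measurable_interferenceU (c := c) hb hs hg .secure
  have := measurable_interferenceU (c := c) hb hs hg .normalUncached
  unfold sinrU
  fun_prop

lemma measurable_interferenceE {j : ℕ} (he : Measurable (W.er j))
    (hf : ∀ k, Measurable (W.field j k)) (hI : ∀ k, Measurable (W.gainI j k)) :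
    Measurable (W.interferenceE c j) := by
  unfold interferenceE
  fun_prop

lemma measurable_sinrE (hb : ∀ n, Measurable (W.bs n)) {j : ℕ} (he : Measurable (W.er j))
    (hg : Measurable (W.gainE j)) (hf : ∀ k, Measurable (W.field j k))
    (hI : ∀ k, Measurable (W.gainI j k)) : Measurable (W.sinrE c j) := by
  have := measurable_bs_serving hb
  have := measurable_interferenceE (c := c) he hf hI
  unfold sinrE receivedE
  fun_prop

lemma measurable_sinrMaxE (hb : ∀ n, Measurable (W.bs n))
    (he : ∀ j, Measurable (W.er j)) (hg : ∀ j, Measurable (W.gainE j))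
    (hf : ∀ j k, Measurable (W.field j k)) (hI : ∀ j k, Measurable (W.gainI j k)) :
    Measurable (W.sinrMaxE c) :=
  Measurable.iSup fun j => measurable_sinrE hb (he j) (hg j) (hf j) (hI j)

end

end Network

/-! ### Coverage of the user -/

lemma one_div_one_add_le_one {t : ℝ} (ht : 0 ≤ t) : 1 / (1 + t) ≤ 1 :=
  div_le_one_of_le₀ (by linarith) (by linarith)

namespace Params

variable {c : Params}

/-- The interference-limited regime `σ² = 0`, in which the closed form is derived; the request
probabilities enter through the cache hit probability `δ`. -/
structure InterferenceLimited (c : Params) : Prop where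
  δ_nonneg : 0 ≤ c.δ
  δ_lt_one : c.δ < 1
  α_nonneg : 0 ≤ c.α
  α_le_one : c.α ≤ 1
  θ_pos : 0 < c.θ
  θ_le_one : c.θ ≤ 1
  two_lt_β : 2 < c.β
  P_pos : 0 < c.P
  σ2_eq_zero : c.σ2 = 0
  lamB_pos : 0 < c.lamB
  lamE_pos : 0 < c.lamE

lemma Valid.interferenceLimited (hc : c.Valid) (hδ : c.δ < 1) (hσ : c.σ2 = 0) :
    c.InterferenceLimited where
  δ_nonneg := Finset.sum_nonneg fun i _ => hc.p_nonneg i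
  δ_lt_one := hδ
  α_nonneg := hc.α_nonneg
  α_le_one := hc.α_le_one
  θ_pos := hc.θ_pos
  θ_le_one := hc.θ_le_one
  two_lt_β := hc.two_lt_β
  P_pos := hc.P_pos
  σ2_eq_zero := hσ
  lamB_pos := hc.lamB_pos
  lamE_pos := hc.lamE_pos

/-- Strength of the interference of a base station at the user, relative to that of a base station
in secure transmission. -/
def weight (c : Params) : BSState → ℝ
  | .secure => 1
  | .normalCached => 0
  | .normalUncached => 1 / c.θ

/-- `𝔼 exp (-τ · weight · gain)` for a base station with random state and Rayleigh fading. -/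
def laplaceU (c : Params) (τ : ℝ) : ℝ :=
  c.stateProb .secure * (1 / (1 + τ)) + c.stateProb .normalCached
    + c.stateProb .normalUncached * (1 / (1 + τ / c.θ))

/-- Contribution of a base station at `y` to the exponent of the coverage probability of a user
whose serving base station is at distance `r`. -/
def exponentU (c : Params) (γ r : ℝ) (y : Plane) : ℝ≥0∞ :=
  negLog (ENNReal.ofReal (c.laplaceU (γ * r ^ c.β * ‖y‖ ^ (-c.β))))

/-- The exponent `Z(γ) λ_b₁ / λ_b + Z(γ/θ) λ_b₃ / λ_b`. -/
def totalZ (c : Params) (γ : ℝ) : ℝ :=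
  c.Z γ * (c.lamB1 / c.lamB) + c.Z (γ / c.θ) * (c.lamB3 / c.lamB)

@[fun_prop]
lemma measurable_weight : Measurable c.weight := measurable_from_top

lemma measurable_exponentU (γ : ℝ) : Measurable (Function.uncurry (c.exponentU γ)) := by
  refine measurable_negLog.comp (Measurable.ennreal_ofReal ?_)
  unfold laplaceU
  fun_prop

namespace InterferenceLimited

lemma weight_nonneg (hc : c.InterferenceLimited) (s : BSState) : 0 ≤ c.weight s := by
  have := hc.θ_pos
  cases s <;> simp [weight, this.le]

lemma sum_requestShare_pos (hc : c.InterferenceLimited) :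
    0 < c.requestShare .secure + c.requestShare .normalCached + c.requestShare .normalUncached := by
  simp only [requestShare]
  nlinarith [mul_le_mul_of_nonneg_right hc.α_le_one hc.δ_nonneg, hc.δ_lt_one]

lemma stateProb_nonneg (hc : c.InterferenceLimited) (s : BSState) : 0 ≤ c.stateProb s := by
  have := hc.α_nonneg
  have := sub_nonneg.2 hc.α_le_one
  have := hc.δ_nonneg
  have := sub_nonneg.2 hc.δ_lt_one.le
  refine div_nonneg ?_ hc.sum_requestShare_pos.le
  cases s <;> simp only [requestShare] <;> positivity

lemma sum_stateProb (hc : c.InterferenceLimited) :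
    c.stateProb .secure + c.stateProb .normalCached + c.stateProb .normalUncached = 1 := by
  rw [stateProb, stateProb, stateProb, ← add_div, ← add_div,
    div_self hc.sum_requestShare_pos.ne']

lemma one_sub_laplaceU (hc : c.InterferenceLimited) (τ : ℝ) :
    1 - c.laplaceU τ = c.stateProb .secure * (1 - 1 / (1 + τ))
      + c.stateProb .normalUncached * (1 - 1 / (1 + τ / c.θ)) := by
  rw [laplaceU]
  linear_combination -hc.sum_stateProb

lemma laplaceU_nonneg (hc : c.InterferenceLimited) {τ : ℝ} (hτ : 0 ≤ τ) : 0 ≤ c.laplaceU τ := by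
  have := hc.θ_pos
  have := hc.stateProb_nonneg
  exact add_nonneg (add_nonneg (mul_nonneg (this _) (by positivity)) (this _))
    (mul_nonneg (this _) (by positivity))

lemma antitoneOn_laplaceU (hc : c.InterferenceLimited) : AntitoneOn c.laplaceU (Ici 0) := by
  intro a (ha : 0 ≤ a) b _ hab
  have := hc.θ_pos
  unfold laplaceU
  gcongr <;> exact hc.stateProb_nonneg _

lemma laplaceU_le_one (hc : c.InterferenceLimited) {τ : ℝ} (hτ : 0 ≤ τ) : c.laplaceU τ ≤ 1 := by
  simpa [laplaceU, hc.sum_stateProb] using hc.antitoneOn_laplaceU self_mem_Ici hτ hτ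

lemma monotoneOn_exponentU (hc : c.InterferenceLimited) {γ : ℝ} (hγ : 0 ≤ γ) :
    MonotoneOn (c.exponentU γ) (Ici 0) := by
  intro a (ha : 0 ≤ a) b (hb : 0 ≤ b) hab y
  have hpow : a ^ c.β ≤ b ^ c.β := Real.rpow_le_rpow ha hab (by linarith [hc.two_lt_β])
  refine negLog_antitone (ENNReal.ofReal_le_ofReal (hc.antitoneOn_laplaceU ?_ ?_ (by gcongr)))
  · exact mem_Ici.2 (by positivity)
  · exact mem_Ici.2 (by positivity)

lemma totalZ_eq (hc : c.InterferenceLimited) (γ : ℝ) :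
    c.totalZ γ = c.stateProb .secure * c.Z γ + c.stateProb .normalUncached * c.Z (γ / c.θ) := by
  have := hc.lamB_pos.ne'
  rw [totalZ, lamB1, lamB3]
  field_simp

lemma totalZ_nonneg (hc : c.InterferenceLimited) {γ : ℝ} (hγ : 0 ≤ γ) : 0 ≤ c.totalZ γ := by
  rw [hc.totalZ_eq]
  exact add_nonneg (mul_nonneg (hc.stateProb_nonneg _) (Z_nonneg hc.two_lt_β hγ))
    (mul_nonneg (hc.stateProb_nonneg _) (Z_nonneg hc.two_lt_β (div_nonneg hγ hc.θ_pos.le)))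

lemma one_sub_ofReal_laplaceU (hc : c.InterferenceLimited) {τ : ℝ} (hτ : 0 ≤ τ) :
    1 - ENNReal.ofReal (c.laplaceU τ)
      = ENNReal.ofReal (c.stateProb .secure) * (1 - ENNReal.ofReal (1 / (1 + τ)))
        + ENNReal.ofReal (c.stateProb .normalUncached)
          * (1 - ENNReal.ofReal (1 / (1 + τ / c.θ))) := by
  have hp := hc.stateProb_nonneg
  have hτθ := div_nonneg hτ hc.θ_pos.le
  have hnonneg {t : ℝ} (ht : 0 ≤ t) : 0 ≤ 1 - 1 / (1 + t) :=
    sub_nonneg.2 (one_div_one_add_le_one ht)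
  rw [← ENNReal.ofReal_one, ← ENNReal.ofReal_sub _ (hc.laplaceU_nonneg hτ),
    ← ENNReal.ofReal_sub _ (by positivity), ← ENNReal.ofReal_sub _ (by positivity),
    ← ENNReal.ofReal_mul (hp _), ← ENNReal.ofReal_mul (hp _),
    ← ENNReal.ofReal_add (mul_nonneg (hp _) (hnonneg hτ)) (mul_nonneg (hp _) (hnonneg hτθ)),
    hc.one_sub_laplaceU]

lemma one_sub_expNeg_exponentU (hc : c.InterferenceLimited) {γ r : ℝ} (hγ : 0 ≤ γ) (hr : 0 ≤ r)
    (y : Plane) :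
    1 - expNeg (c.exponentU γ r y)
      = ENNReal.ofReal (c.stateProb .secure)
          * (1 - ENNReal.ofReal (1 / (1 + γ * r ^ c.β * ‖y‖ ^ (-c.β))))
        + ENNReal.ofReal (c.stateProb .normalUncached)
          * (1 - ENNReal.ofReal (1 / (1 + γ / c.θ * r ^ c.β * ‖y‖ ^ (-c.β)))) := by
  rw [exponentU, expNeg_negLog (ENNReal.ofReal_le_one.2 (hc.laplaceU_le_one (by positivity))),
    hc.one_sub_ofReal_laplaceU (by positivity)]
  ring_nf

lemma lintegral_compl_ball_exponentU (hc : c.InterferenceLimited) {γ r : ℝ} (hγ : 0 ≤ γ)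
    (hr : 0 < r) :
    ∫⁻ y in (Metric.ball 0 r)ᶜ, (1 - expNeg (c.exponentU γ r y))
      = ENNReal.ofReal (Real.pi * r ^ 2 * c.totalZ γ) := by
  have hp := hc.stateProb_nonneg
  have hγθ := div_nonneg hγ hc.θ_pos.le
  have := Z_nonneg hc.two_lt_β hγ
  have := Z_nonneg hc.two_lt_β hγθ
  rw [lintegral_congr (hc.one_sub_expNeg_exponentU hγ hr.le), lintegral_add_left (by fun_prop),
    lintegral_const_mul _ (by fun_prop), lintegral_const_mul _ (by fun_prop),
    lintegral_compl_ball_one_sub_inv_one_add hc.two_lt_β hγ hr,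
    lintegral_compl_ball_one_sub_inv_one_add hc.two_lt_β hγθ hr,
    ← ENNReal.ofReal_mul (hp _), ← ENNReal.ofReal_mul (hp _),
    ← ENNReal.ofReal_add (mul_nonneg (hp _) (by positivity)) (mul_nonneg (hp _) (by positivity)),
    hc.totalZ_eq]
  ring_nf

open Classical in
lemma ofReal_mul_weight (hc : c.InterferenceLimited) (s : BSState) (r : ℝ) :
    ENNReal.ofReal (c.θ * c.P * (c.weight s * r))
      = ENNReal.ofReal (c.θ * c.P) * (if s = .secure then ENNReal.ofReal r else 0)
        + ENNReal.ofReal c.P * (if s = .normalUncached then ENNReal.ofReal r else 0) := by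
  have := hc.θ_pos
  have := hc.P_pos
  cases s with
  | secure => simp [weight, ENNReal.ofReal_mul (show 0 ≤ c.θ * c.P by positivity)]
  | normalCached => simp [weight]
  | normalUncached =>
    simp only [weight, reduceCtorEq, if_false, if_true, mul_zero, zero_add]
    rw [← ENNReal.ofReal_mul this.le]
    congr 1
    field_simp

end InterferenceLimited

end Params

namespace Network

variable {Ω : Type*} {c : Params} {W : Network Ω}

/-- The network with the base stations placed at the points of a given configuration. It serves to
condition on the locations of the base stations. -/
def withBs (W : Network Ω) (x : ℕ → Plane) : Network Ω := { W with bs := fun n _ => x n }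

/-- `γ` times the interference of base station `n` at the user, relative to the power received
from the serving base station per unit of fading gain, if the base stations are at `x`. -/
def relInterferenceU (W : Network Ω) (c : Params) (γ : ℝ) (x : ℕ → Plane) (n : ℕ) (ω : Ω) : ℝ≥0∞ :=
  if n = nearest x then 0 else ENNReal.ofReal
    (γ * ‖x (nearest x)‖ ^ c.β * ‖x n‖ ^ (-c.β) * c.weight (W.state n ω) * W.gainU n ω)

lemma ofReal_mul_relInterferenceU (hc : c.InterferenceLimited) {γ : ℝ} (hγ : 0 ≤ γ)
    {x : ℕ → Plane} (hx : x (nearest x) ≠ 0) {n : ℕ} (hn : n ≠ nearest x) (ω : Ω) :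
    ENNReal.ofReal (c.θ * c.P * ‖x (nearest x)‖ ^ (-c.β)) * W.relInterferenceU c γ x n ω
      = ENNReal.ofReal γ * ENNReal.ofReal
        (c.θ * c.P * (c.weight (W.state n ω) * (‖x n‖ ^ (-c.β) * W.gainU n ω))) := by
  have := hc.θ_pos
  have := hc.P_pos
  have hcancel : ‖x (nearest x)‖ ^ (-c.β) * ‖x (nearest x)‖ ^ c.β = 1 := by
    rw [← Real.rpow_add (norm_pos_iff.2 hx), neg_add_cancel, Real.rpow_zero]
  rw [relInterferenceU, if_neg hn, ← ENNReal.ofReal_mul (by positivity), ← ENNReal.ofReal_mul hγ]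
  congr 1
  linear_combination
    c.θ * c.P * γ * ‖x n‖ ^ (-c.β) * c.weight (W.state n ω) * W.gainU n ω * hcancel

open Classical in
lemma interferenceU_withBs (x : ℕ → Plane) (s : BSState) (ω : Ω) :
    (W.withBs x).interferenceU c s ω = ∑' n, if n ≠ nearest x ∧ W.state n ω = s
      then ENNReal.ofReal (‖x n‖ ^ (-c.β) * W.gainU n ω) else 0 :=
  rfl

lemma ofReal_mul_tsum_relInterferenceU (hc : c.InterferenceLimited) {γ : ℝ} (hγ : 0 ≤ γ)
    {x : ℕ → Plane} (hx : x (nearest x) ≠ 0) (ω : Ω) :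
    ENNReal.ofReal (c.θ * c.P * ‖x (nearest x)‖ ^ (-c.β)) * ∑' n, W.relInterferenceU c γ x n ω
      = ENNReal.ofReal γ * (ENNReal.ofReal (c.θ * c.P) * (W.withBs x).interferenceU c .secure ω
        + ENNReal.ofReal c.P * (W.withBs x).interferenceU c .normalUncached ω) := by
  rw [interferenceU_withBs, interferenceU_withBs, ← ENNReal.tsum_mul_left, ← ENNReal.tsum_mul_left,
    ← ENNReal.tsum_mul_left, ← ENNReal.tsum_add, ← ENNReal.tsum_mul_left]
  classical
  refine tsum_congr fun n => ?_
  by_cases hn : n = nearest x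
  · simp [hn, relInterferenceU]
  · rw [ofReal_mul_relInterferenceU hc hγ hx hn, hc.ofReal_mul_weight]
    simp [hn]

lemma lt_sinrU_withBs_iff (hc : c.InterferenceLimited) {γ : ℝ} (hγ : 0 < γ) {x : ℕ → Plane}
    (hx : x (nearest x) ≠ 0) (ω : Ω) :
    ENNReal.ofReal γ < (W.withBs x).sinrU c ω ↔
      ∑' n, W.relInterferenceU c γ x n ω < ENNReal.ofReal (W.gainU (nearest x) ω) := by
  have hpower : 0 < c.θ * c.P * ‖x (nearest x)‖ ^ (-c.β) :=
    mul_pos (mul_pos hc.θ_pos hc.P_pos) (Real.rpow_pos_of_pos (norm_pos_iff.2 hx) _)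
  have hsignal : ENNReal.ofReal (c.θ * c.P
      * ‖(W.withBs x).bs ((W.withBs x).serving ω) ω‖ ^ (-c.β)
      * (W.withBs x).gainU ((W.withBs x).serving ω) ω)
      = ENNReal.ofReal (c.θ * c.P * ‖x (nearest x)‖ ^ (-c.β))
        * ENNReal.ofReal (W.gainU (nearest x) ω) := ENNReal.ofReal_mul hpower.le
  rw [sinrU, hc.σ2_eq_zero, ENNReal.ofReal_zero, add_zero, ENNReal.lt_div_iff_mul_lt
    (Or.inr ENNReal.ofReal_ne_top) (Or.inr (by simpa using hγ)),
    ← ofReal_mul_tsum_relInterferenceU hc hγ.le hx, hsignal,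
    ENNReal.mul_lt_mul_iff_right (by simpa using hpower) ENNReal.ofReal_ne_top]

lemma measurable_relInterferenceU {m : MeasurableSpace Ω} {n : ℕ} {x : ℕ → Plane}
    (h : n ≠ nearest x → Measurable (W.state n) ∧ Measurable (W.gainU n)) (γ : ℝ) :
    Measurable (W.relInterferenceU c γ x n) := by
  unfold relInterferenceU
  by_cases hn : n = nearest x
  · simp only [if_pos hn, measurable_const]
  · obtain ⟨hs, hg⟩ := h hn
    simp only [if_neg hn]
    exact (((Params.measurable_weight.comp hs).const_mul _).mul hg).ennreal_ofReal

lemma measurable_tsum_relInterferenceU {_ : MeasurableSpace Ω} {x : ℕ → Plane}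
    (h : ∀ n ≠ nearest x, Measurable (W.state n) ∧ Measurable (W.gainU n)) (γ : ℝ) :
    Measurable fun ω => ∑' n, W.relInterferenceU c γ x n ω :=
  .tsum fun n => measurable_relInterferenceU (h n) γ

variable [MeasurableSpace Ω] {μ : Measure Ω}

lemma IsModel.lintegral_comp_state (h : W.IsModel μ c) (n : ℕ) (g : BSState → ℝ≥0∞) :
    ∫⁻ ω, g (W.state n ω) ∂μ = g .secure * ENNReal.ofReal (c.stateProb .secure)
      + g .normalCached * ENNReal.ofReal (c.stateProb .normalCached)
      + g .normalUncached * ENNReal.ofReal (c.stateProb .normalUncached) := by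
  have hmeas (s) : MeasurableSet {ω | W.state n ω = s} :=
    h.state_measurable n (measurableSet_singleton s)
  have hsplit (ω) : g (W.state n ω)
      = {ω | W.state n ω = .secure}.indicator (fun _ => g .secure) ω
        + {ω | W.state n ω = .normalCached}.indicator (fun _ => g .normalCached) ω
        + {ω | W.state n ω = .normalUncached}.indicator (fun _ => g .normalUncached) ω := by
    cases hs : W.state n ω <;> simp [indicator, hs]
  rw [lintegral_congr hsplit, lintegral_add_right _ (measurable_const.indicator (hmeas _)),
    lintegral_add_right _ (measurable_const.indicator (hmeas _)),
    lintegral_indicator_const (hmeas _), lintegral_indicator_const (hmeas _),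
    lintegral_indicator_const (hmeas _), h.state_law, h.state_law, h.state_law]

variable [IsProbabilityMeasure μ]

lemma IsModel.lintegral_expNeg_weight_gainU (h : W.IsModel μ c) (hc : c.InterferenceLimited)
    {τ : ℝ} (hτ : 0 ≤ τ) (n : ℕ) :
    ∫⁻ ω, expNeg (ENNReal.ofReal (τ * c.weight (W.state n ω) * W.gainU n ω)) ∂μ
      = ENNReal.ofReal (c.laplaceU τ) := by
  have hp := hc.stateProb_nonneg
  have hτθ : 0 ≤ τ / c.θ := div_nonneg hτ hc.θ_pos.le
  have hind : IndepFun (W.state n) (W.gainU n) μ :=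
    h.indepFun_of_disjoint (S := {.state n}) (T := {.gainU n}) (by simp)
      (W.measurable_state_sigmaOn rfl) (W.measurable_gainU_sigmaOn rfl)
  calc ∫⁻ ω, expNeg (ENNReal.ofReal (τ * c.weight (W.state n ω) * W.gainU n ω)) ∂μ
      = ∫⁻ ω, ∫⁻ ω', expNeg (ENNReal.ofReal (τ * c.weight (W.state n ω) * W.gainU n ω')) ∂μ ∂μ :=
        lintegral_of_indepFun hind (h.state_measurable n) (h.gainU_law n).1
          (Φ := fun p => expNeg (ENNReal.ofReal (τ * c.weight p.1 * p.2))) (by fun_prop)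
    _ = ∫⁻ ω, ENNReal.ofReal (1 / (1 + τ * c.weight (W.state n ω))) ∂μ :=
        lintegral_congr fun ω => lintegral_expNeg_mul_of_map_eq (h.gainU_law n).1
          (h.gainU_law n).2 (mul_nonneg hτ (hc.weight_nonneg _))
    _ = ENNReal.ofReal (c.laplaceU τ) := by
        rw [h.lintegral_comp_state n fun s => ENNReal.ofReal (1 / (1 + τ * c.weight s))]
        simp only [Params.weight, mul_one, mul_zero, add_zero, div_one, ENNReal.ofReal_one, one_mul,
          mul_one_div]
        rw [Params.laplaceU, ENNReal.ofReal_add (add_nonneg (mul_nonneg (hp _) (by positivity))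
            (hp _)) (mul_nonneg (hp _) (by positivity)),
          ENNReal.ofReal_add (mul_nonneg (hp _) (by positivity)) (hp _),
          ENNReal.ofReal_mul (hp _), ENNReal.ofReal_mul (hp _), mul_comm,
          mul_comm (ENNReal.ofReal (1 / (1 + τ / c.θ)))]

lemma IsModel.measure_lt_sinrU_withBs (h : W.IsModel μ c) (hc : c.InterferenceLimited)
    {γ : ℝ} (hγ : 0 < γ) {x : ℕ → Plane} (hx : x (nearest x) ≠ 0) :
    μ {ω | ENNReal.ofReal γ < (W.withBs x).sinrU c ω}
      = expNeg (sumOthers (c.exponentU γ ‖x (nearest x)‖) x (nearest x)) := by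
  have hmeas (n) : Measurable (W.relInterferenceU c γ x n) :=
    measurable_relInterferenceU (fun _ => ⟨h.state_measurable n, (h.gainU_law n).1⟩) γ
  have hind : IndepFun (fun ω => ∑' n, W.relInterferenceU c γ x n ω) (W.gainU (nearest x)) μ := by
    refine h.indepFun_of_disjoint (S := {i | i ≠ .gainU (nearest x)})
      (T := {.gainU (nearest x)}) (by simp)
      (measurable_tsum_relInterferenceU (fun n hn => ?_) γ) (W.measurable_gainU_sigmaOn rfl)
    exact ⟨W.measurable_state_sigmaOn (by simp), W.measurable_gainU_sigmaOn (by simpa using hn)⟩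
  have hiind : iIndepFun (W.relInterferenceU c γ x) μ := by
    refine h.iIndepFun_of_disjoint (S := fun n => {.state n, .gainU n}) (fun i j hij => ?_)
      fun n => measurable_relInterferenceU (fun _ => ⟨W.measurable_state_sigmaOn (by simp),
        W.measurable_gainU_sigmaOn (by simp)⟩) γ
    simp [hij.symm]
  simp only [lt_sinrU_withBs_iff hc hγ hx]
  rw [measure_lt_ofReal_of_indepFun (.tsum hmeas) (h.gainU_law _).1 (h.gainU_law _).2 hind,
    lintegral_expNeg_tsum_of_iIndepFun hmeas hiind, sumOthers]
  congr 1
  refine tsum_congr fun n => ?_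
  by_cases hn : n = nearest x
  · simp [relInterferenceU, hn]
  · simp only [relInterferenceU, if_neg hn, Params.exponentU]
    rw [h.lintegral_expNeg_weight_gainU hc (by positivity) n]

end Network

/-! ### The eavesdroppers -/

section

open Classical in
lemma expNeg_tsum_ite_top (p : ℕ → Prop) :
    expNeg (∑' n, if p n then 0 else ∞) = if ∀ n, p n then 1 else 0 := by
  by_cases h : ∀ n, p n
  · simp [h]
  · obtain ⟨n, hn⟩ := not_forall.1 h
    have htop : ∑' n, (if p n then 0 else ∞ : ℝ≥0∞) = ∞ :=
      ENNReal.tsum_eq_top_of_eq_top ⟨n, if_neg hn⟩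
    rw [htop, expNeg_top, if_neg h]

lemma lintegral_exp_neg_mul_dist_sq {κ : ℝ} (hκ : 0 < κ) (y : Plane) :
    ∫⁻ e, ENNReal.ofReal (Real.exp (-κ * dist e y ^ 2)) = ENNReal.ofReal (Real.pi / κ) := by
  simp_rw [dist_eq_norm]
  rw [lintegral_sub_right_eq_self (fun x : Plane => ENNReal.ofReal (Real.exp (-κ * ‖x‖ ^ 2))) y,
    lintegral_exp_neg_mul_normSq hκ]

variable {Ω : Type*} [MeasurableSpace Ω] {μ : Measure Ω} [IsProbabilityMeasure μ]

lemma measure_forall_mem_of_iIndepFun {E : ℕ → Type*} [∀ n, MeasurableSpace (E n)]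
    {f : ∀ n, Ω → E n} (hf : ∀ n, Measurable (f n)) (hind : iIndepFun f μ) {B : ∀ n, Set (E n)}
    (hB : ∀ n, MeasurableSet (B n)) :
    μ {ω | ∀ n, f n ω ∈ B n} = expNeg (∑' n, negLog (μ {ω | f n ω ∈ B n})) := by
  classical
  let g (n) (x : E n) : ℝ≥0∞ := if x ∈ B n then 0 else ∞
  have hg (n) : Measurable (g n) := .ite (hB n) measurable_const measurable_const
  have hone (n) (ω) : expNeg (g n (f n ω)) = {ω | f n ω ∈ B n}.indicator 1 ω := by
    by_cases h : f n ω ∈ B n <;> simp [g, h]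
  have hall (ω) : expNeg (∑' n, g n (f n ω)) = {ω | ∀ n, f n ω ∈ B n}.indicator 1 ω :=
    expNeg_tsum_ite_top _
  have hmeas : MeasurableSet {ω | ∀ n, f n ω ∈ B n} := by
    rw [ofPred_forall]
    exact .iInter fun n => hf n (hB n)
  calc μ {ω | ∀ n, f n ω ∈ B n} = ∫⁻ ω, expNeg (∑' n, g n (f n ω)) ∂μ := by
        rw [lintegral_congr hall, lintegral_indicator_one hmeas]
    _ = expNeg (∑' n, negLog (∫⁻ ω, expNeg (g n (f n ω)) ∂μ)) :=
        lintegral_expNeg_tsum_of_iIndepFun (fun n => (hg n).comp (hf n)) (hind.comp g hg)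
    _ = expNeg (∑' n, negLog (μ {ω | f n ω ∈ B n})) := by
        refine congrArg expNeg (tsum_congr fun n => congrArg negLog ?_)
        exact (lintegral_congr (hone n)).trans (lintegral_indicator_one (hf n (hB n)))

lemma lintegral_expNeg_tsum_mul_of_iIndepFun {g : ℕ → Ω → ℝ} (hg : ∀ n, Measurable (g n))
    (hlaw : ∀ n, μ.map (g n) = expMeasure 1) (hind : iIndepFun g μ) {a : ℕ → ℝ}
    (ha : ∀ n, 0 ≤ a n) :
    ∫⁻ ω, expNeg (∑' n, ENNReal.ofReal (a n * g n ω)) ∂μ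
      = expNeg (∑' n, negLog (ENNReal.ofReal (1 / (1 + a n)))) := by
  have hY (n) : Measurable fun t : ℝ => ENNReal.ofReal (a n * t) := by fun_prop
  rw [lintegral_expNeg_tsum_of_iIndepFun (Y := fun n ω => ENNReal.ofReal (a n * g n ω))
    (fun n => (hY n).comp (hg n)) (hind.comp (fun n t => ENNReal.ofReal (a n * t)) hY)]
  refine congrArg expNeg (tsum_congr fun n => ?_)
  rw [lintegral_expNeg_mul_of_map_eq (hg n) (hlaw n) (ha n)]

namespace IsPoissonProcess

variable {X : ℕ → Ω → Plane} {lam : ℝ} {g : ℕ → Ω → ℝ}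

lemma lintegral_expNeg_tsum_mul (h : IsPoissonProcess μ X lam) (hlam : 0 ≤ lam)
    (hg : ∀ n, Measurable (g n)) (hlaw : ∀ n, μ.map (g n) = expMeasure 1) (hgind : iIndepFun g μ)
    (hind : IndepFun (fun ω n => X n ω) (fun ω n => g n ω) μ) {f : Plane → ℝ}
    (hf : Measurable f) (hf0 : ∀ x, 0 ≤ f x) :
    ∫⁻ ω, expNeg (∑' n, ENNReal.ofReal (f (X n ω) * g n ω)) ∂μ
      = expNeg (ENNReal.ofReal lam * ∫⁻ x, (1 - ENNReal.ofReal (1 / (1 + f x)))) := by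
  have hle (x) : ENNReal.ofReal (1 / (1 + f x)) ≤ 1 :=
    ENNReal.ofReal_le_one.2 (one_div_one_add_le_one (hf0 x))
  calc ∫⁻ ω, expNeg (∑' n, ENNReal.ofReal (f (X n ω) * g n ω)) ∂μ
      = ∫⁻ ω, ∫⁻ ω', expNeg (∑' n, ENNReal.ofReal (f (X n ω) * g n ω')) ∂μ ∂μ :=
        lintegral_of_indepFun hind (measurable_pi_lambda _ h.measurable)
          (measurable_pi_lambda _ hg)
          (Φ := fun p => expNeg (∑' n, ENNReal.ofReal (f (p.1 n) * p.2 n))) (by fun_prop)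
    _ = ∫⁻ ω, expNeg (∑' n, negLog (ENNReal.ofReal (1 / (1 + f (X n ω))))) ∂μ :=
        lintegral_congr fun ω =>
          lintegral_expNeg_tsum_mul_of_iIndepFun hg hlaw hgind fun n => hf0 _
    _ = expNeg (ENNReal.ofReal lam * ∫⁻ x, (1 - ENNReal.ofReal (1 / (1 + f x)))) := by
        rw [h.lintegral_expNeg_tsum hlam (f := fun x => negLog (ENNReal.ofReal (1 / (1 + f x))))
          (measurable_negLog.comp (by fun_prop))]
        refine congrArg (fun t => expNeg (ENNReal.ofReal lam * t)) (lintegral_congr fun x => ?_)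
        rw [expNeg_negLog (hle x)]

lemma lintegral_expNeg_tsum_dist_rpow (h : IsPoissonProcess μ X lam) (hlam : 0 ≤ lam)
    (hg : ∀ n, Measurable (g n)) (hlaw : ∀ n, μ.map (g n) = expMeasure 1) (hgind : iIndepFun g μ)
    (hind : IndepFun (fun ω n => X n ω) (fun ω n => g n ω) μ) {β s : ℝ} (hβ : 2 < β) (hs : 0 < s)
    (e : Plane) :
    ∫⁻ ω, expNeg (ENNReal.ofReal s
        * ∑' n, ENNReal.ofReal (dist e (X n ω) ^ (-β) * g n ω)) ∂μ
      = expNeg (ENNReal.ofReal lam * ENNReal.ofReal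
          (Real.pi * s ^ (2 / β) * (Real.Gamma (1 + 2 / β) * Real.Gamma (1 - 2 / β)))) := by
  simp_rw [← ENNReal.tsum_mul_left, ← ENNReal.ofReal_mul hs.le, ← mul_assoc, dist_comm e,
    dist_eq_norm]
  rw [h.lintegral_expNeg_tsum_mul hlam hg hlaw hgind hind (f := fun x => s * ‖x - e‖ ^ (-β))
    (by fun_prop) (fun x => by positivity), lintegral_sub_right_eq_self
    (fun x : Plane => 1 - ENNReal.ofReal (1 / (1 + s * ‖x‖ ^ (-β)))) e,
    lintegral_one_sub_inv_one_add hβ hs]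
  simp only [mul_assoc]

end IsPoissonProcess

end

namespace Params

variable {c : Params}

/-- SINR of an eavesdropper at distance `d` from the serving base station, with power gain `h`
and interference `I`. -/
def sinrAt (c : Params) (h d : ℝ) (I : ℝ≥0∞) : ℝ≥0∞ :=
  ENNReal.ofReal (c.θ * c.P * (h * d ^ (-c.β))) /
    (ENNReal.ofReal c.P * I + ENNReal.ofReal ((1 - c.θ) * c.P * (h * d ^ (-c.β)))
      + ENNReal.ofReal c.σ2)

/-- Interference at the point `e` of the base stations `x` with power gains `g`. -/
def interferenceAt (c : Params) (e : Plane) (x : ℕ → Plane) (g : ℕ → ℝ) : ℝ≥0∞ :=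
  ∑' k, ENNReal.ofReal (dist e (x k) ^ (-c.β) * g k)

/-- The signal-to-interference ratio at which the SINR of an eavesdropper is `γ`; the SINR cannot
exceed `γ` if the denominator is not positive. -/
def sirThreshold (c : Params) (γ : ℝ) : ℝ := γ / (c.θ - (1 - c.θ) * γ)

/-- The constant `Γ(1 + 2/β) Γ(1 - 2/β)` of the Laplace transform of the interference. -/
def gammaFactor (c : Params) : ℝ := Real.Gamma (1 + 2 / c.β) * Real.Gamma (1 - 2 / c.β)

/-- An eavesdropper at distance `d` has SINR above `γ` with probability
`exp (-exceedRate γ * d ^ 2)`. -/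
def exceedRate (c : Params) (γ : ℝ) : ℝ :=
  c.lamB * Real.pi * c.sirThreshold γ ^ (2 / c.β) * c.gammaFactor

/-- The probability that all eavesdroppers have SINR at most `γ`, for `γ < γ_th0`. -/
def probE (c : Params) (γ : ℝ) : ℝ :=
  Real.exp (-((c.lamE / c.lamB) / (c.gammaFactor * c.sirThreshold γ ^ (2 / c.β))))

/-- The probability that an eavesdropper at `e` has SINR above `γ`, if the serving base station
is at `y`. -/
def exceedProb (c : Params) (γ : ℝ) (y e : Plane) : ℝ≥0∞ :=
  -- `0 ^ (-β) = 0`, so an eavesdropper at the serving base station receives nothing.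
  if e = y then 0 else ENNReal.ofReal (Real.exp (-(c.exceedRate γ) * dist e y ^ 2))

lemma measurable_interferenceAt {Ω : Type*} {_ : MeasurableSpace Ω} {e : Ω → Plane}
    {x : ℕ → Ω → Plane} {g : ℕ → Ω → ℝ} (he : Measurable e) (hx : ∀ k, Measurable (x k))
    (hg : ∀ k, Measurable (g k)) :
    Measurable fun ω => c.interferenceAt (e ω) (fun k => x k ω) (fun k => g k ω) := by
  unfold interferenceAt
  fun_prop

lemma measurable_sinrAt {Ω : Type*} {_ : MeasurableSpace Ω} {h d : Ω → ℝ} {I : Ω → ℝ≥0∞}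
    (hh : Measurable h) (hd : Measurable d) (hI : Measurable I) :
    Measurable fun ω => c.sinrAt (h ω) (d ω) (I ω) := by
  unfold sinrAt
  fun_prop

lemma measurable_exceedProb (γ : ℝ) (y : Plane) : Measurable (c.exceedProb γ y) :=
  Measurable.ite (measurableSet_singleton y) measurable_const (by fun_prop)

namespace InterferenceLimited

lemma lt_sinrAt_iff (hc : c.InterferenceLimited) {γ : ℝ} (hγ : 0 < γ)
    (hγθ : 0 < c.θ - (1 - c.θ) * γ) {d : ℝ} (hd : 0 < d) (h : ℝ) (I : ℝ≥0∞) :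
    ENNReal.ofReal γ < c.sinrAt h d I ↔
      ENNReal.ofReal (c.sirThreshold γ * d ^ c.β) * I < ENNReal.ofReal h := by
  have := hc.θ_pos
  have := hc.P_pos
  have := sub_nonneg.2 hc.θ_le_one
  set η := (c.θ - (1 - c.θ) * γ) * c.P * d ^ (-c.β) with hη
  have hηpos : 0 < η := by positivity
  have hsignal : ENNReal.ofReal (c.θ * c.P * (h * d ^ (-c.β))) = ENNReal.ofReal η * ENNReal.ofReal h
      + ENNReal.ofReal γ * ENNReal.ofReal ((1 - c.θ) * c.P * (h * d ^ (-c.β))) := by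
    rw [mul_comm h, ← mul_assoc, ← mul_assoc,
      ENNReal.ofReal_mul (p := c.θ * c.P * d ^ (-c.β)) (by positivity),
      ENNReal.ofReal_mul (p := (1 - c.θ) * c.P * d ^ (-c.β)) (by positivity), ← mul_assoc,
      ← ENNReal.ofReal_mul hγ.le, ← add_mul, ← ENNReal.ofReal_add hηpos.le (by positivity), hη]
    ring_nf
  have hinterference : ENNReal.ofReal γ * (ENNReal.ofReal c.P * I)
      = ENNReal.ofReal η * (ENNReal.ofReal (c.sirThreshold γ * d ^ c.β) * I) := by
    rw [← mul_assoc, ← mul_assoc, ← ENNReal.ofReal_mul hγ.le, ← ENNReal.ofReal_mul hηpos.le, hη,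
      sirThreshold, Real.rpow_neg hd.le]
    congr 2
    have : c.θ - γ * (1 - c.θ) ≠ 0 := by linarith
    field_simp
  rw [sinrAt, hc.σ2_eq_zero, ENNReal.ofReal_zero, add_zero, ENNReal.lt_div_iff_mul_lt
    (Or.inr ENNReal.ofReal_ne_top) (Or.inr (by simpa using hγ)), mul_add, hsignal, hinterference,
    ENNReal.add_lt_add_iff_right (ENNReal.mul_ne_top ENNReal.ofReal_ne_top ENNReal.ofReal_ne_top),
    ENNReal.mul_lt_mul_iff_right (by simpa using hηpos) ENNReal.ofReal_ne_top]

lemma sinrAt_zero (hc : c.InterferenceLimited) (h : ℝ) (I : ℝ≥0∞) : c.sinrAt h 0 I = 0 := by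
  have : -c.β ≠ 0 := by linarith [hc.two_lt_β]
  simp [sinrAt, Real.zero_rpow this]

lemma sinrAt_le (hc : c.InterferenceLimited) {γ : ℝ} (hγ : 0 ≤ γ)
    (hγθ : c.θ - (1 - c.θ) * γ ≤ 0) (h d : ℝ) (I : ℝ≥0∞) :
    c.sinrAt h d I ≤ ENNReal.ofReal γ := by
  have := hc.θ_pos
  have := hc.P_pos
  have := sub_nonneg.2 hc.θ_le_one
  refine ENNReal.div_le_of_le_mul ?_
  calc ENNReal.ofReal (c.θ * c.P * (h * d ^ (-c.β)))
      = ENNReal.ofReal (c.θ * c.P) * ENNReal.ofReal (h * d ^ (-c.β)) :=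
        ENNReal.ofReal_mul (by positivity)
    _ ≤ ENNReal.ofReal (γ * ((1 - c.θ) * c.P)) * ENNReal.ofReal (h * d ^ (-c.β)) := by
        gcongr ENNReal.ofReal ?_ * _
        nlinarith
    _ = ENNReal.ofReal γ * ENNReal.ofReal ((1 - c.θ) * c.P * (h * d ^ (-c.β))) := by
        rw [ENNReal.ofReal_mul hγ, mul_assoc, ← ENNReal.ofReal_mul (by positivity)]
    _ ≤ _ := by
        gcongr
        exact le_add_right le_add_self

lemma two_div_β_mem_Ioo (hc : c.InterferenceLimited) : 2 / c.β ∈ Ioo 0 1 := by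
  have := hc.two_lt_β
  exact ⟨by positivity, (div_lt_one (by positivity)).2 this⟩

lemma gammaFactor_pos (hc : c.InterferenceLimited) : 0 < c.gammaFactor := by
  have ⟨hpos, hlt⟩ := hc.two_div_β_mem_Ioo
  exact mul_pos (Real.Gamma_pos_of_pos (by linarith)) (Real.Gamma_pos_of_pos (by linarith))

lemma exceedRate_pos (hc : c.InterferenceLimited) {γ : ℝ} (hγ : 0 < γ)
    (hγθ : 0 < c.θ - (1 - c.θ) * γ) : 0 < c.exceedRate γ := by
  have := hc.lamB_pos
  have := hc.gammaFactor_pos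
  unfold exceedRate sirThreshold
  positivity

lemma lintegral_exceedProb (hc : c.InterferenceLimited) {γ : ℝ} (hγ : 0 < γ)
    (hγθ : 0 < c.θ - (1 - c.θ) * γ) (y : Plane) :
    ∫⁻ e, c.exceedProb γ y e = ENNReal.ofReal (Real.pi / c.exceedRate γ) := by
  rw [← lintegral_exp_neg_mul_dist_sq (hc.exceedRate_pos hγ hγθ) y]
  refine lintegral_congr_ae ?_
  filter_upwards [measure_eq_zero_iff_ae_notMem.1 (measure_singleton (μ := volume) y)] with e he
  exact if_neg he

lemma expNeg_lamE_mul_pi_div_exceedRate (hc : c.InterferenceLimited) {γ : ℝ} (hγ : 0 < γ)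
    (hγθ : 0 < c.θ - (1 - c.θ) * γ) :
    expNeg (ENNReal.ofReal c.lamE * ENNReal.ofReal (Real.pi / c.exceedRate γ))
      = ENNReal.ofReal (c.probE γ) := by
  have := hc.lamB_pos
  have hlamE := hc.lamE_pos
  have := hc.gammaFactor_pos
  have := hc.exceedRate_pos hγ hγθ
  have hsir : 0 < c.sirThreshold γ := div_pos hγ hγθ
  have : 0 < c.sirThreshold γ ^ (2 / c.β) := by positivity
  rw [← ENNReal.ofReal_mul hlamE.le, expNeg_ofReal (by positivity), probE, exceedRate]
  congr 3
  field_simp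

end InterferenceLimited

end Params

namespace Network

variable {Ω : Type*} {c : Params} {W : Network Ω}

/-- SINR of eavesdropper `j`, if it is at `e` and the serving base station is at `y`. -/
def sinrEFrom (W : Network Ω) (c : Params) (y e : Plane) (j : ℕ) (ω : Ω) : ℝ≥0∞ :=
  c.sinrAt (W.gainE j ω) (dist e y)
    (c.interferenceAt e (fun k => W.field j k ω) fun k => W.gainI j k ω)

/-- The fading gains and interference fields seen by the eavesdroppers. -/
def eveMarks (W : Network Ω) (ω : Ω) : (ℕ → ℝ) × (ℕ → ℕ → Plane) × (ℕ → ℕ → ℝ) :=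
  (fun j => W.gainE j ω, fun j k => W.field j k ω, fun j k => W.gainI j k ω)

lemma sinrE_withBs (x : ℕ → Plane) (j : ℕ) (ω : Ω) :
    (W.withBs x).sinrE c j ω = W.sinrEFrom c (x (nearest x)) (W.er j ω) j ω := rfl

section

variable {mΩ : MeasurableSpace Ω}

lemma measurable_sinrEFrom {j : ℕ} (hg : Measurable (W.gainE j))
    (hf : ∀ k, Measurable (W.field j k)) (hI : ∀ k, Measurable (W.gainI j k)) (y e : Plane) :
    Measurable (W.sinrEFrom c y e j) :=
  Params.measurable_sinrAt hg measurable_const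
    (Params.measurable_interferenceAt measurable_const hf hI)

lemma measurable_eveMarks (hg : ∀ j, Measurable (W.gainE j))
    (hf : ∀ j k, Measurable (W.field j k)) (hI : ∀ j k, Measurable (W.gainI j k)) :
    Measurable W.eveMarks := by
  unfold eveMarks
  fun_prop

end

variable [MeasurableSpace Ω] {μ : Measure Ω}

namespace IsModel

lemma measurable_sinrEFrom (h : W.IsModel μ c) (y e : Plane) (j : ℕ) :
    Measurable (W.sinrEFrom c y e j) :=
  Network.measurable_sinrEFrom (h.gainE_law j).1 (h.field_poisson j).measurable
    (fun k => (h.gainI_law j k).1) y e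

lemma measurable_eveMarks (h : W.IsModel μ c) : Measurable W.eveMarks :=
  Network.measurable_eveMarks (fun j => (h.gainE_law j).1)
    (fun j => (h.field_poisson j).measurable) fun j k => (h.gainI_law j k).1

lemma indepFun_field_gainI (h : W.IsModel μ c) (j : ℕ) :
    IndepFun (fun ω k => W.field j k ω) (fun ω k => W.gainI j k ω) μ :=
  h.indepFun_of_disjoint (S := {.field j}) (T := range (Source.gainI j)) (by simp)
    (@measurable_pi_lambda _ _ _ (W.sigmaOn _) _ _ (W.measurable_field_sigmaOn rfl))
    (@measurable_pi_lambda _ _ _ (W.sigmaOn _) _ _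
      fun k => W.measurable_gainI_sigmaOn (mem_range_self k))

lemma iIndepFun_gainI (h : W.IsModel μ c) (j : ℕ) : iIndepFun (W.gainI j) μ :=
  h.iIndepFun_of_disjoint (S := fun k => {.gainI j k}) (fun i k hik => by simpa using hik)
    fun k => W.measurable_gainI_sigmaOn rfl

lemma indepFun_interferenceAt_gainE (h : W.IsModel μ c) (e : Plane) (j : ℕ) :
    IndepFun (fun ω => c.interferenceAt e (fun k => W.field j k ω) fun k => W.gainI j k ω)
      (W.gainE j) μ :=
  h.indepFun_of_disjoint (S := {i | i ≠ .gainE j}) (T := {.gainE j}) (by simp)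
    (Params.measurable_interferenceAt measurable_const (W.measurable_field_sigmaOn (by simp))
      fun k => W.measurable_gainI_sigmaOn (by simp)) (W.measurable_gainE_sigmaOn rfl)

lemma iIndepFun_sinrEFrom (h : W.IsModel μ c) (y : Plane) (e : ℕ → Plane) :
    iIndepFun (fun j => W.sinrEFrom c y (e j) j) μ := by
  refine h.iIndepFun_of_disjoint (S := fun j => {.gainE j, .field j} ∪ range (Source.gainI j))
    (fun i j hij => ?_) fun j => Network.measurable_sinrEFrom
      (W.measurable_gainE_sigmaOn (by simp)) (W.measurable_field_sigmaOn (by simp))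
      (fun k => W.measurable_gainI_sigmaOn (by simp)) y (e j)
  refine disjoint_left.2 ?_
  rintro a ((rfl | rfl) | ⟨k, rfl⟩) <;> simp [hij, hij.symm]

lemma indepFun_er_eveMarks (h : W.IsModel μ c) :
    IndepFun (fun ω j => W.er j ω) W.eveMarks μ :=
  h.indepFun_of_disjoint (S := {.er}) (T := {i | i ≠ .er}) (by simp)
    (@measurable_pi_lambda _ _ _ (W.sigmaOn _) _ _ (W.measurable_er_sigmaOn rfl))
    (Network.measurable_eveMarks (fun j => W.measurable_gainE_sigmaOn (by simp))
      (fun j => W.measurable_field_sigmaOn (by simp))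
      fun j k => W.measurable_gainI_sigmaOn (by simp))

variable [IsProbabilityMeasure μ]

lemma lintegral_expNeg_interferenceAt (h : W.IsModel μ c) (hc : c.InterferenceLimited) {s : ℝ}
    (hs : 0 < s) (e : Plane) (j : ℕ) :
    ∫⁻ ω, expNeg (ENNReal.ofReal s
        * c.interferenceAt e (fun k => W.field j k ω) (fun k => W.gainI j k ω)) ∂μ
      = ENNReal.ofReal (Real.exp (-(c.lamB * (Real.pi * s ^ (2 / c.β) * c.gammaFactor)))) := by
  have := hc.gammaFactor_pos
  have hlam := hc.lamB_pos
  refine ((h.field_poisson j).lintegral_expNeg_tsum_dist_rpow hlam.le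
    (fun k => (h.gainI_law j k).1) (fun k => (h.gainI_law j k).2) (h.iIndepFun_gainI j)
    (h.indepFun_field_gainI j) hc.two_lt_β hs e).trans ?_
  rw [← Params.gammaFactor, ← ENNReal.ofReal_mul hlam.le, expNeg_ofReal (by positivity)]

lemma measure_lt_sinrAt (h : W.IsModel μ c) (hc : c.InterferenceLimited) {γ : ℝ} (hγ : 0 < γ)
    (hγθ : 0 < c.θ - (1 - c.θ) * γ) {d : ℝ} (hd : 0 < d) (e : Plane) (j : ℕ) :
    μ {ω | ENNReal.ofReal γ < c.sinrAt (W.gainE j ω) d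
        (c.interferenceAt e (fun k => W.field j k ω) (fun k => W.gainI j k ω))}
      = ENNReal.ofReal (Real.exp (-(c.exceedRate γ) * d ^ 2)) := by
  have hsir : 0 < c.sirThreshold γ := div_pos hγ hγθ
  have hpow : (d ^ c.β) ^ (2 / c.β) = d ^ 2 := by
    rw [← Real.rpow_mul hd.le, mul_div_cancel₀ 2 (by linarith [hc.two_lt_β]), Real.rpow_two]
  have hmeas : Measurable fun ω =>
      c.interferenceAt e (fun k => W.field j k ω) (fun k => W.gainI j k ω) :=
    Params.measurable_interferenceAt measurable_const (h.field_poisson j).measurable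
      fun k => (h.gainI_law j k).1
  simp only [hc.lt_sinrAt_iff hγ hγθ hd]
  rw [measure_lt_ofReal_of_indepFun (hmeas.const_mul _) (h.gainE_law j).1 (h.gainE_law j).2
      ((h.indepFun_interferenceAt_gainE e j).comp (measurable_const_mul _) measurable_id),
    h.lintegral_expNeg_interferenceAt hc (by positivity) e j, Params.exceedRate,
    Real.mul_rpow hsir.le (by positivity), hpow]
  ring_nf

lemma measure_lt_sinrEFrom (h : W.IsModel μ c) (hc : c.InterferenceLimited) {γ : ℝ} (hγ : 0 < γ)
    (hγθ : 0 < c.θ - (1 - c.θ) * γ) (y e : Plane) (j : ℕ) :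
    μ {ω | ENNReal.ofReal γ < W.sinrEFrom c y e j ω} = c.exceedProb γ y e := by
  rcases eq_or_ne e y with rfl | he
  · simp [sinrEFrom, hc.sinrAt_zero, Params.exceedProb]
  · rw [Params.exceedProb, if_neg he]
    exact h.measure_lt_sinrAt hc hγ hγθ (dist_pos.2 he) e j

lemma exceedProb_le_one (h : W.IsModel μ c) (hc : c.InterferenceLimited) {γ : ℝ} (hγ : 0 < γ)
    (hγθ : 0 < c.θ - (1 - c.θ) * γ) (y e : Plane) : c.exceedProb γ y e ≤ 1 :=
  h.measure_lt_sinrEFrom hc hγ hγθ y e 0 ▸ prob_le_one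

lemma measure_sinrEFrom_le (h : W.IsModel μ c) (hc : c.InterferenceLimited) {γ : ℝ} (hγ : 0 < γ)
    (hγθ : 0 < c.θ - (1 - c.θ) * γ) (y e : Plane) (j : ℕ) :
    μ {ω | W.sinrEFrom c y e j ω ≤ ENNReal.ofReal γ} = 1 - c.exceedProb γ y e := by
  rw [← h.measure_lt_sinrEFrom hc hγ hγθ y e j,
    ← prob_compl_eq_one_sub (measurableSet_lt measurable_const (h.measurable_sinrEFrom y e j))]
  exact congrArg μ (ext fun ω => by simp)

lemma measure_forall_sinrEFrom_apply_le (h : W.IsModel μ c) (hc : c.InterferenceLimited) {γ : ℝ}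
    (hγ : 0 < γ) (hγθ : 0 < c.θ - (1 - c.θ) * γ) (y : Plane) (e : ℕ → Plane) :
    μ {ω | ∀ j, W.sinrEFrom c y (e j) j ω ≤ ENNReal.ofReal γ}
      = expNeg (∑' j, negLog (1 - c.exceedProb γ y (e j))) := by
  refine (measure_forall_mem_of_iIndepFun (fun j => h.measurable_sinrEFrom y (e j) j)
    (h.iIndepFun_sinrEFrom y e) fun _ => measurableSet_Iic).trans ?_
  exact congrArg expNeg (tsum_congr fun j =>
    congrArg negLog (h.measure_sinrEFrom_le hc hγ hγθ y (e j) j))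

lemma measure_forall_sinrEFrom_le (h : W.IsModel μ c) (hc : c.InterferenceLimited) {γ : ℝ}
    (hγ : 0 < γ) (hγθ : 0 < c.θ - (1 - c.θ) * γ) (y : Plane) :
    μ {ω | ∀ j, W.sinrEFrom c y (W.er j ω) j ω ≤ ENNReal.ofReal γ}
      = ENNReal.ofReal (c.probE γ) := by
  let D : Set ((ℕ → Plane) × (ℕ → ℝ) × (ℕ → ℕ → Plane) × (ℕ → ℕ → ℝ)) :=
    {p | ∀ j, c.sinrAt (p.2.1 j) (dist (p.1 j) y)
      (c.interferenceAt (p.1 j) (fun k => p.2.2.1 j k) (fun k => p.2.2.2 j k)) ≤ ENNReal.ofReal γ}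
  have hD : MeasurableSet D := by
    simp only [D, ofPred_forall]
    exact .iInter fun j => measurableSet_le (Params.measurable_sinrAt (by fun_prop) (by fun_prop)
      (Params.measurable_interferenceAt (by fun_prop) (by fun_prop) (by fun_prop)))
      measurable_const
  calc μ {ω | ∀ j, W.sinrEFrom c y (W.er j ω) j ω ≤ ENNReal.ofReal γ}
      = ∫⁻ ω, μ {ω' | ∀ j, W.sinrEFrom c y (W.er j ω) j ω' ≤ ENNReal.ofReal γ} ∂μ :=
        measure_of_indepFun h.indepFun_er_eveMarks
          (measurable_pi_lambda _ h.er_poisson.measurable) h.measurable_eveMarks hD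
    _ = ∫⁻ ω, expNeg (∑' j, negLog (1 - c.exceedProb γ y (W.er j ω))) ∂μ :=
        lintegral_congr fun ω => h.measure_forall_sinrEFrom_apply_le hc hγ hγθ y fun j => W.er j ω
    _ = expNeg (ENNReal.ofReal c.lamE
          * ∫⁻ e, (1 - expNeg (negLog (1 - c.exceedProb γ y e)))) :=
        h.er_poisson.lintegral_expNeg_tsum hc.lamE_pos.le
          (measurable_negLog.comp ((Params.measurable_exceedProb γ y).const_sub 1))
    _ = ENNReal.ofReal (c.probE γ) := by
        simp_rw [expNeg_negLog tsub_le_self, ENNReal.sub_sub_cancel ENNReal.one_ne_top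
          (h.exceedProb_le_one hc hγ hγθ y _)]
        rw [hc.lintegral_exceedProb hγ hγθ, hc.expNeg_lamE_mul_pi_div_exceedRate hγ hγθ]

end IsModel

end Network

/-! ### Joint law of the two SINRs -/

/-- The distribution function at `γ > 0` of the largest SINR of the eavesdroppers. -/
def Params.cdfE (c : Params) (γ : ℝ) : ℝ := if 0 < c.θ - (1 - c.θ) * γ then c.probE γ else 1

namespace Network

variable {Ω : Type*} {c : Params} {W : Network Ω}

/-- All sources of randomness except for the locations of the base stations. -/
def marks (W : Network Ω) (ω : Ω) :
    (ℕ → BSState) × (ℕ → ℝ) × (ℕ → Plane) × (ℕ → ℝ) × (ℕ → ℕ → Plane) × (ℕ → ℕ → ℝ) :=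
  (fun n => W.state n ω, fun n => W.gainU n ω, fun j => W.er j ω, W.eveMarks ω)

/-- The network on the space of all possible values of the sources of randomness. Every network
factors through it, via the locations of the base stations and the `marks`. -/
def canonical : Network ((ℕ → Plane) × (ℕ → BSState) × (ℕ → ℝ) × (ℕ → Plane) ×
    (ℕ → ℝ) × (ℕ → ℕ → Plane) × (ℕ → ℕ → ℝ)) where
  bs n p := p.1 n
  state n p := p.2.1 n
  gainU n p := p.2.2.1 n
  er j p := p.2.2.2.1 j
  gainE j p := p.2.2.2.2.1 j
  field j k p := p.2.2.2.2.2.1 j k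
  gainI j k p := p.2.2.2.2.2.2 j k

lemma measurable_canonical_sinrU : Measurable (canonical.sinrU c) := by
  refine measurable_sinrU (fun n => ?_) (fun n => ?_) (fun n => ?_) <;>
    simp only [canonical] <;> fun_prop

lemma measurable_canonical_sinrMaxE : Measurable (canonical.sinrMaxE c) := by
  refine measurable_sinrMaxE (fun n => ?_) (fun n => ?_) (fun n => ?_) (fun j k => ?_)
    (fun j k => ?_) <;> simp only [canonical] <;> fun_prop

lemma measurable_marks {mΩ : MeasurableSpace Ω} (hs : ∀ n, Measurable (W.state n))
    (hu : ∀ n, Measurable (W.gainU n)) (he : ∀ j, Measurable (W.er j))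
    (hM : Measurable W.eveMarks) : Measurable W.marks := by
  unfold marks
  fun_prop

variable [MeasurableSpace Ω] {μ : Measure Ω}

namespace IsModel

lemma measurable_sinrU (h : W.IsModel μ c) : Measurable (W.sinrU c) :=
  Network.measurable_sinrU h.bs_poisson.measurable h.state_measurable fun n => (h.gainU_law n).1

lemma measurable_sinrMaxE (h : W.IsModel μ c) : Measurable (W.sinrMaxE c) :=
  Network.measurable_sinrMaxE h.bs_poisson.measurable h.er_poisson.measurable
    (fun j => (h.gainE_law j).1) (fun j => (h.field_poisson j).measurable)
    fun j k => (h.gainI_law j k).1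

lemma measurable_marks (h : W.IsModel μ c) : Measurable W.marks :=
  Network.measurable_marks h.state_measurable (fun n => (h.gainU_law n).1)
    h.er_poisson.measurable h.measurable_eveMarks

lemma indepFun_bs_marks (h : W.IsModel μ c) : IndepFun (fun ω n => W.bs n ω) W.marks μ :=
  h.indepFun_of_disjoint (S := {.bs}) (T := {i | i ≠ .bs}) (by simp)
    (@measurable_pi_lambda _ _ _ (W.sigmaOn _) _ _ (W.measurable_bs_sigmaOn rfl))
    (Network.measurable_marks (fun n => W.measurable_state_sigmaOn (by simp))
      (fun n => W.measurable_gainU_sigmaOn (by simp)) (W.measurable_er_sigmaOn (by simp))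
      (Network.measurable_eveMarks (fun j => W.measurable_gainE_sigmaOn (by simp))
        (fun j => W.measurable_field_sigmaOn (by simp))
        fun j k => W.measurable_gainI_sigmaOn (by simp)))

lemma indepFun_withBs (h : W.IsModel μ c) (x : ℕ → Plane) :
    IndepFun ((W.withBs x).sinrU c) ((W.withBs x).sinrMaxE c) μ := by
  let S : Set Source := range Source.state ∪ range Source.gainU
  refine h.indepFun_of_disjoint (S := S) (T := Sᶜ) _root_.disjoint_compl_right
    (Network.measurable_sinrU (fun n => measurable_const) (fun n => ?_) fun n => ?_)
    (Network.measurable_sinrMaxE (fun n => measurable_const) ?_ (fun j => ?_) (fun j => ?_)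
      fun j k => ?_)
  · exact W.measurable_state_sigmaOn (by simp [S])
  · exact W.measurable_gainU_sigmaOn (by simp [S])
  · exact W.measurable_er_sigmaOn (by simp [S])
  · exact W.measurable_gainE_sigmaOn (by simp [S])
  · exact W.measurable_field_sigmaOn (by simp [S])
  · exact W.measurable_gainI_sigmaOn (by simp [S])

variable [IsProbabilityMeasure μ]

lemma measure_sinrU_mem_and_sinrMaxE_mem (h : W.IsModel μ c) {A B : Set ℝ≥0∞}
    (hA : MeasurableSet A) (hB : MeasurableSet B) :
    μ {ω | W.sinrU c ω ∈ A ∧ W.sinrMaxE c ω ∈ B}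
      = ∫⁻ ω, μ ((W.withBs fun n => W.bs n ω).sinrU c ⁻¹' A)
          * μ ((W.withBs fun n => W.bs n ω).sinrMaxE c ⁻¹' B) ∂μ := by
  refine (measure_of_indepFun h.indepFun_bs_marks (measurable_pi_lambda _ h.bs_poisson.measurable)
    h.measurable_marks (D := canonical.sinrU c ⁻¹' A ∩ canonical.sinrMaxE c ⁻¹' B)
    ((measurable_canonical_sinrU hA).inter (measurable_canonical_sinrMaxE hB))).trans ?_
  exact lintegral_congr fun ω => (h.indepFun_withBs _).measure_inter_preimage_eq_mul _ _ hA hB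

lemma measure_sinrMaxE_withBs_le (h : W.IsModel μ c) (hc : c.InterferenceLimited) {γ : ℝ}
    (hγ : 0 < γ) (x : ℕ → Plane) :
    μ ((W.withBs x).sinrMaxE c ⁻¹' Iic (ENNReal.ofReal γ)) = ENNReal.ofReal (c.cdfE γ) := by
  have hset : (W.withBs x).sinrMaxE c ⁻¹' Iic (ENNReal.ofReal γ)
      = {ω | ∀ j, W.sinrEFrom c (x (nearest x)) (W.er j ω) j ω ≤ ENNReal.ofReal γ} := by
    ext ω
    simp [sinrMaxE, sinrE_withBs]
  rw [hset, Params.cdfE]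
  split_ifs with hγθ
  · exact h.measure_forall_sinrEFrom_le hc hγ hγθ _
  · simp [sinrEFrom, hc.sinrAt_le hγ.le (not_lt.1 hγθ)]

theorem measure_lt_sinrU_and_sinrMaxE_le (h : W.IsModel μ c) (hc : c.InterferenceLimited) {γ : ℝ}
    (hγ : 0 < γ) :
    μ {ω | ENNReal.ofReal γ < W.sinrU c ω ∧ W.sinrMaxE c ω ≤ ENNReal.ofReal γ}
      = ENNReal.ofReal (1 / (1 + c.totalZ γ)) * ENNReal.ofReal (c.cdfE γ) := by
  refine (h.measure_sinrU_mem_and_sinrMaxE_mem measurableSet_Ioi measurableSet_Iic).trans ?_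
  simp only [h.measure_sinrMaxE_withBs_le hc hγ]
  rw [lintegral_mul_const' _ _ ENNReal.ofReal_ne_top,
    ← h.bs_poisson.lintegral_expNeg_sumOthers_nearest hc.lamB_pos (Params.measurable_exponentU γ)
      (hc.monotoneOn_exponentU hγ.le) (hc.totalZ_nonneg hγ.le)
      fun r hr => hc.lintegral_compl_ball_exponentU hγ.le hr]
  congr 1
  refine lintegral_congr_ae ?_
  filter_upwards [h.bs_poisson.ae_forall_ne hc.lamB_pos.le 0] with ω hω
  exact h.measure_lt_sinrU_withBs hc hγ (hω _)

lemma measure_sinrMaxE_le (h : W.IsModel μ c) (hc : c.InterferenceLimited) {γ : ℝ} (hγ : 0 < γ) :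
    μ {ω | W.sinrMaxE c ω ≤ ENNReal.ofReal γ} = ENNReal.ofReal (c.cdfE γ) := by
  have hjoint := h.measure_sinrU_mem_and_sinrMaxE_mem MeasurableSet.univ
    (measurableSet_Iic (a := ENNReal.ofReal γ))
  simpa [h.measure_sinrMaxE_withBs_le hc hγ] using hjoint

end IsModel

end Network

/-! ### Convergence of the integrals -/

/- Since `g t ≤ 1` on `[0, g⁻¹]`, the denominator is at most `2` there. -/
lemma rpow_sub_one_div_le_integral {p g : ℝ} (hp : p < 1) (hg : 1 ≤ g) :
    g ^ (p - 1) / (2 * (1 - p)) ≤ ∫ t in (0 : ℝ)..1, t ^ (-p) / (1 + g * t) := by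
  have : 0 < g := by linarith
  have hi := intervalIntegrable_rpow_neg_div hp this.le
  have hginv : g⁻¹ ∈ Icc (0 : ℝ) 1 := ⟨by positivity, inv_le_one_of_one_le₀ hg⟩
  have hsub : uIcc (0 : ℝ) g⁻¹ ⊆ uIcc 0 1 := by
    rw [uIcc_of_le hginv.1, uIcc_of_le zero_le_one]
    exact Icc_subset_Icc_right hginv.2
  calc g ^ (p - 1) / (2 * (1 - p)) = ∫ t in (0 : ℝ)..g⁻¹, t ^ (-p) / 2 := by
        rw [intervalIntegral.integral_div, integral_rpow (Or.inl (by linarith)),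
          Real.zero_rpow (by linarith), sub_zero, Real.inv_rpow this.le, ← Real.rpow_neg this.le,
          neg_add_rev, neg_neg, neg_add_eq_sub, div_div, neg_add_eq_sub, mul_comm]
    _ ≤ ∫ t in (0 : ℝ)..g⁻¹, t ^ (-p) / (1 + g * t) := by
        refine intervalIntegral.integral_mono_on hginv.1
          ((intervalIntegral.intervalIntegrable_rpow' (by linarith)).div_const _)
          (hi.mono_set hsub) fun t ht => ?_
        have ht0 := ht.1
        have hgt : g * t ≤ 1 := (le_inv_mul_iff₀ this).1 (by simpa using ht.2)
        gcongr
        linarith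
    _ ≤ ∫ t in (0 : ℝ)..1, t ^ (-p) / (1 + g * t) := by
        refine intervalIntegral.integral_mono_interval le_rfl hginv.1 hginv.2 ?_ hi
        filter_upwards [ae_restrict_mem measurableSet_Ioc] with t ht
        have ht0 := ht.1
        rw [Pi.zero_apply]
        positivity

namespace Params

variable {c : Params}

/-- The constant in the lower bound of `Z`. -/
def growthZ (c : Params) : ℝ := 2 / c.β / (2 * (1 - 2 / c.β))

/-- Probability that a base station interferes at the user. -/
def probInterfere (c : Params) : ℝ := c.stateProb .secure + c.stateProb .normalUncached

/-- The density of the average secrecy rate, up to the factor `1 / log 2`, with respect to the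
threshold `γ`. -/
def rateIntegrand (c : Params) (γ : ℝ) : ℝ := c.cdfE γ * c.tailIntegrand γ

lemma measurable_Z (hβ : 2 < c.β) : Measurable c.Z := by
  have hZ : c.Z = fun g => 2 / c.β * g * ∫ t in Ioc (0 : ℝ) 1, t ^ (-(2 / c.β)) / (1 + g * t) :=
    funext fun g => by rw [Z_eq_integral hβ, intervalIntegral.integral_of_le zero_le_one]
  have hintegrand : Measurable fun x : ℝ × ℝ => x.2 ^ (-(2 / c.β)) / (1 + x.1 * x.2) := by fun_prop
  rw [hZ]
  exact (measurable_const_mul _).mul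
    hintegrand.stronglyMeasurable.integral_prod_right'.measurable

lemma measurable_totalZ (hβ : 2 < c.β) : Measurable c.totalZ :=
  ((measurable_Z hβ).mul_const _).add
    (((measurable_Z hβ).comp (measurable_id.div_const _)).mul_const _)

lemma tailIntegrand_eq (γ : ℝ) : c.tailIntegrand γ = 1 / (1 + γ) * (1 / (1 + c.totalZ γ)) := by
  rw [tailIntegrand, totalZ, add_comm (1 : ℝ) (_ + _), one_div_mul_one_div]

lemma measurable_tailIntegrand (hβ : 2 < c.β) : Measurable c.tailIntegrand := by
  have := measurable_totalZ hβ
  rw [funext tailIntegrand_eq]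
  fun_prop

lemma measurable_cdfE : Measurable c.cdfE := by
  refine Measurable.ite (measurableSet_lt measurable_const (by fun_prop)) ?_ measurable_const
  unfold probE sirThreshold
  fun_prop

lemma cdfE_nonneg (γ : ℝ) : 0 ≤ c.cdfE γ := by
  rw [cdfE, probE]
  split_ifs <;> positivity

lemma headSet_union_tailSet (c : Params) : c.headSet ∪ c.tailSet = Ioi 0 := by
  ext γ
  simp only [headSet, tailSet, mem_union, mem_ofPred_eq, mem_Ioi, ← and_or_left, lt_or_ge, and_true]

lemma disjoint_headSet_tailSet : Disjoint c.headSet c.tailSet :=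
  disjoint_left.2 fun _ hhead htail => not_lt.2 htail.2 hhead.2

lemma measurableSet_headSet : MeasurableSet c.headSet :=
  measurableSet_Ioi.inter (measurableSet_lt ENNReal.measurable_ofReal measurable_const)

lemma measurableSet_tailSet : MeasurableSet c.tailSet :=
  measurableSet_Ioi.inter (measurableSet_le measurable_const ENNReal.measurable_ofReal)

namespace InterferenceLimited

lemma growthZ_pos (hc : c.InterferenceLimited) : 0 < c.growthZ :=
  div_pos hc.two_div_β_mem_Ioo.1 (by linarith [hc.two_div_β_mem_Ioo.2])

lemma growthZ_mul_rpow_le_Z (hc : c.InterferenceLimited) {g : ℝ} (hg : 1 ≤ g) :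
    c.growthZ * g ^ (2 / c.β) ≤ c.Z g := by
  have ⟨hpos, hlt⟩ := hc.two_div_β_mem_Ioo
  have : 0 < g := by linarith
  calc c.growthZ * g ^ (2 / c.β)
      = 2 / c.β * g * (g ^ (2 / c.β - 1) / (2 * (1 - 2 / c.β))) := by
        rw [Real.rpow_sub_one this.ne', growthZ]
        field_simp
    _ ≤ c.Z g := by
        rw [Z_eq_integral hc.two_lt_β]
        gcongr
        exact rpow_sub_one_div_le_integral hlt hg

lemma probInterfere_pos (hc : c.InterferenceLimited) : 0 < c.probInterfere := by
  rw [probInterfere, stateProb, stateProb, ← add_div]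
  refine div_pos ?_ hc.sum_requestShare_pos
  simp only [requestShare]
  linarith [hc.δ_lt_one]

lemma probInterfere_mul_le_totalZ (hc : c.InterferenceLimited) {γ : ℝ} (hγ : 1 ≤ γ) :
    c.probInterfere * (c.growthZ * γ ^ (2 / c.β)) ≤ c.totalZ γ := by
  have hγθ : γ ≤ γ / c.θ := le_div_self (by linarith) hc.θ_pos hc.θ_le_one
  have := hc.growthZ_pos
  have hpow : γ ^ (2 / c.β) ≤ (γ / c.θ) ^ (2 / c.β) :=
    Real.rpow_le_rpow (by linarith) hγθ hc.two_div_β_mem_Ioo.1.le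
  have hZθ : c.growthZ * γ ^ (2 / c.β) ≤ c.Z (γ / c.θ) :=
    (mul_le_mul_of_nonneg_left hpow this.le).trans (hc.growthZ_mul_rpow_le_Z (hγ.trans hγθ))
  rw [hc.totalZ_eq, probInterfere, add_mul]
  exact add_le_add
    (mul_le_mul_of_nonneg_left (hc.growthZ_mul_rpow_le_Z hγ) (hc.stateProb_nonneg _))
    (mul_le_mul_of_nonneg_left hZθ (hc.stateProb_nonneg _))

lemma tendsto_totalZ (hc : c.InterferenceLimited) :
    Tendsto c.totalZ atTop atTop := by
  refine tendsto_atTop_mono' _ ?_ (((tendsto_rpow_atTop hc.two_div_β_mem_Ioo.1).const_mul_atTop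
    hc.growthZ_pos).const_mul_atTop hc.probInterfere_pos)
  filter_upwards [eventually_ge_atTop 1] with γ hγ using hc.probInterfere_mul_le_totalZ hγ

lemma tailIntegrand_nonneg (hc : c.InterferenceLimited) {γ : ℝ} (hγ : 0 ≤ γ) :
    0 ≤ c.tailIntegrand γ := by
  have := hc.totalZ_nonneg hγ
  rw [tailIntegrand_eq]
  positivity

lemma tailIntegrand_le_one (hc : c.InterferenceLimited) {γ : ℝ} (hγ : 0 ≤ γ) :
    c.tailIntegrand γ ≤ 1 := by
  have htotal := hc.totalZ_nonneg hγ
  rw [tailIntegrand_eq]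
  exact mul_le_one₀ (one_div_one_add_le_one hγ) (by positivity) (one_div_one_add_le_one htotal)

lemma tailIntegrand_le_rpow (hc : c.InterferenceLimited) {γ : ℝ} (hγ : 1 ≤ γ) :
    c.tailIntegrand γ ≤ 1 / (c.probInterfere * c.growthZ) * γ ^ (-1 - 2 / c.β) := by
  have : 0 < γ := by linarith
  have := hc.probInterfere_pos
  have := hc.growthZ_pos
  have hle := hc.probInterfere_mul_le_totalZ hγ
  calc c.tailIntegrand γ = 1 / (1 + γ) * (1 / (1 + c.totalZ γ)) := tailIntegrand_eq γ
    _ ≤ 1 / γ * (1 / (c.probInterfere * (c.growthZ * γ ^ (2 / c.β)))) := by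
        have := hc.totalZ_nonneg (by linarith : 0 ≤ γ)
        gcongr <;> linarith
    _ = 1 / (c.probInterfere * c.growthZ) * γ ^ (-1 - 2 / c.β) := by
        rw [Real.rpow_sub (by positivity), Real.rpow_neg_one]
        field_simp

lemma integrableOn_tailIntegrand_Ioi (hc : c.InterferenceLimited) :
    IntegrableOn c.tailIntegrand (Ioi 0) := by
  have hmeas := measurable_tailIntegrand hc.two_lt_β
  rw [← Ioc_union_Ioi_eq_Ioi (zero_le_one' ℝ)]
  refine IntegrableOn.union ?_ ?_
  · refine Integrable.mono' (g := fun _ => (1 : ℝ)) (integrable_const _) hmeas.aestronglyMeasurable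
      ((ae_restrict_mem measurableSet_Ioc).mono fun γ hγ => ?_)
    rw [Real.norm_of_nonneg (hc.tailIntegrand_nonneg hγ.1.le)]
    exact hc.tailIntegrand_le_one hγ.1.le
  · refine Integrable.mono' ((integrableOn_Ioi_rpow_of_lt (a := -1 - 2 / c.β)
      (by linarith [hc.two_div_β_mem_Ioo.1]) zero_lt_one).const_mul
      (1 / (c.probInterfere * c.growthZ))) hmeas.aestronglyMeasurable
      ((ae_restrict_mem measurableSet_Ioi).mono fun γ (hγ : 1 < γ) => ?_)
    rw [Real.norm_of_nonneg (hc.tailIntegrand_nonneg (by linarith))]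
    exact hc.tailIntegrand_le_rpow hγ.le

lemma lt_gammaTh0_iff (hc : c.InterferenceLimited) (γ : ℝ) :
    ENNReal.ofReal γ < c.gammaTh0 ↔ 0 < c.θ - (1 - c.θ) * γ := by
  have := hc.θ_pos
  rcases hc.θ_le_one.eq_or_lt with hθ | hθ
  · simp [gammaTh0, hθ]
  · have hpos : 0 < 1 - c.θ := by linarith
    rw [gammaTh0, ← ENNReal.ofReal_div_of_pos hpos, ENNReal.ofReal_lt_ofReal_iff (by positivity),
      lt_div_iff₀ hpos, sub_pos, mul_comm]

lemma cdfE_le_one (hc : c.InterferenceLimited) {γ : ℝ} (hγ : 0 ≤ γ) : c.cdfE γ ≤ 1 := by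
  rw [cdfE]
  split_ifs with hγθ
  · have := hc.gammaFactor_pos
    have := hc.lamB_pos
    have := hc.lamE_pos
    have : 0 ≤ c.sirThreshold γ := div_nonneg hγ hγθ.le
    rw [probE, Real.exp_le_one_iff, neg_nonpos]
    positivity
  · exact le_rfl

lemma tendsto_cdfE (hc : c.InterferenceLimited) : Tendsto c.cdfE atTop (𝓝 1) := by
  rcases hc.θ_le_one.eq_or_lt with hθ | hθ
  · have hcdf (γ : ℝ) :
        c.cdfE γ = Real.exp (-(c.lamE / c.lamB / (c.gammaFactor * γ ^ (2 / c.β)))) := by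
      simp [cdfE, probE, sirThreshold, hθ]
    have hpow : Tendsto (fun γ : ℝ => c.gammaFactor * γ ^ (2 / c.β)) atTop atTop :=
      (tendsto_rpow_atTop hc.two_div_β_mem_Ioo.1).const_mul_atTop hc.gammaFactor_pos
    rw [funext hcdf]
    simpa using (hpow.const_div_atTop (c.lamE / c.lamB)).neg.rexp
  · refine tendsto_const_nhds.congr' ?_
    filter_upwards [eventually_ge_atTop (c.θ / (1 - c.θ))] with γ hγ
    rw [div_le_iff₀ (by linarith)] at hγ
    rw [cdfE, if_neg (by linarith)]

lemma rateIntegrand_nonneg (hc : c.InterferenceLimited) {γ : ℝ} (hγ : 0 ≤ γ) :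
    0 ≤ c.rateIntegrand γ :=
  mul_nonneg (cdfE_nonneg γ) (hc.tailIntegrand_nonneg hγ)

lemma integrableOn_rateIntegrand (hc : c.InterferenceLimited) :
    IntegrableOn c.rateIntegrand (Ioi 0) := by
  refine Integrable.mono' hc.integrableOn_tailIntegrand_Ioi
    (measurable_cdfE.mul (measurable_tailIntegrand hc.two_lt_β)).aestronglyMeasurable
    ((ae_restrict_mem measurableSet_Ioi).mono fun γ (hγ : 0 < γ) => ?_)
  rw [Real.norm_of_nonneg (hc.rateIntegrand_nonneg hγ.le)]
  exact mul_le_of_le_one_left (hc.tailIntegrand_nonneg hγ.le) (hc.cdfE_le_one hγ.le)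

lemma eqOn_headIntegrand (hc : c.InterferenceLimited) :
    EqOn c.rateIntegrand c.headIntegrand c.headSet := fun γ hγ => by
  rw [rateIntegrand, cdfE, if_pos ((hc.lt_gammaTh0_iff γ).1 hγ.2), tailIntegrand, mul_one_div]
  rfl

lemma eqOn_tailIntegrand (hc : c.InterferenceLimited) :
    EqOn c.rateIntegrand c.tailIntegrand c.tailSet := fun γ hγ => by
  rw [rateIntegrand, cdfE, if_neg ((hc.lt_gammaTh0_iff γ).not.1 hγ.2.not_gt), one_mul]

lemma integrableOn_headIntegrand (hc : c.InterferenceLimited) :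
    IntegrableOn c.headIntegrand c.headSet :=
  (hc.integrableOn_rateIntegrand.mono_set
    (c.headSet_union_tailSet ▸ subset_union_left)).congr_fun hc.eqOn_headIntegrand
    measurableSet_headSet

lemma integrableOn_tailIntegrand (hc : c.InterferenceLimited) :
    IntegrableOn c.tailIntegrand c.tailSet :=
  hc.integrableOn_tailIntegrand_Ioi.mono_set (c.headSet_union_tailSet ▸ subset_union_right)

lemma integral_rateIntegrand (hc : c.InterferenceLimited) :
    ∫ γ in Ioi 0, c.rateIntegrand γ
      = (∫ γ in c.headSet, c.headIntegrand γ) + ∫ γ in c.tailSet, c.tailIntegrand γ := by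
  have hint := hc.integrableOn_rateIntegrand
  rw [← c.headSet_union_tailSet] at hint ⊢
  rw [setIntegral_union disjoint_headSet_tailSet measurableSet_tailSet hint.left_of_union
    hint.right_of_union, setIntegral_congr_fun measurableSet_headSet hc.eqOn_headIntegrand,
    setIntegral_congr_fun measurableSet_tailSet hc.eqOn_tailIntegrand]

end InterferenceLimited

end Params

/-! ### The average secrecy rate -/

lemma setOf_ofReal_lt_and_le_inter_Ioi_ae_eq (u e : ℝ≥0) :
    ({γ | ENNReal.ofReal γ < u ∧ (e : ℝ≥0∞) ≤ ENNReal.ofReal γ} ∩ Ioi 0 : Set ℝ)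
      =ᵐ[volume] Ioc (e : ℝ) u := by
  have hIco : ({γ | ENNReal.ofReal γ < u ∧ (e : ℝ≥0∞) ≤ ENNReal.ofReal γ} ∩ Ioi 0 : Set ℝ)
      = Ico (e : ℝ) u ∩ Ioi 0 := by
    ext γ
    refine and_congr_left fun (hγ : 0 < γ) => ?_
    rw [mem_ofPred_eq, ← ENNReal.ofReal_coe_nnreal (p := u), ← ENNReal.ofReal_coe_nnreal (p := e),
      ENNReal.ofReal_lt_ofReal_iff_of_nonneg hγ.le, ENNReal.ofReal_le_ofReal_iff hγ.le, and_comm,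
      mem_Ico]
  have hIoc : Ioc (e : ℝ) u ∩ Ioi 0 = Ioc (e : ℝ) u :=
    inter_eq_left.2 fun γ hγ => e.coe_nonneg.trans_lt hγ.1
  rw [hIco]
  exact (Ico_ae_eq_Ioc.inter (ae_eq_refl _)).trans hIoc.eventuallyEq

lemma hasDerivAt_logb_one_add {b x : ℝ} (hx : 0 < 1 + x) :
    HasDerivAt (fun x => Real.logb b (1 + x)) (1 / (1 + x) * (1 / Real.log b)) x := by
  have := (((hasDerivAt_id x).const_add 1).log hx.ne').div_const (Real.log b)
  exact this.congr_deriv (by simp only [id_eq, div_eq_mul_inv, one_mul])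

lemma lintegral_Ioc_one_div_one_add {b x y : ℝ} (hb : 1 < b) (hx : 0 ≤ x) (hy : 0 ≤ y) :
    ∫⁻ t in Ioc x y, ENNReal.ofReal (1 / (1 + t) * (1 / Real.log b))
      = ENNReal.ofReal (max (Real.logb b (1 + y) - Real.logb b (1 + x)) 0) := by
  have hlog : 0 < Real.log b := Real.log_pos hb
  rcases le_total x y with hxy | hyx
  · have hpos : ∀ t ∈ uIcc x y, 0 < 1 + t := fun t ht => by
      rw [uIcc_of_le hxy] at ht
      linarith [ht.1]
    have hcont : ContinuousOn (fun t : ℝ => 1 / (1 + t) * (1 / Real.log b)) (uIcc x y) :=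
      (continuousOn_const.div (by fun_prop) fun t ht => (hpos t ht).ne').mul continuousOn_const
    have hint := hcont.intervalIntegrable (μ := volume)
    have hFTC := intervalIntegral.integral_eq_sub_of_hasDerivAt
      (fun t ht => hasDerivAt_logb_one_add (b := b) (hpos t ht)) hint
    have hnonneg : ∀ t ∈ Ioc x y, 0 ≤ 1 / (1 + t) * (1 / Real.log b) := fun t ht => by
      have : 0 < 1 + t := by linarith [ht.1]
      positivity
    rw [intervalIntegral.integral_of_le hxy] at hFTC
    rw [← ofReal_integral_eq_lintegral_ofReal
      ((intervalIntegrable_iff_integrableOn_Ioc_of_le hxy).1 hint)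
      ((ae_restrict_mem measurableSet_Ioc).mono hnonneg), hFTC, max_eq_left]
    exact sub_nonneg.2 (Real.logb_le_logb_of_le hb (by linarith) (by linarith))
  · rw [Ioc_eq_empty hyx.not_gt, Measure.restrict_empty, lintegral_zero_measure, max_eq_right,
      ENNReal.ofReal_zero]
    exact sub_nonpos.2 (Real.logb_le_logb_of_le hb (by linarith) (by linarith))

lemma lintegral_indicator_one_div_one_add {b : ℝ} (hb : 1 < b) {u e : ℝ≥0∞} (hu : u ≠ ∞)
    (he : e ≠ ∞) :
    ∫⁻ γ in Ioi (0 : ℝ), {γ | ENNReal.ofReal γ < u ∧ e ≤ ENNReal.ofReal γ}.indicator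
        (fun γ => ENNReal.ofReal (1 / (1 + γ) * (1 / Real.log b))) γ
      = ENNReal.ofReal (max (Real.logb b (1 + u.toReal) - Real.logb b (1 + e.toReal)) 0) := by
  lift u to ℝ≥0 using hu
  lift e to ℝ≥0 using he
  have hmeas : MeasurableSet {γ | ENNReal.ofReal γ < (u : ℝ≥0∞) ∧ (e : ℝ≥0∞) ≤ ENNReal.ofReal γ} :=
    (measurableSet_lt ENNReal.measurable_ofReal measurable_const).inter
      (measurableSet_le measurable_const ENNReal.measurable_ofReal)
  rw [lintegral_indicator hmeas, Measure.restrict_restrict hmeas,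
    Measure.restrict_congr_set (setOf_ofReal_lt_and_le_inter_Ioi_ae_eq u e), ENNReal.coe_toReal,
    ENNReal.coe_toReal, lintegral_Ioc_one_div_one_add hb e.coe_nonneg u.coe_nonneg]

namespace Network

variable {Ω : Type*} {W : Network Ω} {c : Params}

lemma secrecyRate_nonneg (ω : Ω) : 0 ≤ W.secrecyRate c ω := le_max_right _ _

namespace IsModel

variable [MeasurableSpace Ω] {μ : Measure Ω}

lemma measurable_secrecyRate (h : W.IsModel μ c) : Measurable (W.secrecyRate c) := by
  have hu := h.measurable_sinrU.ennreal_toReal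
  have he := h.measurable_sinrMaxE.ennreal_toReal
  exact (((hu.const_add 1).log.div_const _).sub ((he.const_add 1).log.div_const _)).max
    measurable_const

lemma measurable_indicator_one_div_one_add (h : W.IsModel μ c) :
    Measurable (Function.uncurry fun (ω : Ω) (γ : ℝ) =>
      {γ | ENNReal.ofReal γ < W.sinrU c ω ∧ W.sinrMaxE c ω ≤ ENNReal.ofReal γ}.indicator
        (fun γ => ENNReal.ofReal (1 / (1 + γ) * (1 / Real.log 2))) γ) := by
  have hmeas : MeasurableSet {x : Ω × ℝ | ENNReal.ofReal x.2 < W.sinrU c x.1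
      ∧ W.sinrMaxE c x.1 ≤ ENNReal.ofReal x.2} :=
    (measurableSet_lt (by fun_prop) (h.measurable_sinrU.comp measurable_fst)).inter
      (measurableSet_le (h.measurable_sinrMaxE.comp measurable_fst) (by fun_prop))
  exact Measurable.indicator (f := fun x : Ω × ℝ =>
    ENNReal.ofReal (1 / (1 + x.2) * (1 / Real.log 2))) (by fun_prop) hmeas

variable [IsProbabilityMeasure μ]

lemma ae_sinrMaxE_ne_top (h : W.IsModel μ c) (hc : c.InterferenceLimited) :
    ∀ᵐ ω ∂μ, W.sinrMaxE c ω ≠ ∞ := by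
  have hlim : Tendsto (fun γ => 1 - ENNReal.ofReal (c.cdfE γ)) atTop (𝓝 0) := by
    rw [← tsub_self 1]
    exact ENNReal.Tendsto.sub tendsto_const_nhds
      (ENNReal.ofReal_one ▸ ENNReal.tendsto_ofReal hc.tendsto_cdfE) (.inl ENNReal.one_ne_top)
  rw [ae_iff]
  simp only [not_not]
  refine le_antisymm (ge_of_tendsto hlim ?_) bot_le
  filter_upwards [eventually_gt_atTop 0] with γ hγ
  have hmeas : MeasurableSet {ω | W.sinrMaxE c ω ≤ ENNReal.ofReal γ} :=
    h.measurable_sinrMaxE measurableSet_Iic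
  rw [← h.measure_sinrMaxE_le hc hγ, ← prob_compl_eq_one_sub hmeas]
  refine measure_mono fun ω (hω : W.sinrMaxE c ω = ∞) => ?_
  simp [hω]

lemma ae_sinrU_ne_top (h : W.IsModel μ c) (hc : c.InterferenceLimited) :
    ∀ᵐ ω ∂μ, W.sinrU c ω ≠ ∞ := by
  have hlim : Tendsto (fun γ => ENNReal.ofReal (1 / (1 + c.totalZ γ))) atTop (𝓝 0) := by
    rw [← ENNReal.ofReal_zero]
    exact ENNReal.tendsto_ofReal
      ((tendsto_atTop_add_const_left _ _ hc.tendsto_totalZ).const_div_atTop 1)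
  have hbounded : ∀ n : ℕ, ∀ᵐ ω ∂μ, ¬ (W.sinrU c ω = ∞ ∧ W.sinrMaxE c ω ≤ n) := by
    intro n
    rw [ae_iff]
    simp only [not_not]
    refine le_antisymm (ge_of_tendsto hlim ?_) bot_le
    filter_upwards [eventually_gt_atTop 0, eventually_ge_atTop (n : ℝ)] with γ hγ hnγ
    calc μ {ω | W.sinrU c ω = ∞ ∧ W.sinrMaxE c ω ≤ n}
        ≤ μ {ω | ENNReal.ofReal γ < W.sinrU c ω ∧ W.sinrMaxE c ω ≤ ENNReal.ofReal γ} :=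
          measure_mono fun ω hω => ⟨hω.1 ▸ ENNReal.ofReal_lt_top,
            hω.2.trans (ENNReal.ofReal_natCast n ▸ ENNReal.ofReal_le_ofReal hnγ)⟩
      _ = ENNReal.ofReal (1 / (1 + c.totalZ γ)) * ENNReal.ofReal (c.cdfE γ) :=
          h.measure_lt_sinrU_and_sinrMaxE_le hc hγ
      _ ≤ ENNReal.ofReal (1 / (1 + c.totalZ γ)) :=
          mul_le_of_le_one_right' (ENNReal.ofReal_le_one.2 (hc.cdfE_le_one hγ.le))
  filter_upwards [h.ae_sinrMaxE_ne_top hc, ae_all_iff.2 hbounded] with ω he hω hu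
  obtain ⟨n, hn⟩ := ENNReal.exists_nat_gt he
  exact hω n ⟨hu, hn.le⟩

lemma lintegral_indicator_one_div_one_add (h : W.IsModel μ c) (hc : c.InterferenceLimited) {γ : ℝ}
    (hγ : 0 < γ) :
    ∫⁻ ω, {γ | ENNReal.ofReal γ < W.sinrU c ω ∧ W.sinrMaxE c ω ≤ ENNReal.ofReal γ}.indicator
        (fun γ => ENNReal.ofReal (1 / (1 + γ) * (1 / Real.log 2))) γ ∂μ
      = ENNReal.ofReal (1 / Real.log 2 * c.rateIntegrand γ) := by
  have : 0 < Real.log 2 := Real.log_pos one_lt_two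
  have := hc.totalZ_nonneg hγ.le
  have hmeas : MeasurableSet {ω | ENNReal.ofReal γ < W.sinrU c ω
      ∧ W.sinrMaxE c ω ≤ ENNReal.ofReal γ} :=
    (measurableSet_lt measurable_const h.measurable_sinrU).inter
      (measurableSet_le h.measurable_sinrMaxE measurable_const)
  refine (lintegral_indicator_const (μ := μ) hmeas
    (ENNReal.ofReal (1 / (1 + γ) * (1 / Real.log 2)))).trans ?_
  rw [h.measure_lt_sinrU_and_sinrMaxE_le hc hγ, ← ENNReal.ofReal_mul (by positivity),
    ← ENNReal.ofReal_mul (by positivity), Params.rateIntegrand, Params.tailIntegrand_eq]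
  congr 1
  ring

lemma lintegral_secrecyRate (h : W.IsModel μ c) (hc : c.InterferenceLimited) :
    ∫⁻ ω, ENNReal.ofReal (W.secrecyRate c ω) ∂μ
      = ENNReal.ofReal (1 / Real.log 2 * ∫ γ in Ioi 0, c.rateIntegrand γ) := by
  calc ∫⁻ ω, ENNReal.ofReal (W.secrecyRate c ω) ∂μ
      = ∫⁻ ω, (∫⁻ γ in Ioi (0 : ℝ), {γ | ENNReal.ofReal γ < W.sinrU c ω
          ∧ W.sinrMaxE c ω ≤ ENNReal.ofReal γ}.indicator
            (fun γ => ENNReal.ofReal (1 / (1 + γ) * (1 / Real.log 2))) γ) ∂μ := by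
        refine lintegral_congr_ae ?_
        filter_upwards [h.ae_sinrMaxE_ne_top hc, h.ae_sinrU_ne_top hc] with ω he hu
        exact (CacheNet.lintegral_indicator_one_div_one_add one_lt_two hu he).symm
    _ = ∫⁻ γ in Ioi (0 : ℝ), ∫⁻ ω, {γ | ENNReal.ofReal γ < W.sinrU c ω
          ∧ W.sinrMaxE c ω ≤ ENNReal.ofReal γ}.indicator
            (fun γ => ENNReal.ofReal (1 / (1 + γ) * (1 / Real.log 2))) γ ∂μ :=
        lintegral_lintegral_swap h.measurable_indicator_one_div_one_add.aemeasurable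
    _ = ∫⁻ γ in Ioi (0 : ℝ), ENNReal.ofReal (1 / Real.log 2 * c.rateIntegrand γ) :=
        setLIntegral_congr_fun measurableSet_Ioi fun _ hγ =>
          h.lintegral_indicator_one_div_one_add hc hγ
    _ = ENNReal.ofReal (1 / Real.log 2 * ∫ γ in Ioi 0, c.rateIntegrand γ) := by
        have hlog : 0 ≤ 1 / Real.log 2 := one_div_nonneg.2 (Real.log_nonneg one_le_two)
        rw [← integral_const_mul, ofReal_integral_eq_lintegral_ofReal
          (hc.integrableOn_rateIntegrand.const_mul _)]
        exact (ae_restrict_mem measurableSet_Ioi).mono fun γ hγ =>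
          mul_nonneg hlog (hc.rateIntegrand_nonneg (le_of_lt hγ))

end IsModel

end Network

end CacheNet

end

theorem theorem1_general {Ω : Type*} [MeasurableSpace Ω] (μ : Measure Ω) [IsProbabilityMeasure μ]
    (c : CacheNet.Params) (hc : c.InterferenceLimited)
    (W : CacheNet.Network Ω) (hW : W.IsModel μ c) :
    Integrable (W.secrecyRate c) μ ∧
    IntegrableOn c.headIntegrand c.headSet ∧
    IntegrableOn c.tailIntegrand c.tailSet ∧
    ∫ ω, W.secrecyRate c ω ∂μ =
      1 / Real.log 2 * (∫ γ in c.headSet, c.headIntegrand γ)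
        + 1 / Real.log 2 * (∫ γ in c.tailSet, c.tailIntegrand γ) := by
  have hrate := hW.lintegral_secrecyRate hc
  have hnonneg : 0 ≤ᵐ[μ] W.secrecyRate c := .of_forall CacheNet.Network.secrecyRate_nonneg
  have hmeas := hW.measurable_secrecyRate.aestronglyMeasurable (μ := μ)
  refine ⟨(lintegral_ofReal_ne_top_iff_integrable hmeas hnonneg).1 (hrate ▸ ENNReal.ofReal_ne_top),
    hc.integrableOn_headIntegrand, hc.integrableOn_tailIntegrand, ?_⟩
  rw [integral_eq_lintegral_of_nonneg_ae hnonneg hmeas, hrate, ENNReal.toReal_ofReal,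
    hc.integral_rateIntegrand, mul_add]
  exact mul_nonneg (one_div_nonneg.2 (Real.log_nonneg one_le_two))
    (setIntegral_nonneg measurableSet_Ioi fun γ hγ => hc.rateIntegrand_nonneg (le_of_lt hγ))

theorem theorem1 {Ω : Type*} [MeasurableSpace Ω] (μ : Measure Ω) [IsProbabilityMeasure μ]
    (c : CacheNet.Params) (hc : c.Valid) (hδ : c.δ < 1) (hσ : c.σ2 = 0)
    (W : CacheNet.Network Ω) (hW : W.IsModel μ c) :
    Integrable (W.secrecyRate c) μ ∧
    IntegrableOn c.headIntegrand c.headSet ∧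
    IntegrableOn c.tailIntegrand c.tailSet ∧
    ∫ ω, W.secrecyRate c ω ∂μ =
      1 / Real.log 2 * (∫ γ in c.headSet, c.headIntegrand γ)
        + 1 / Real.log 2 * (∫ γ in c.tailSet, c.tailIntegrand γ) :=
  theorem1_general μ c (hc.interferenceLimited hδ hσ) W hW
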